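/- \textbf{Definitions.} A \emph{cofibration category} is a category $\mathcal C$ with two classes of morphisms, cofibrations ($\rightarrowtail$) and weak equivalences, such that: (1) isomorphisms are weak equivalences and weak equivalences have the 2-out-of-3 property; (2) isomorphisms are cofibrations and cofibrations are closed under composition; (3) every diagram $Y\leftarrowtail X\to Z$ with $X\rightarrowtail Y$ a cofibration has a pushout, and $Z\to Y\cup_X Z$ is a cofibration, which is also a weak equivalence if $X\rightarrowtail Y$ is; (4) there is an initial object and every morphism from an initial object is a cofibration; (5) every morphism is a cofibration followed by a weak equivalence. It is \emph{pointed} if it has a zero object $*$. Let $\gamma\colon\mathcal C\to\mathrm{Ho}(\mathcal C)$ be the localization at the weak equivalences and, for a cofibration $X\rightarrowtail Y$, put $Y/X = Y\cup_X *$. Fix for every object $X$ a cone, i.e. a cofibration $X\rightarrowtail CX$ with $CX\to *$ a weak equivalence, and let $\Sigma X = CX/X$. For $f\colon X\to Y$ there are a cofibration $CX\cup_X CY\rightarrowtail\bar C$ such that the induced $CY\to\bar C$ is a cofibration and a weak equivalence, and $\Sigma f=\gamma(CX/X\to\bar C/Y\xleftarrow{\sim}CY/Y)$ is independent of the choice of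 $\bar C$; this induces a functor $\Sigma\colon\mathrm{Ho}(\mathcal C)\to\mathrm{Ho}(\mathcal C)$, and $\mathcal C$ is \emph{stable} if this functor is an equivalence. For a cofibration $f\colon X\rightarrowtail Y$ the \emph{connecting morphism} is $\delta(f)=\gamma(Y/X\xleftarrow{\sim}CX\cup_X Y\to\Sigma X)$, and $X\xrightarrow{\gamma(f)}Y\to Y/X\xrightarrow{\delta(f)}\Sigma X$ is an \emph{elementary exact triangle}. A commutative square with edges $g\colon T\to V$, $f\colon T\to U$, $f'\colon V\to X$, $g'\colon U\to X$ in a triangulated category is \emph{homotopy cartesian} if there is an exact triangle $$T\xrightarrow{\binom{f}{-g}}U\oplus V\xrightarrow{(g'\ f')}X\xrightarrow{\partial}\Sigma T .$$ A triangulated category is \emph{strongly triangulated} if, for every composition $X\xrightarrow{f}Y\xrightarrow{g}Z$ and every choice of exact triangles $X\xrightarrow{f}Y\xrightarrow{f'}U\xrightarrow{f''}\Sigma X$, $Y\xrightarrow{g}Z\xrightarrow{g'}W\xrightarrow{g''}\Sigma Y$, $X\xrightarrow{gf}Z\xrightarrow{h'}V\xrightarrow{h''}\Sigma X$, the morphisms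 $j\colon U\to V$ and $j'\colon V\to W$ of the octahedral axiom (so that $jf'=h'g$, $h''j=f''$, $j'h'=g'$, $(\Sigma f)h''=g''j'$ and $U\xrightarrow{j}V\xrightarrow{j'}W\xrightarrow{(\Sigma f')g''}\Sigma U$ is exact) can be chosen such that the squares with corners $Y,U,Z,V$ and $V,\Sigma X,W,\Sigma Y$ are homotopy cartesian. \textbf{Statement.} Let $\mathcal C$ be a stable (pointed) cofibration category. Then $\mathrm{Ho}(\mathcal C)$ with the suspension $\Sigma$ and, as exact triangles, the triangles isomorphic to an elementary exact triangle is a triangulated category, and: (a) for every composition of cofibrations $X\overset{f}{\rightarrowtail}Y\overset{g}{\rightarrowtail}Z$ in $\mathcal C$ the squares $$\begin{array}{ccc}Y&\to&Y/X\\ {\scriptstyle\gamma(g)}\downarrow&&\downarrow\\ Z&\to&Z/X\end{array}\qquad\text{and}\qquad\begin{array}{ccc}Z/X&\xrightarrow{\delta(gf)}&\Sigma X\\ \downarrow&&\downarrow{\scriptstyle\Sigma f}\\ Z/Y&\xrightarrow{\delta(g)}&\Sigma Y\end{array}$$ are homotopy cartesian in $\mathrm{Ho}(\mathcal C)$; (b)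 $\mathrm{Ho}(\mathcal C)$ is strongly triangulated. -/

import Mathlib

open CategoryTheory Limits HomotopicalAlgebra Pretriangulated
open scoped ZeroObject

universe v u

noncomputable section

/-! ### Cofibration categories -/

/-- A cofibration category: a category with two classes of morphisms, the cofibrations and the weak
equivalences. Stability under cobase change is about arbitrary pushout squares. -/
class CofibrationCategory (C : Type u) [Category.{v} C] extends
    CategoryWithCofibrations C, CategoryWithWeakEquivalences C where
  /-- isomorphisms are weak equivalences -/
  isomorphisms_le_weq : MorphismProperty.isomorphisms C ≤ HomotopicalAlgebra.weakEquivalences C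
  /-- weak equivalences have the 2-out-of-3 property -/
  weq_two_out_of_three : (HomotopicalAlgebra.weakEquivalences C).HasTwoOutOfThreeProperty
  /-- isomorphisms are cofibrations -/
  isomorphisms_le_cof : MorphismProperty.isomorphisms C ≤ HomotopicalAlgebra.cofibrations C
  /-- cofibrations are closed under composition -/
  cof_comp : (HomotopicalAlgebra.cofibrations C).IsStableUnderComposition
  /-- pushouts along cofibrations exist -/
  hasPushout_of_cof : ∀ {X Y Z : C} (i : X ⟶ Y) (f : X ⟶ Z),
    HomotopicalAlgebra.cofibrations C i → HasPushout i f
  /-- cofibrations are stable under cobase change -/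
  cof_cobaseChange : (HomotopicalAlgebra.cofibrations C).IsStableUnderCobaseChange
  /-- acyclic cofibrations are stable under cobase change -/
  acyclic_cobaseChange : (HomotopicalAlgebra.trivialCofibrations C).IsStableUnderCobaseChange
  /-- there is an initial object -/
  hasInitial : HasInitial C
  /-- every morphism from an initial object is a cofibration -/
  cof_of_isInitial : ∀ {X Y : C} (f : X ⟶ Y), IsInitial X → HomotopicalAlgebra.cofibrations C f
  /-- every morphism is a cofibration followed by a weak equivalence -/
  factorization :
    (HomotopicalAlgebra.cofibrations C).HasFactorization (HomotopicalAlgebra.weakEquivalences C)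

namespace CofibrationCategory

/-- The homotopy category: the localization at the weak equivalences. -/
abbrev Ho (C : Type u) [Category.{v} C] [CofibrationCategory C] : Type u :=
  (weakEquivalences C).Localization

/-- The localization functor. -/
abbrev γ (C : Type u) [Category.{v} C] [CofibrationCategory C] : C ⥤ Ho C :=
  (weakEquivalences C).Q

section Basic

variable {C : Type u} [Category.{v} C] [CofibrationCategory C] {X Y Z P : C}

/-- The inverse in the homotopy category of (the image of) a weak equivalence. -/
def γInv (w : X ⟶ Y) (hw : weakEquivalences C w) : (γ C).obj Y ⟶ (γ C).obj X :=
  (Localization.Construction.wIso w hw).inv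

lemma γ_γInv (w : X ⟶ Y) (hw : weakEquivalences C w) : (γ C).map w ≫ γInv w hw = 𝟙 _ :=
  (Localization.Construction.wIso w hw).hom_inv_id

lemma γInv_γ (w : X ⟶ Y) (hw : weakEquivalences C w) : γInv w hw ≫ (γ C).map w = 𝟙 _ :=
  (Localization.Construction.wIso w hw).inv_hom_id

lemma isIso_γ (w : X ⟶ Y) (hw : weakEquivalences C w) : IsIso ((γ C).map w) :=
  ⟨γInv w hw, γ_γInv w hw, γInv_γ w hw⟩

lemma cof_trans {f : X ⟶ Y} {g : Y ⟶ Z} (hf : cofibrations C f) (hg : cofibrations C g) :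
    cofibrations C (f ≫ g) :=
  cof_comp.comp_mem _ _ hf hg

lemma weq_trans {f : X ⟶ Y} {g : Y ⟶ Z} (hf : weakEquivalences C f) (hg : weakEquivalences C g) :
    weakEquivalences C (f ≫ g) :=
  weq_two_out_of_three.comp_mem _ _ hf hg

lemma weq_of_postcomp {f : X ⟶ Y} {g : Y ⟶ Z} (hg : weakEquivalences C g)
    (hfg : weakEquivalences C (f ≫ g)) : weakEquivalences C f :=
  weq_two_out_of_three.of_postcomp _ _ hg hfg

lemma weq_of_precomp {f : X ⟶ Y} {g : Y ⟶ Z} (hf : weakEquivalences C f)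
    (hfg : weakEquivalences C (f ≫ g)) : weakEquivalences C g :=
  weq_two_out_of_three.of_precomp _ _ hf hfg

lemma cof_of_isIso (f : X ⟶ Y) [IsIso f] : cofibrations C f :=
  isomorphisms_le_cof _ (MorphismProperty.isomorphisms.infer_property f)

lemma weq_of_isIso (f : X ⟶ Y) [IsIso f] : weakEquivalences C f :=
  isomorphisms_le_weq _ (MorphismProperty.isomorphisms.infer_property f)

lemma cof_inr {f : X ⟶ Y} {g : X ⟶ Z} {a : Y ⟶ P} {b : Z ⟶ P} (h : IsPushout f g a b)
    (hf : cofibrations C f) : cofibrations C b :=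
  cof_cobaseChange.of_isPushout h.flip hf

lemma cof_inl {f : X ⟶ Y} {g : X ⟶ Z} {a : Y ⟶ P} {b : Z ⟶ P} (h : IsPushout f g a b)
    (hg : cofibrations C g) : cofibrations C a :=
  cof_cobaseChange.of_isPushout h hg

lemma acyclic_inr {f : X ⟶ Y} {g : X ⟶ Z} {a : Y ⟶ P} {b : Z ⟶ P} (h : IsPushout f g a b)
    (hf : cofibrations C f) (hf' : weakEquivalences C f) : weakEquivalences C b :=
  (acyclic_cobaseChange.of_isPushout h.flip ⟨hf, hf'⟩).2

lemma acyclic_inl {f : X ⟶ Y} {g : X ⟶ Z} {a : Y ⟶ P} {b : Z ⟶ P} (h : IsPushout f g a b)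
    (hg : cofibrations C g) (hg' : weakEquivalences C g) : weakEquivalences C a :=
  (acyclic_cobaseChange.of_isPushout h ⟨hg, hg'⟩).2

lemma exists_pushout {f : X ⟶ Y} (hf : cofibrations C f) (g : X ⟶ Z) :
    ∃ (P : C) (a : Y ⟶ P) (b : Z ⟶ P), IsPushout f g a b :=
  have := hasPushout_of_cof f g hf
  ⟨_, _, _, IsPushout.of_hasPushout f g⟩

lemma exists_factorization (f : X ⟶ Y) :
    ∃ (Z : C) (i : X ⟶ Z) (p : Z ⟶ Y), cofibrations C i ∧ weakEquivalences C p ∧ i ≫ p = f :=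
  let ⟨d⟩ := factorization.nonempty_mapFactorizationData (C := C) f
  ⟨d.Z, d.i, d.p, d.hi, d.hp, d.fac⟩

end Basic

/-! ### The pointed case: quotients and cones -/

section Zero

variable {C : Type u} [Category.{v} C] [HasZeroObject C] {X : C}

/-- The morphism to the zero object. -/
def toZero (X : C) : X ⟶ 0 := (isZero_zero C).from_ X

/-- The morphism from the zero object. -/
def fromZero (X : C) : 0 ⟶ X := (isZero_zero C).to_ X

lemma toZero_eq (f g : X ⟶ 0) : f = g := (isZero_zero C).eq_of_tgt f g

lemma fromZero_eq (f g : 0 ⟶ X) : f = g := (isZero_zero C).eq_of_src f g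

end Zero

section Pointed

variable {C : Type u} [Category.{v} C] [CofibrationCategory C] [HasZeroObject C] {X Y Z : C}

lemma cof_fromZero (X : C) : cofibrations C (fromZero X) :=
  cof_of_isInitial _ (isZero_zero C).isInitial

/-- The quotient `Y/X` of a cofibration `f : X ⟶ Y`, i.e. the pushout of `f` along `X ⟶ 0`. -/
def quot (f : X ⟶ Y) (hf : cofibrations C f) : C :=
  haveI := hasPushout_of_cof f (toZero X) hf
  pushout f (toZero X)

/-- The projection `Y ⟶ Y/X`. -/
def quotProj (f : X ⟶ Y) (hf : cofibrations C f) : Y ⟶ quot f hf :=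
  haveI := hasPushout_of_cof f (toZero X) hf
  pushout.inl f (toZero X)

lemma quot_isPushout (f : X ⟶ Y) (hf : cofibrations C f) :
    IsPushout f (toZero X) (quotProj f hf) (fromZero _) := by
  have := hasPushout_of_cof f (toZero X) hf
  have h := IsPushout.of_hasPushout f (toZero X)
  rw [fromZero_eq (pushout.inr f (toZero X)) (fromZero _)] at h
  exact h

lemma quot_hom_ext {f : X ⟶ Y} {hf : cofibrations C f} {a b : quot f hf ⟶ Z}
    (h : quotProj f hf ≫ a = quotProj f hf ≫ b) : a = b :=
  (quot_isPushout f hf).hom_ext h (fromZero_eq _ _)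

variable {X' Y' X'' Y'' : C}

/-- The morphism `Y/X ⟶ Y'/X'` induced by a commutative square between cofibrations. -/
def quotMap (f : X ⟶ Y) (hf : cofibrations C f) (f' : X' ⟶ Y') (hf' : cofibrations C f')
    (a : X ⟶ X') (b : Y ⟶ Y') (w : f ≫ b = a ≫ f') : quot f hf ⟶ quot f' hf' :=
  (quot_isPushout f hf).desc (b ≫ quotProj f' hf') (fromZero _) (by
    rw [← Category.assoc, w, Category.assoc, (quot_isPushout f' hf').w, ← Category.assoc,
      toZero_eq (a ≫ toZero X') (toZero X)])

lemma quotProj_quotMap (f : X ⟶ Y) (hf : cofibrations C f) (f' : X' ⟶ Y')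
    (hf' : cofibrations C f') (a : X ⟶ X') (b : Y ⟶ Y') (w : f ≫ b = a ≫ f') :
    quotProj f hf ≫ quotMap f hf f' hf' a b w = b ≫ quotProj f' hf' :=
  IsPushout.inl_desc _ _ _ _

lemma quotMap_comp {f : X ⟶ Y} {hf : cofibrations C f} {f' : X' ⟶ Y'} {hf' : cofibrations C f'}
    {f'' : X'' ⟶ Y''} {hf'' : cofibrations C f''} {a : X ⟶ X'} {b : Y ⟶ Y'} {a' : X' ⟶ X''}
    {b' : Y' ⟶ Y''} (w : f ≫ b = a ≫ f') (w' : f' ≫ b' = a' ≫ f'') :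
    quotMap f hf f' hf' a b w ≫ quotMap f' hf' f'' hf'' a' b' w' =
      quotMap f hf f'' hf'' (a ≫ a') (b ≫ b')
        (by rw [← Category.assoc, w, Category.assoc, w', Category.assoc]) := by
  apply quot_hom_ext
  rw [← Category.assoc, quotProj_quotMap, Category.assoc, quotProj_quotMap, quotProj_quotMap,
    Category.assoc]

lemma quotMap_id (f : X ⟶ Y) (hf : cofibrations C f) (w : f ≫ 𝟙 Y = 𝟙 X ≫ f) :
    quotMap f hf f hf (𝟙 X) (𝟙 Y) w = 𝟙 _ := by
  apply quot_hom_ext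
  rw [quotProj_quotMap, Category.id_comp, Category.comp_id]

/-- For cofibrations `X ⟶ Y` and `s : Y ⟶ Z`, the morphism `Y/X ⟶ Z/X` is the pushout of `s`. -/
lemma quotMap_isPushout (f : X ⟶ Y) (hf : cofibrations C f) (s : Y ⟶ Z)
    (f' : X ⟶ Z) (hf' : cofibrations C f') (w : f ≫ s = 𝟙 X ≫ f') :
    IsPushout s (quotProj f hf) (quotProj f' hf') (quotMap f hf f' hf' (𝟙 X) s w) := by
  obtain rfl : f ≫ s = f' := by rw [w, Category.id_comp]
  refine IsPushout.of_left ?_ (quotProj_quotMap _ _ _ _ _ _ _).symm (quot_isPushout f hf)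
  rw [fromZero_eq (fromZero _ ≫ _) (fromZero _)]
  exact quot_isPushout _ _

lemma quotMap_weq (f : X ⟶ Y) (hf : cofibrations C f) (s : Y ⟶ Z) (f' : X ⟶ Z)
    (hf' : cofibrations C f') (w : f ≫ s = 𝟙 X ≫ f') (hs : cofibrations C s)
    (hs' : weakEquivalences C s) : weakEquivalences C (quotMap f hf f' hf' (𝟙 X) s w) :=
  acyclic_inr (quotMap_isPushout f hf s f' hf' w) hs hs'

variable (X) in
/-- An object is weakly contractible if its morphism to the zero object is a weak equivalence. -/
def WeaklyContractible : Prop := weakEquivalences C (toZero X)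

lemma WeaklyContractible.of_weq {f : X ⟶ Y} (hf : weakEquivalences C f)
    (hX : WeaklyContractible X) : WeaklyContractible Y :=
  weq_of_precomp hf (by rw [toZero_eq (f ≫ toZero Y) (toZero X)]; exact hX)

lemma WeaklyContractible.weq (hX : WeaklyContractible X) (hY : WeaklyContractible Y)
    (f : X ⟶ Y) : weakEquivalences C f :=
  weq_of_postcomp hY (by rw [toZero_eq (f ≫ toZero Y) (toZero X)]; exact hX)

lemma weaklyContractible_zero : WeaklyContractible (0 : C) := by
  rw [WeaklyContractible, toZero_eq (toZero (0 : C)) (𝟙 0)]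
  exact weq_of_isIso _

/-- Two morphisms from a cone of `X` to a cone of `Y` which agree on `X` become equal in the
homotopy category after passing to quotients. -/
lemma γ_quotMap_eq {A E : C} (i : X ⟶ A) (hi : cofibrations C i)
    (j : Y ⟶ E) (hj : cofibrations C j) (hE : WeaklyContractible E) (f : X ⟶ Y)
    (a a' : A ⟶ E) (w : i ≫ a = f ≫ j) (w' : i ≫ a' = f ≫ j) :
    (γ C).map (quotMap i hi j hj f a w) = (γ C).map (quotMap i hi j hj f a' w') := by
  obtain ⟨P, l, r, hP⟩ := exists_pushout hi i
  obtain ⟨I, c, p, hc, hp, fac⟩ := exists_factorization (hP.desc (𝟙 A) (𝟙 A) rfl)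
  have e0 : (l ≫ c) ≫ p = 𝟙 A := by rw [Category.assoc, fac, hP.inl_desc]
  have e1 : (r ≫ c) ≫ p = 𝟙 A := by rw [Category.assoc, fac, hP.inr_desc]
  have c0 : cofibrations C (l ≫ c) := cof_trans (cof_inl hP hi) hc
  have h0 : weakEquivalences C (l ≫ c) :=
    weq_of_postcomp hp (by rw [e0]; exact weq_of_isIso _)
  obtain ⟨Q, k, e, hQ⟩ := exists_pushout hc (hP.desc a a' (w.trans w'.symm))
  obtain ⟨E', d, p', hd, hp', -⟩ := exists_factorization (toZero Q)
  have hE' : WeaklyContractible E' := by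
    rw [WeaklyContractible, toZero_eq (toZero E') p']; exact hp'
  have ce : cofibrations C (e ≫ d) := cof_trans (cof_inr hQ hc) hd
  have we : weakEquivalences C (e ≫ d) := hE.weq hE' _
  have ka : (l ≫ c) ≫ (k ≫ d) = a ≫ (e ≫ d) := by
    rw [Category.assoc, ← Category.assoc c, hQ.w, Category.assoc, ← Category.assoc l,
      hP.inl_desc]
  have ka' : (r ≫ c) ≫ (k ≫ d) = a' ≫ (e ≫ d) := by
    rw [Category.assoc, ← Category.assoc c, hQ.w, Category.assoc, ← Category.assoc r,
      hP.inr_desc]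
  have hr : i ≫ (r ≫ c) = 𝟙 X ≫ (i ≫ l ≫ c) := by
    rw [Category.id_comp, ← Category.assoc, ← hP.w, Category.assoc]
  have cI : cofibrations C (i ≫ l ≫ c) := cof_trans hi c0
  have cE : cofibrations C (j ≫ e ≫ d) := cof_trans hj ce
  have hpI : (i ≫ l ≫ c) ≫ p = 𝟙 X ≫ i := by
    rw [Category.assoc, e0, Category.comp_id, Category.id_comp]
  have hkI : (i ≫ l ≫ c) ≫ (k ≫ d) = f ≫ (j ≫ e ≫ d) := by
    rw [Category.assoc, ka, ← Category.assoc, w, Category.assoc]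
  -- the two inclusions into the relative cylinder agree in the homotopy category
  let q0 := quotMap i hi (i ≫ l ≫ c) cI (𝟙 X) (l ≫ c) (by rw [Category.id_comp])
  let q1 := quotMap i hi (i ≫ l ≫ c) cI (𝟙 X) (r ≫ c) hr
  let qp := quotMap (i ≫ l ≫ c) cI i hi (𝟙 X) p hpI
  have hq0 : q0 ≫ qp = 𝟙 _ := by
    simp only [q0, qp, quotMap_comp, e0, Category.comp_id]
    exact quotMap_id _ _ _
  have hq1 : q1 ≫ qp = 𝟙 _ := by
    simp only [q1, qp, quotMap_comp, e1, Category.comp_id]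
    exact quotMap_id _ _ _
  have wq0 : weakEquivalences C q0 := quotMap_weq _ _ _ _ _ _ c0 h0
  have wqp : weakEquivalences C qp :=
    weq_of_precomp wq0 (by rw [hq0]; exact weq_of_isIso _)
  have hq : (γ C).map q0 = (γ C).map q1 := by
    have := isIso_γ qp wqp
    rw [← cancel_mono ((γ C).map qp), ← Functor.map_comp, ← Functor.map_comp, hq0, hq1]
  -- compare after the acyclic cofibration `E ⟶ E'`
  let qe := quotMap j hj (j ≫ e ≫ d) cE (𝟙 Y) (e ≫ d) (by rw [Category.id_comp])
  have := isIso_γ qe (quotMap_weq _ _ _ _ _ _ ce we)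
  let qk := quotMap (i ≫ l ≫ c) cI (j ≫ e ≫ d) cE f (k ≫ d) hkI
  have s0 : quotMap i hi j hj f a w ≫ qe = q0 ≫ qk := by
    simp only [qe, q0, qk, quotMap_comp, ka, Category.comp_id, Category.id_comp]
  have s1 : quotMap i hi j hj f a' w' ≫ qe = q1 ≫ qk := by
    simp only [qe, q1, qk, quotMap_comp, ka', Category.comp_id, Category.id_comp]
  rw [← cancel_mono ((γ C).map qe), ← Functor.map_comp, ← Functor.map_comp, s0, s1,
    Functor.map_comp, Functor.map_comp, hq]

/-- Collapsing a weakly contractible object along a cofibration is a weak equivalence. -/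
lemma weq_collapse {A B Q : C} {i : A ⟶ B} (hi : cofibrations C i) (hA : WeaklyContractible A)
    {q : B ⟶ Q} {z : 0 ⟶ Q} (sq : IsPushout i (toZero A) q z) : weakEquivalences C q := by
  -- a cylinder `Cyl` of `A`
  obtain ⟨P, l, r, hP⟩ := exists_pushout (cof_fromZero A) (fromZero A)
  obtain ⟨Cyl, c, p, hc, hp, fac⟩ := exists_factorization (hP.desc (𝟙 A) (𝟙 A) rfl)
  have e0 : (l ≫ c) ≫ p = 𝟙 A := by rw [Category.assoc, fac, hP.inl_desc]
  have e1 : (r ≫ c) ≫ p = 𝟙 A := by rw [Category.assoc, fac, hP.inr_desc]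
  have c0 : cofibrations C (l ≫ c) := cof_trans (cof_inl hP (cof_fromZero A)) hc
  have c1 : cofibrations C (r ≫ c) := cof_trans (cof_inr hP (cof_fromZero A)) hc
  have h0 : weakEquivalences C (l ≫ c) :=
    weq_of_postcomp hp (by rw [e0]; exact weq_of_isIso _)
  have h1 : weakEquivalences C (r ≫ c) :=
    weq_of_postcomp hp (by rw [e1]; exact weq_of_isIso _)
  -- `K` is the cylinder with one end collapsed
  obtain ⟨K, πK, zK, hK⟩ := exists_pushout c1 (toZero A)
  have hKc : WeaklyContractible K := weaklyContractible_zero.of_weq (acyclic_inr hK c1 h1)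
  -- folding the second summand of `A ⊔ A` away
  let φ : P ⟶ A := hP.desc (𝟙 A) (toZero A ≫ fromZero A) (fromZero_eq _ _)
  have hφ : IsPushout r (toZero A) φ (fromZero A) := by
    refine (IsPushout.of_left (h₁₁ := fromZero A) (v₁₁ := fromZero A) (h₂₁ := l) ?_ ?_
      hP.flip).flip
    · have hl : l ≫ φ = 𝟙 A := hP.inl_desc _ _ _
      have hz : fromZero A ≫ toZero A = 𝟙 0 := toZero_eq _ _
      rw [hl, hz]
      exact IsPushout.id_horiz _
    · exact (hP.inr_desc _ _ _).symm
  let κ : A ⟶ K := hφ.desc (c ≫ πK) zK (by rw [← Category.assoc]; exact hK.w)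
  have hφκ : φ ≫ κ = c ≫ πK := hφ.inl_desc _ _ _
  have hκ' : κ = (l ≫ c) ≫ πK := by
    rw [Category.assoc, ← hφκ, ← Category.assoc, hP.inl_desc, Category.id_comp]
  have hκ : IsPushout c φ πK κ := by
    refine IsPushout.of_left ?_ hφκ.symm hφ
    rw [fromZero_eq (fromZero A ≫ κ) zK]
    exact hK
  have cκ : cofibrations C ((l ≫ c) ≫ πK) := hκ' ▸ cof_inr hκ hc
  -- `N` is the mapping cylinder of `i`, and `M` the result of collapsing its free end
  obtain ⟨N, t, k, hN⟩ := exists_pushout hi (l ≫ c)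
  have ck : cofibrations C k := cof_inr hN hi
  obtain ⟨M, μ, m, hM⟩ := exists_pushout ck πK
  have htμ : weakEquivalences C (t ≫ μ) :=
    acyclic_inl (hN.paste_vert hM) cκ (hA.weq hKc _)
  have hMq := hK.paste_horiz hM
  rw [fromZero_eq (zK ≫ m) (fromZero _)] at hMq
  have ckA : cofibrations C ((r ≫ c) ≫ k) := cof_trans c1 ck
  let ρ : N ⟶ B := hN.desc (𝟙 B) (p ≫ i) (by
    rw [Category.comp_id, ← Category.assoc, e0, Category.id_comp])
  have htρ : t ≫ ρ = 𝟙 B := hN.inl_desc _ _ _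
  have hkρ : ((r ≫ c) ≫ k) ≫ ρ = i := by
    rw [Category.assoc, hN.inr_desc, ← Category.assoc, e1, Category.id_comp]
  have wt : weakEquivalences C t := acyclic_inl hN c0 h0
  have wρ : weakEquivalences C ρ := weq_of_precomp wt (by rw [htρ]; exact weq_of_isIso _)
  -- factor `N ⟶ B` relative to `A`
  obtain ⟨R, n, b, hR⟩ := exists_pushout ckA i
  obtain ⟨S, c', p', hc', hp', fac'⟩ :=
    exists_factorization (hR.desc ρ (𝟙 B) (by rw [hkρ, Category.comp_id]))
  have en : (n ≫ c') ≫ p' = ρ := by rw [Category.assoc, fac', hR.inl_desc]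
  have eb : (b ≫ c') ≫ p' = 𝟙 B := by rw [Category.assoc, fac', hR.inr_desc]
  have cn : cofibrations C (n ≫ c') := cof_trans (cof_inl hR hi) hc'
  have cb : cofibrations C (b ≫ c') := cof_trans (cof_inr hR ckA) hc'
  have wn : weakEquivalences C (n ≫ c') := weq_of_postcomp hp' (by rw [en]; exact wρ)
  have wb : weakEquivalences C (b ≫ c') :=
    weq_of_postcomp hp' (by rw [eb]; exact weq_of_isIso _)
  have cS : cofibrations C (i ≫ b ≫ c') := cof_trans hi cb
  let qn := quotMap _ ckA _ cS (𝟙 A) (n ≫ c') (by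
    rw [Category.id_comp, ← Category.assoc, hR.w, Category.assoc])
  let qb := quotMap i hi _ cS (𝟙 A) (b ≫ c') (by rw [Category.id_comp])
  let qp := quotMap _ cS i hi (𝟙 A) p' (by
    rw [Category.assoc, eb, Category.comp_id, Category.id_comp])
  have wqn : weakEquivalences C qn := quotMap_weq _ _ _ _ _ _ cn wn
  have wqb : weakEquivalences C qb := quotMap_weq _ _ _ _ _ _ cb wb
  have hqb : qb ≫ qp = 𝟙 _ := by
    simp only [qb, qp, quotMap_comp, eb, Category.comp_id]
    exact quotMap_id _ _ _
  have wqp : weakEquivalences C qp :=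
    weq_of_precomp wqb (by rw [hqb]; exact weq_of_isIso _)
  have hMi := hMq.inl_isoIsPushout_hom _ _ (quot_isPushout _ ckA)
  have h1' : weakEquivalences C (t ≫ quotProj _ ckA) := by
    rw [← hMi, ← Category.assoc]
    exact weq_trans htμ (weq_of_isIso _)
  have h2' : (t ≫ quotProj _ ckA) ≫ qn ≫ qp = quotProj i hi := by
    simp only [qn, qp, quotMap_comp, Category.assoc, quotProj_quotMap]
    rw [Category.assoc] at en
    rw [← Category.assoc c', ← Category.assoc n, en, ← Category.assoc, htρ, Category.id_comp]
  have h3' : weakEquivalences C (quotProj i hi) := by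
    rw [← h2']
    exact weq_trans h1' (weq_trans wqn wqp)
  rw [← (quot_isPushout i hi).inl_isoIsPushout_hom _ _ sq]
  exact weq_trans h3' (weq_of_isIso _)

variable (C) in
/-- A choice of a cone `X ⟶ CX` for every object `X`: a cofibration to a weakly contractible
object. -/
structure Cones where
  /-- the object `CX` -/
  obj : C → C
  /-- the cofibration `X ⟶ CX` -/
  ι : ∀ X : C, X ⟶ obj X
  cof : ∀ X : C, cofibrations C (ι X)
  contractible : ∀ X : C, WeaklyContractible (obj X)

instance : Nonempty (Cones C) := by
  choose obj i p hi hp _ using fun X : C => exists_factorization (toZero X)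
  exact ⟨⟨obj, i, hi, fun X => by
    rw [WeaklyContractible, toZero_eq (toZero (obj X)) (p X)]; exact hp X⟩⟩

namespace Cones

variable (K : Cones C)

/-- The object `CX/X` of `C`. -/
abbrev suspObj (X : C) : C := quot (K.ι X) (K.cof X)

/-- A cone extension of `f : X ⟶ Y`: a morphism `map : CX ⟶ obj` and an acyclic cofibration
`s : CY ⟶ obj` which agree on `X` and such that `CX ∪_X CY ⟶ obj` is a cofibration. -/
structure Extension (f : X ⟶ Y) where
  /-- the target of the extension -/
  obj : C
  /-- the morphism extending `f` -/
  map : K.obj X ⟶ obj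
  /-- the acyclic cofibration -/
  s : K.obj Y ⟶ obj
  cof_s : cofibrations C s
  weq_s : weakEquivalences C s
  comm : K.ι X ≫ map = (f ≫ K.ι Y) ≫ s
  cof_desc : ∀ {P : C} {a : K.obj X ⟶ P} {b : K.obj Y ⟶ P}
    (h : IsPushout (K.ι X) (f ≫ K.ι Y) a b), cofibrations C (h.desc map s comm)

lemma exists_extension (f : X ⟶ Y) : Nonempty (K.Extension f) := by
  obtain ⟨P, a, b, hP⟩ := exists_pushout (K.cof X) (f ≫ K.ι Y)
  obtain ⟨E, i, p, hi, hp, -⟩ := exists_factorization (toZero P)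
  have hE : WeaklyContractible E := by
    rw [WeaklyContractible, toZero_eq (toZero E) p]; exact hp
  refine ⟨⟨E, a ≫ i, b ≫ i, cof_trans (cof_inr hP (K.cof X)) hi, (K.contractible Y).weq hE _,
    by rw [← Category.assoc, hP.w, Category.assoc], ?_⟩⟩
  intro P' a' b' hP'
  have h : hP'.desc (a ≫ i) (b ≫ i) (by rw [← Category.assoc, hP.w, Category.assoc]) =
      (hP'.isoIsPushout _ _ hP).hom ≫ i := by
    apply hP'.hom_ext
    · rw [hP'.inl_desc, ← Category.assoc, hP'.inl_isoIsPushout_hom]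
    · rw [hP'.inr_desc, ← Category.assoc, hP'.inr_isoIsPushout_hom]
  rw [h]
  exact cof_trans (cof_of_isIso _) hi

/-- For an acyclic cofibration `s : CY ⟶ D`, the weak equivalence `CY/Y ⟶ D/Y`. -/
def quotS {D : C} (s : K.obj Y ⟶ D) (hs : cofibrations C s) :
    K.suspObj Y ⟶ quot (K.ι Y ≫ s) (cof_trans (K.cof Y) hs) :=
  quotMap _ _ _ _ (𝟙 Y) s (by rw [Category.id_comp])

lemma quotS_weq {D : C} (s : K.obj Y ⟶ D) (hs : cofibrations C s)
    (hs' : weakEquivalences C s) : weakEquivalences C (K.quotS s hs) :=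
  quotMap_weq _ _ _ _ _ _ hs hs'

/-- The morphism `CX/X ⟶ D/Y`. -/
def quotA {D : C} (f : X ⟶ Y) (a : K.obj X ⟶ D) (s : K.obj Y ⟶ D) (hs : cofibrations C s)
    (w : K.ι X ≫ a = (f ≫ K.ι Y) ≫ s) :
    K.suspObj X ⟶ quot (K.ι Y ≫ s) (cof_trans (K.cof Y) hs) :=
  quotMap _ _ _ _ f a (by rw [w, Category.assoc])

/-- The morphism `γ(CX/X ⟶ E/Y ⟵ CY/Y)` for a cone extension `CX ⟶ E ⟵ CY` of `f`. -/
def Extension.toHo {K : Cones C} {f : X ⟶ Y} (E : K.Extension f) :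
    (γ C).obj (K.suspObj X) ⟶ (γ C).obj (K.suspObj Y) :=
  (γ C).map (K.quotA f E.map E.s E.cof_s E.comm) ≫
    γInv (K.quotS E.s E.cof_s) (K.quotS_weq E.s E.cof_s E.weq_s)

/-- The suspension of a morphism of `C`, as a morphism in the homotopy category. -/
def suspMap (f : X ⟶ Y) : (γ C).obj (K.suspObj X) ⟶ (γ C).obj (K.suspObj Y) :=
  (K.exists_extension f).some.toHo

lemma suspMap_quotS (f : X ⟶ Y) {D : C} (a : K.obj X ⟶ D) (s : K.obj Y ⟶ D)
    (hs : cofibrations C s) (hs' : weakEquivalences C s)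
    (w : K.ι X ≫ a = (f ≫ K.ι Y) ≫ s) :
    K.suspMap f ≫ (γ C).map (K.quotS s hs) = (γ C).map (K.quotA f a s hs w) := by
  let E := (K.exists_extension f).some
  change E.toHo ≫ _ = _
  obtain ⟨F, u, t, hF⟩ := exists_pushout hs E.s
  have cu : cofibrations C u := cof_inl hF E.cof_s
  have wu : weakEquivalences C u := acyclic_inl hF E.cof_s E.weq_s
  have hFc : WeaklyContractible F := (K.contractible Y).of_weq (weq_trans hs' wu)
  have csu : cofibrations C (K.ι Y ≫ s ≫ u) := cof_trans (K.cof Y) (cof_trans hs cu)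
  -- the two extensions agree after passing to `F`
  let qu := quotMap (K.ι Y ≫ s) (cof_trans (K.cof Y) hs) _ csu (𝟙 Y) u (by
    rw [Category.id_comp, Category.assoc])
  let qt := quotMap (K.ι Y ≫ E.s) (cof_trans (K.cof Y) E.cof_s) _ csu (𝟙 Y) t (by
    rw [Category.id_comp, Category.assoc, ← hF.w])
  have wqu : weakEquivalences C qu := quotMap_weq _ _ _ _ _ _ cu wu
  have := isIso_γ _ wqu
  have key : (γ C).map (K.quotA f a s hs w ≫ qu) =
      (γ C).map (K.quotA f E.map E.s E.cof_s E.comm ≫ qt) := by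
    simp only [qu, qt, quotA, quotMap_comp, Category.comp_id]
    exact γ_quotMap_eq _ _ _ _ hFc _ _ _ _ _
  have hst : K.quotS s hs ≫ qu = K.quotS E.s E.cof_s ≫ qt := by
    simp only [qu, qt, quotS, quotMap_comp, hF.w]
  rw [← cancel_mono ((γ C).map qu), ← Functor.map_comp, key, Category.assoc, ← Functor.map_comp,
    hst, Functor.map_comp, Functor.map_comp, Extension.toHo, Category.assoc,
    ← Category.assoc (γInv _ _), γInv_γ, Category.id_comp]

/-- Any cone extension computes the suspension. -/
lemma suspMap_eq {f : X ⟶ Y} (E : K.Extension f) : K.suspMap f = E.toHo := by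
  rw [Extension.toHo, ← K.suspMap_quotS f E.map E.s E.cof_s E.weq_s E.comm, Category.assoc,
    γ_γInv, Category.comp_id]

lemma suspMap_id (X : C) : K.suspMap (𝟙 X) = 𝟙 _ := by
  have h := K.suspMap_quotS (𝟙 X) (𝟙 _) (𝟙 _) (cof_of_isIso _) (weq_of_isIso _)
    (by rw [Category.id_comp])
  have := isIso_γ _ (K.quotS_weq (𝟙 (K.obj X)) (cof_of_isIso _) (weq_of_isIso _))
  rw [← cancel_mono ((γ C).map (K.quotS (𝟙 (K.obj X)) (cof_of_isIso _))), h]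
  exact (Category.id_comp _).symm

lemma suspMap_comp (f : X ⟶ Y) (g : Y ⟶ Z) :
    K.suspMap (f ≫ g) = K.suspMap f ≫ K.suspMap g := by
  let E := (K.exists_extension f).some
  let G := (K.exists_extension g).some
  obtain ⟨F, p, q, hF⟩ := exists_pushout E.cof_s G.map
  have cq : cofibrations C q := cof_inr hF E.cof_s
  have wq : weakEquivalences C q := acyclic_inr hF E.cof_s E.weq_s
  have cGq : cofibrations C (G.s ≫ q) := cof_trans G.cof_s cq
  have wGq : weakEquivalences C (G.s ≫ q) := weq_trans G.weq_s wq
  have w : K.ι X ≫ E.map ≫ p = ((f ≫ g) ≫ K.ι Z) ≫ G.s ≫ q := by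
    have h1 := E.comm
    have h2 := G.comm
    have h3 := hF.w
    simp only [Category.assoc] at h1 h2 h3 ⊢
    rw [← Category.assoc, h1, Category.assoc, Category.assoc, h3, ← Category.assoc (K.ι Y), h2]
    simp only [Category.assoc]
  have h := K.suspMap_quotS (f ≫ g) (E.map ≫ p) (G.s ≫ q) cGq wGq w
  have hf := K.suspMap_quotS f E.map E.s E.cof_s E.weq_s E.comm
  have hg := K.suspMap_quotS g G.map G.s G.cof_s G.weq_s G.comm
  have cZ : cofibrations C (K.ι Z ≫ G.s ≫ q) := cof_trans (K.cof Z) cGq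
  let qp := quotMap (K.ι Y ≫ E.s) (cof_trans (K.cof Y) E.cof_s) _ cZ g p (by
    rw [Category.assoc, hF.w, ← Category.assoc, G.comm, Category.assoc, Category.assoc])
  let qq := quotMap (K.ι Z ≫ G.s) (cof_trans (K.cof Z) G.cof_s) _ cZ (𝟙 Z) q (by
    rw [Category.id_comp, Category.assoc])
  have h1 : K.quotA (f ≫ g) (E.map ≫ p) (G.s ≫ q) cGq w =
      K.quotA f E.map E.s E.cof_s E.comm ≫ qp := by
    simp only [qp, quotA, quotMap_comp]
  have h2 : K.quotS E.s E.cof_s ≫ qp = K.quotA g G.map G.s G.cof_s G.comm ≫ qq := by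
    simp only [qp, qq, quotA, quotS, quotMap_comp, Category.comp_id, Category.id_comp, hF.w]
  have h3 : K.quotS G.s G.cof_s ≫ qq = K.quotS (G.s ≫ q) cGq := by
    simp only [qq, quotS, quotMap_comp, Category.comp_id]
  have := isIso_γ _ (K.quotS_weq (G.s ≫ q) cGq wGq)
  rw [← cancel_mono ((γ C).map (K.quotS (G.s ≫ q) cGq)), h, h1, Functor.map_comp, ← hf,
    Category.assoc, ← Functor.map_comp, h2, Functor.map_comp, ← hg, Category.assoc,
    ← Functor.map_comp, h3, Category.assoc]

/-- The suspension as a functor `C ⥤ Ho C`. -/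
def suspFunctor : C ⥤ Ho C where
  obj X := (γ C).obj (K.suspObj X)
  map f := K.suspMap f
  map_id X := K.suspMap_id X
  map_comp f g := K.suspMap_comp f g

lemma isIso_suspMap_of_acyclic (f : X ⟶ Y) (hf : cofibrations C f)
    (hf' : weakEquivalences C f) : IsIso (K.suspMap f) := by
  obtain ⟨E, x, y, hE⟩ := exists_pushout (K.cof X) f
  obtain ⟨P, l, r, hP⟩ := exists_pushout (cof_inr hE (K.cof X)) (K.ι Y)
  obtain ⟨D, i, p, hi, hp, -⟩ := exists_factorization (toZero P)
  have hD : WeaklyContractible D := by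
    rw [WeaklyContractible, toZero_eq (toZero D) p]; exact hp
  have hEc : WeaklyContractible E := (K.contractible X).of_weq (acyclic_inl hE hf hf')
  have cy : cofibrations C y := cof_inr hE (K.cof X)
  have cs : cofibrations C (r ≫ i) := cof_trans (cof_inr hP cy) hi
  have ws : weakEquivalences C (r ≫ i) := (K.contractible Y).weq hD _
  have cl : cofibrations C (l ≫ i) := cof_trans (cof_inl hP (K.cof Y)) hi
  have wl : weakEquivalences C (l ≫ i) := hEc.weq hD _
  have hys : y ≫ l ≫ i = K.ι Y ≫ r ≫ i := by
    rw [← Category.assoc, hP.w, Category.assoc]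
  have w : K.ι X ≫ x ≫ l ≫ i = (f ≫ K.ι Y) ≫ r ≫ i := by
    rw [← Category.assoc, hE.w, Category.assoc, hys, Category.assoc]
  have h := K.suspMap_quotS f (x ≫ l ≫ i) (r ≫ i) cs ws w
  have cD : cofibrations C (K.ι Y ≫ r ≫ i) := cof_trans (K.cof Y) cs
  let qx : K.suspObj X ⟶ quot y cy := quotMap (K.ι X) (K.cof X) y cy f x hE.w
  let ql : quot y cy ⟶ quot _ cD := quotMap y cy _ cD (𝟙 Y) (l ≫ i) (by
    rw [Category.id_comp, hys])
  have h1 : K.quotA f (x ≫ l ≫ i) (r ≫ i) cs w = qx ≫ ql := by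
    simp only [qx, ql, quotA, quotMap_comp, Category.comp_id]
  have hpo : IsPushout (K.ι X) (toZero X) (x ≫ quotProj y cy) (fromZero _) := by
    have := hE.paste_vert (quot_isPushout y cy)
    rw [toZero_eq (f ≫ toZero Y) (toZero X)] at this
    exact this
  have hqx : qx = ((quot_isPushout (K.ι X) (K.cof X)).isoIsPushout _ _ hpo).hom := by
    apply quot_hom_ext
    rw [IsPushout.inl_isoIsPushout_hom]
    exact quotProj_quotMap _ _ _ _ _ _ _
  have i1 : IsIso qx := by rw [hqx]; infer_instance
  have i2 := isIso_γ ql (quotMap_weq _ _ _ _ _ _ cl wl)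
  have i3 := isIso_γ _ (K.quotS_weq (r ≫ i) cs ws)
  rw [h1, Functor.map_comp] at h
  have : K.suspMap f = ((γ C).map qx ≫ (γ C).map ql) ≫ inv ((γ C).map (K.quotS (r ≫ i) cs)) := by
    rw [← h, Category.assoc, IsIso.hom_inv_id, Category.comp_id]
  rw [this]
  infer_instance

lemma suspFunctor_inverts : (weakEquivalences C).IsInvertedBy K.suspFunctor := by
  intro X Y f hf
  change IsIso (K.suspMap f)
  obtain ⟨R, a, b, hR⟩ := exists_pushout (cof_fromZero X) (fromZero Y)
  obtain ⟨Z, c, p, hc, hp, fac⟩ :=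
    exists_factorization (hR.desc f (𝟙 Y) (fromZero_eq _ _))
  have ea : (a ≫ c) ≫ p = f := by rw [Category.assoc, fac, hR.inl_desc]
  have eb : (b ≫ c) ≫ p = 𝟙 Y := by rw [Category.assoc, fac, hR.inr_desc]
  have i1 := K.isIso_suspMap_of_acyclic (a ≫ c)
    (cof_trans (cof_inl hR (cof_fromZero Y)) hc) (weq_of_postcomp hp (by rw [ea]; exact hf))
  have i2 := K.isIso_suspMap_of_acyclic (b ≫ c)
    (cof_trans (cof_inr hR (cof_fromZero X)) hc)
    (weq_of_postcomp hp (by rw [eb]; exact weq_of_isIso _))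
  have h2 : K.suspMap (b ≫ c) ≫ K.suspMap p = 𝟙 _ := by
    rw [← suspMap_comp, eb, suspMap_id]
  have i3 : IsIso (K.suspMap p) := IsIso.of_isIso_fac_left h2
  rw [← ea, suspMap_comp]
  infer_instance

/-- The suspension functor of the homotopy category; on `γ X` its value is `γ (CX/X)`. -/
def suspension : Ho C ⥤ Ho C :=
  Localization.Construction.lift K.suspFunctor K.suspFunctor_inverts

lemma γ_comp_suspension : γ C ⋙ K.suspension = K.suspFunctor :=
  Localization.Construction.fac _ _

/-- The pushout `CX ∪_X Y` for a cofibration `f : X ⟶ Y`. -/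
def mappingCone (f : X ⟶ Y) : C :=
  haveI := hasPushout_of_cof (K.ι X) f (K.cof X)
  pushout (K.ι X) f

/-- The morphism `CX ⟶ CX ∪_X Y`. -/
def inCone (f : X ⟶ Y) : K.obj X ⟶ K.mappingCone f :=
  haveI := hasPushout_of_cof (K.ι X) f (K.cof X)
  pushout.inl (K.ι X) f

/-- The morphism `Y ⟶ CX ∪_X Y`. -/
def inBase (f : X ⟶ Y) : Y ⟶ K.mappingCone f :=
  haveI := hasPushout_of_cof (K.ι X) f (K.cof X)
  pushout.inr (K.ι X) f

lemma mappingCone_isPushout (f : X ⟶ Y) :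
    IsPushout (K.ι X) f (K.inCone f) (K.inBase f) := by
  have := hasPushout_of_cof (K.ι X) f (K.cof X)
  exact IsPushout.of_hasPushout (K.ι X) f

/-- The morphism `CX ∪_X Y ⟶ Y/X` collapsing the cone. -/
def collapseCone (f : X ⟶ Y) (hf : cofibrations C f) : K.mappingCone f ⟶ quot f hf :=
  (K.mappingCone_isPushout f).desc (toZero _ ≫ fromZero _) (quotProj f hf) (by
    rw [(quot_isPushout f hf).w, ← Category.assoc, toZero_eq (K.ι X ≫ toZero _) (toZero X)])

/-- The morphism `CX ∪_X Y ⟶ CX/X` collapsing `Y`. -/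
def collapseBase (f : X ⟶ Y) : K.mappingCone f ⟶ K.suspObj X :=
  (K.mappingCone_isPushout f).desc (quotProj (K.ι X) (K.cof X)) (toZero _ ≫ fromZero _) (by
    rw [(quot_isPushout (K.ι X) (K.cof X)).w, ← Category.assoc,
      toZero_eq (f ≫ toZero _) (toZero X)])

lemma collapseCone_weq (f : X ⟶ Y) (hf : cofibrations C f) :
    weakEquivalences C (K.collapseCone f hf) := by
  have hU := K.mappingCone_isPushout f
  refine weq_collapse (i := K.inCone f) (z := fromZero _) (cof_inl hU hf) (K.contractible X) ?_
  refine (IsPushout.of_left ?_ (hU.inl_desc _ _ _).symm hU).flip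
  have h : K.inBase f ≫ K.collapseCone f hf = quotProj f hf := hU.inr_desc _ _ _
  change IsPushout _ _ _ (K.inBase f ≫ K.collapseCone f hf)
  rw [h, toZero_eq (K.ι X ≫ toZero _) (toZero X)]
  exact (quot_isPushout f hf).flip

/-- The connecting morphism `δ(f) = γ(Y/X ⟵ CX ∪_X Y ⟶ ΣX)` of a cofibration `f : X ⟶ Y`. -/
def δ (f : X ⟶ Y) (hf : cofibrations C f) :
    (γ C).obj (quot f hf) ⟶ K.suspension.obj ((γ C).obj X) :=
  γInv (K.collapseCone f hf) (K.collapseCone_weq f hf) ≫ (γ C).map (K.collapseBase f)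

end Cones

end Pointed

end CofibrationCategory

/-! ### Homotopy cartesian squares and strong triangulations -/

section Triangulated

variable {T : Type u} [Category.{v} T] [Preadditive T] [HasZeroObject T] [HasShift T ℤ]
  [∀ n : ℤ, (shiftFunctor T n).Additive] [Pretriangulated T]

/-- A commutative square
```
A --g--> B
|        |
f        f'
v        v
D --g'-> E
```
in a (pre)triangulated category is homotopy cartesian if there is a distinguished triangle
`A --(f,-g)--> D ⊞ B --(g',f')--> E --∂--> A⟦1⟧`. -/
def IsHomotopyCartesian {A B D E : T} (g : A ⟶ B) (f : A ⟶ D) (f' : B ⟶ E) (g' : D ⟶ E) :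
    Prop :=
  CommSq g f f' g' ∧ ∃ d : E ⟶ A⟦(1 : ℤ)⟧,
    Triangle.mk (biprod.lift f (-g)) (biprod.desc g' f') d ∈ distTriang T

variable (T) in
/-- A triangulated category is strongly triangulated if every composition, together with chosen
distinguished triangles on the two morphisms and their composite, can be completed to an octahedron
whose two middle squares are homotopy cartesian. -/
def IsStronglyTriangulated : Prop :=
  ∀ {X₁ X₂ X₃ Z₁₂ Z₂₃ Z₁₃ : T}
    {u₁₂ : X₁ ⟶ X₂} {u₂₃ : X₂ ⟶ X₃} {u₁₃ : X₁ ⟶ X₃} (comm : u₁₂ ≫ u₂₃ = u₁₃)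
    {v₁₂ : X₂ ⟶ Z₁₂} {w₁₂ : Z₁₂ ⟶ X₁⟦(1 : ℤ)⟧} (h₁₂ : Triangle.mk u₁₂ v₁₂ w₁₂ ∈ distTriang T)
    {v₂₃ : X₃ ⟶ Z₂₃} {w₂₃ : Z₂₃ ⟶ X₂⟦(1 : ℤ)⟧} (h₂₃ : Triangle.mk u₂₃ v₂₃ w₂₃ ∈ distTriang T)
    {v₁₃ : X₃ ⟶ Z₁₃} {w₁₃ : Z₁₃ ⟶ X₁⟦(1 : ℤ)⟧} (h₁₃ : Triangle.mk u₁₃ v₁₃ w₁₃ ∈ distTriang T),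
    ∃ o : Triangulated.Octahedron comm h₁₂ h₂₃ h₁₃,
      IsHomotopyCartesian v₁₂ u₂₃ o.m₁ v₁₃ ∧
      IsHomotopyCartesian w₁₃ o.m₃ (u₁₂⟦(1 : ℤ)⟧') w₂₃

lemma IsStronglyTriangulated.isTriangulated (h : IsStronglyTriangulated T) :
    IsTriangulated T :=
  ⟨fun comm _ _ h₁₂ _ _ h₂₃ _ _ h₁₃ => let ⟨o, _⟩ := h comm h₁₂ h₂₃ h₁₃; ⟨o⟩⟩

end Triangulated

end

open CofibrationCategory

noncomputable section

set_option linter.unusedSectionVars false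

/-! Everything rests on a calculus of fractions. Every morphism of the homotopy category is a
fraction whose denominator is an acyclic cofibration (`exists_fraction`), and two morphisms of `C`
become equal there exactly when they are homotopic after an acyclic cofibration (`γ_map_eq_iff`).
Hence coproducts of `C` stay coproducts. A square between cofibrations that commutes only in the
homotopy category can be replaced, through a mapping cylinder, by a zigzag of strictly commuting
squares; with the naturality of `δ` this yields the completion of morphisms of triangles
(`completes_of_comm`).

Stability gives additivity. Completion makes the elementary triangles exact for morphisms out of
them, and full faithfulness of the suspension adds exactness for morphisms into `Y`. Every object is
isomorphic to some `CW/W`, and the pinch map from `CW ∪_W CW` to the coproduct of two copies of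
`CW/W` detects equality: followed by `[a, b]` it vanishes iff `a = b`. This turns coproducts into
biproducts, provides negatives, and shows that `δ` of `W ⟶ CW` is minus the identity, which is the
sign in the rotation axiom. The rotated triangle of `f` is the elementary triangle of `Y ⟶ CX ∪_X
Y`; backward rotation then follows formally. The shift by all integers comes from a category of
spectra for the suspension.

The homotopy cartesian squares have one source: a pushout along a cofibration is homotopy cartesian
(`isHomotopyCartesian_of_isPushout`). Up to weak equivalence the pushout is a double mapping
cylinder, a cobase change of a cylinder inclusion `A ⨿ A ⟶ I`, and the latter represents the
codiagonal of `A`, whose triangle is known. The first square of (a) is such a pushout, and the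
second becomes one after its corners are replaced by weakly equivalent objects
(`isHomotopyCartesian_δ`). For (b), any composition is isomorphic to one of cofibrations, where the
required octahedron is explicit (`hasStrongOctahedron`); it transports to arbitrary choices because
a triangle is determined up to isomorphism by its first morphism. -/

namespace CofibrationCategory

/-! ### Homotopies and the calculus of left fractions -/

section Fractions

variable {C : Type u} [Category.{v} C] [CofibrationCategory C] [HasZeroObject C] {X Y Z W : C}

/-- Two morphisms `f g : X ⟶ Y` are homotopic if they factor through the two ends of an object
weakly equivalent to `X`. -/
def Homotopic (f g : X ⟶ Y) : Prop :=
  ∃ (I : C) (p : I ⟶ X) (i₀ i₁ : X ⟶ I) (H : I ⟶ Y), weakEquivalences C p ∧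
    i₀ ≫ p = 𝟙 X ∧ i₁ ≫ p = 𝟙 X ∧ i₀ ≫ H = f ∧ i₁ ≫ H = g

variable (X) in
/-- A cylinder of `X`. -/
structure Cylinder where
  /-- the coproduct `X ⨿ X` -/
  sum : C
  /-- the first inclusion -/
  inl : X ⟶ sum
  /-- the second inclusion -/
  inr : X ⟶ sum
  isPushout : IsPushout (fromZero X) (fromZero X) inl inr
  /-- the cylinder object -/
  obj : C
  /-- the inclusion of the two ends -/
  i : sum ⟶ obj
  /-- the projection -/
  p : obj ⟶ X
  cof : cofibrations C i
  weq : weakEquivalences C p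
  inl_p : inl ≫ i ≫ p = 𝟙 X
  inr_p : inr ≫ i ≫ p = 𝟙 X

namespace Cylinder

variable (I : Cylinder X)

/-- The inclusion of the first end. -/
def i₀ : X ⟶ I.obj := I.inl ≫ I.i

/-- The inclusion of the second end. -/
def i₁ : X ⟶ I.obj := I.inr ≫ I.i

lemma i₀_p : I.i₀ ≫ I.p = 𝟙 X := by rw [i₀, Category.assoc, I.inl_p]

lemma i₁_p : I.i₁ ≫ I.p = 𝟙 X := by rw [i₁, Category.assoc, I.inr_p]

lemma cof_i₀ : cofibrations C I.i₀ := cof_trans (cof_inl I.isPushout (cof_fromZero X)) I.cof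

lemma cof_i₁ : cofibrations C I.i₁ := cof_trans (cof_inr I.isPushout (cof_fromZero X)) I.cof

lemma weq_i₀ : weakEquivalences C I.i₀ :=
  weq_of_postcomp I.weq (by rw [i₀_p]; exact weq_of_isIso _)

lemma weq_i₁ : weakEquivalences C I.i₁ :=
  weq_of_postcomp I.weq (by rw [i₁_p]; exact weq_of_isIso _)

end Cylinder

/-- Factoring the two ends `X ⨿ X ⟶ J` into a cofibration and a weak equivalence turns any homotopy
into one on a genuine cylinder. -/
lemma Homotopic.exists_cylinder {f g : X ⟶ Y} (h : Homotopic f g) :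
    ∃ (I : Cylinder X) (H : I.obj ⟶ Y), I.i₀ ≫ H = f ∧ I.i₁ ≫ H = g := by
  obtain ⟨J, p, j₀, j₁, H, hp, h₀, h₁, rfl, rfl⟩ := h
  obtain ⟨P, l, r, hP⟩ := exists_pushout (cof_fromZero X) (fromZero X)
  obtain ⟨I, i, q, hi, hq, fac⟩ := exists_factorization (hP.desc j₀ j₁ (fromZero_eq _ _))
  have e₀ : (l ≫ i) ≫ q = j₀ := by rw [Category.assoc, fac, hP.inl_desc]
  have e₁ : (r ≫ i) ≫ q = j₁ := by rw [Category.assoc, fac, hP.inr_desc]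
  refine ⟨⟨P, l, r, hP, I, i, q ≫ p, hi, weq_trans hq hp, ?_, ?_⟩, q ≫ H, ?_, ?_⟩
  · rw [← Category.assoc, ← Category.assoc, e₀, h₀]
  · rw [← Category.assoc, ← Category.assoc, e₁, h₁]
  · rw [← Category.assoc]; exact congrArg (· ≫ H) e₀
  · rw [← Category.assoc]; exact congrArg (· ≫ H) e₁

lemma Homotopic.refl (f : X ⟶ Y) : Homotopic f f :=
  ⟨X, 𝟙 X, 𝟙 X, 𝟙 X, f, weq_of_isIso _, Category.id_comp _, Category.id_comp _,
    Category.id_comp _, Category.id_comp _⟩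

variable (X) in
lemma nonempty_cylinder : Nonempty (Cylinder X) :=
  ⟨(Homotopic.refl (𝟙 X)).exists_cylinder.choose⟩

lemma Homotopic.symm {f g : X ⟶ Y} (h : Homotopic f g) : Homotopic g f :=
  let ⟨I, p, i₀, i₁, H, hp, h₀, h₁, hf, hg⟩ := h
  ⟨I, p, i₁, i₀, H, hp, h₁, h₀, hg, hf⟩

lemma Homotopic.postcomp {f g : X ⟶ Y} (h : Homotopic f g) (a : Y ⟶ Z) :
    Homotopic (f ≫ a) (g ≫ a) := by
  obtain ⟨I, p, i₀, i₁, H, hp, h₀, h₁, rfl, rfl⟩ := h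
  exact ⟨I, p, i₀, i₁, H ≫ a, hp, h₀, h₁, (Category.assoc _ _ _).symm,
    (Category.assoc _ _ _).symm⟩

lemma Homotopic.trans {f g h : X ⟶ Y} (hfg : Homotopic f g) (hgh : Homotopic g h) :
    Homotopic f h := by
  obtain ⟨I, H, rfl, rfl⟩ := hfg.exists_cylinder
  obtain ⟨J, p, j₀, j₁, K, hp, h₀, h₁, hK, rfl⟩ := hgh
  obtain ⟨G, a, b, hG⟩ := exists_pushout I.cof_i₁ j₀
  have wb : weakEquivalences C b := acyclic_inr hG I.cof_i₁ I.weq_i₁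
  refine ⟨G, hG.desc I.p p (by rw [I.i₁_p, h₀]), I.i₀ ≫ a, j₁ ≫ b,
    hG.desc H K hK.symm, ?_, ?_, ?_, ?_, ?_⟩
  · exact weq_of_precomp wb (by rw [hG.inr_desc]; exact hp)
  · rw [Category.assoc, hG.inl_desc, I.i₀_p]
  · rw [Category.assoc, hG.inr_desc, h₁]
  · rw [Category.assoc, hG.inl_desc]
  · rw [Category.assoc, hG.inr_desc]

/-- The relation on morphisms of being homotopic after composition with an acyclic
cofibration. -/
def HoRel : HomRel C := fun _ Y f g =>
  ∃ (Y' : C) (s : Y ⟶ Y'), cofibrations C s ∧ weakEquivalences C s ∧ Homotopic (f ≫ s) (g ≫ s)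

/-- Glue the cylinder to `Y` along `(f, g)`. The homotopy and `q` define a map from the result to
`Z`; after factoring it, `Y` embeds by a cofibration that is acyclic because `q` is a weak
equivalence, and the glued cylinder is the homotopy. -/
lemma HoRel.of_homotopic_postcomp {f g : X ⟶ Y} {q : Y ⟶ Z} (hq : weakEquivalences C q)
    (h : Homotopic (f ≫ q) (g ≫ q)) : HoRel f g := by
  obtain ⟨I, H, h₀, h₁⟩ := h.exists_cylinder
  obtain ⟨Q, a, b, hQ⟩ := exists_pushout I.cof
    (I.isPushout.desc f g (fromZero_eq _ _))
  have w : I.i ≫ H = I.isPushout.desc f g (fromZero_eq _ _) ≫ q := by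
    apply I.isPushout.hom_ext
    · rw [← Category.assoc, ← Category.assoc, I.isPushout.inl_desc]; exact h₀
    · rw [← Category.assoc, ← Category.assoc, I.isPushout.inr_desc]; exact h₁
  obtain ⟨R, c, p, hc, hp, fac⟩ := exists_factorization (hQ.desc H q w)
  refine ⟨R, b ≫ c, cof_trans (cof_inr hQ I.cof) hc, ?_, I.obj, I.p, I.i₀, I.i₁, a ≫ c, I.weq,
    I.i₀_p, I.i₁_p, ?_, ?_⟩
  · exact weq_of_postcomp hp (by rw [Category.assoc, fac, hQ.inr_desc]; exact hq)
  · rw [Cylinder.i₀, Category.assoc, ← Category.assoc I.i, hQ.w, Category.assoc,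
      I.isPushout.inl_desc_assoc]
  · rw [Cylinder.i₁, Category.assoc, ← Category.assoc I.i, hQ.w, Category.assoc,
      I.isPushout.inr_desc_assoc]

lemma HoRel.of_postcomp {f g : X ⟶ Y} {q : Y ⟶ Z} (hq : weakEquivalences C q)
    (h : HoRel (f ≫ q) (g ≫ q)) : HoRel f g := by
  obtain ⟨Z', s, _, hs, h⟩ := h
  rw [Category.assoc, Category.assoc] at h
  exact .of_homotopic_postcomp (weq_trans hq hs) h

lemma HoRel.of_eq_postcomp {f g : X ⟶ Y} {q : Y ⟶ Z} (hq : weakEquivalences C q)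
    (h : f ≫ q = g ≫ q) : HoRel f g :=
  .of_homotopic_postcomp hq (h ▸ Homotopic.refl _)

lemma HoRel.postcomp {f g : X ⟶ Y} (h : HoRel f g) (a : Y ⟶ Z) : HoRel (f ≫ a) (g ≫ a) := by
  obtain ⟨Y', s, cs, ws, h⟩ := h
  obtain ⟨Z', b, t, hZ⟩ := exists_pushout cs a
  refine ⟨Z', t, cof_inr hZ cs, acyclic_inr hZ cs ws, ?_⟩
  rw [Category.assoc, Category.assoc, ← hZ.w, ← Category.assoc, ← Category.assoc]
  exact h.postcomp b

/-- Cylinders are not functorial, so a homotopy does not restrict along `a` directly. However `a ≫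
i₀` and `a ≫ i₁` agree after the weak equivalence `p`, hence are related. -/
lemma HoRel.precomp (a : W ⟶ X) {f g : X ⟶ Y} (h : HoRel f g) : HoRel (a ≫ f) (a ≫ g) := by
  obtain ⟨Y', s, -, ws, I, p, i₀, i₁, H, hp, h₀, h₁, hf, hg⟩ := h
  apply HoRel.of_postcomp ws
  rw [Category.assoc, Category.assoc, ← hf, ← hg, ← Category.assoc, ← Category.assoc]
  refine HoRel.postcomp (.of_eq_postcomp hp ?_) H
  rw [Category.assoc, Category.assoc, h₀, h₁]

lemma HoRel.trans {f g h : X ⟶ Y} (hfg : HoRel f g) (hgh : HoRel g h) : HoRel f h := by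
  obtain ⟨Y', s, cs, ws, hfg⟩ := hfg
  obtain ⟨Y'', t, ct, wt, hgh⟩ := hgh
  obtain ⟨P, a, b, hP⟩ := exists_pushout cs t
  refine ⟨P, s ≫ a, cof_trans cs (cof_inl hP ct), weq_trans ws (acyclic_inl hP ct wt), ?_⟩
  have h1 := hfg.postcomp a
  have h2 := hgh.postcomp b
  simp only [Category.assoc, hP.w] at h1 h2 ⊢
  exact h1.trans h2

instance : Congruence (HoRel (C := C)) where
  comp_left a _ _ h := h.precomp a
  comp_right a h := h.postcomp a
  equivalence :=
    { refl := fun f => .of_eq_postcomp (weq_of_isIso (𝟙 _)) (congrArg (· ≫ 𝟙 _) (Eq.refl f))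
      symm := fun ⟨Y', s, cs, ws, h⟩ => ⟨Y', s, cs, ws, h.symm⟩
      trans := fun h h' => h.trans h' }

/-- Every weak equivalence `w` is an acyclic cofibration followed by a retraction of an acyclic
cofibration. -/
lemma exists_brown_factorization {w : X ⟶ Y} (hw : weakEquivalences C w) :
    ∃ (Z : C) (j : X ⟶ Z) (k : Y ⟶ Z) (q : Z ⟶ Y), cofibrations C j ∧ weakEquivalences C j ∧
      cofibrations C k ∧ weakEquivalences C k ∧ weakEquivalences C q ∧
      j ≫ q = w ∧ k ≫ q = 𝟙 Y := by
  obtain ⟨P, a, b, hP⟩ := exists_pushout (cof_fromZero X) (fromZero Y)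
  obtain ⟨Z, c, p, hc, hp, fac⟩ := exists_factorization (hP.desc w (𝟙 Y) (fromZero_eq _ _))
  have ea : (a ≫ c) ≫ p = w := by rw [Category.assoc, fac, hP.inl_desc]
  have eb : (b ≫ c) ≫ p = 𝟙 Y := by rw [Category.assoc, fac, hP.inr_desc]
  exact ⟨Z, a ≫ c, b ≫ c, p, cof_trans (cof_inl hP (cof_fromZero Y)) hc,
    weq_of_postcomp hp (by rw [ea]; exact hw), cof_trans (cof_inr hP (cof_fromZero X)) hc,
    weq_of_postcomp hp (by rw [eb]; exact weq_of_isIso _), hp, ea, eb⟩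

/-- Gluing a copy of `X` to each end of the cylinder of `W` along the acyclic cofibration `j` gives
an object weakly equivalent to `X`, on which the homotopy extends by `f` and `g`. -/
lemma HoRel.of_precomp_acyclic {j : W ⟶ X} (cj : cofibrations C j) (wj : weakEquivalences C j)
    {f g : X ⟶ Y} (h : HoRel (j ≫ f) (j ≫ g)) : HoRel f g := by
  obtain ⟨Y', s, cs, ws, I, p, i₀, i₁, H, hp, h₀, h₁, hf, hg⟩ := h
  refine ⟨Y', s, cs, ws, ?_⟩
  obtain ⟨P, a, b, hP⟩ := exists_pushout cj i₀
  obtain ⟨G, c, d, hG⟩ := exists_pushout cj (i₁ ≫ b)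
  have wb : weakEquivalences C (b ≫ d) :=
    weq_trans (acyclic_inr hP cj wj) (acyclic_inr hG cj wj)
  have w₀ : j ≫ 𝟙 X = i₀ ≫ p ≫ j := by
    rw [← Category.assoc, h₀, Category.id_comp, Category.comp_id]
  have w₁ : j ≫ 𝟙 X = (i₁ ≫ b) ≫ hP.desc (𝟙 X) (p ≫ j) w₀ := by
    rw [Category.assoc, hP.inr_desc, ← Category.assoc, h₁, Category.id_comp, Category.comp_id]
  have v₀ : j ≫ f ≫ s = i₀ ≫ H := by rw [hf, Category.assoc]
  have v₁ : j ≫ g ≫ s = (i₁ ≫ b) ≫ hP.desc (f ≫ s) H v₀ := by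
    rw [Category.assoc, hP.inr_desc, hg, Category.assoc]
  refine ⟨G, hG.desc (𝟙 X) (hP.desc (𝟙 X) (p ≫ j) w₀) w₁, a ≫ d, c,
    hG.desc (g ≫ s) (hP.desc (f ≫ s) H v₀) v₁, ?_, ?_, ?_, ?_, ?_⟩
  · refine weq_of_precomp wb ?_
    rw [Category.assoc, hG.inr_desc, hP.inr_desc]
    exact weq_trans hp wj
  · rw [Category.assoc, hG.inr_desc, hP.inl_desc]
  · rw [hG.inl_desc]
  · rw [Category.assoc, hG.inr_desc, hP.inl_desc]
  · rw [hG.inl_desc]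

lemma HoRel.of_precomp {w : W ⟶ X} (hw : weakEquivalences C w) {f g : X ⟶ Y}
    (h : HoRel (w ≫ f) (w ≫ g)) : HoRel f g := by
  obtain ⟨Z, j, k, q, cj, wj, -, -, -, rfl, hk⟩ := exists_brown_factorization hw
  rw [Category.assoc, Category.assoc] at h
  have h' := (HoRel.of_precomp_acyclic cj wj h).precomp k
  rwa [← Category.assoc, ← Category.assoc, hk, Category.id_comp, Category.id_comp] at h'

variable (C) in
/-- The images of the weak equivalences in the quotient by the homotopy relation. -/
def homotopyWeq : MorphismProperty (Quotient (HoRel (C := C))) := fun X Y φ =>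
  ∃ w : X.as ⟶ Y.as, weakEquivalences C w ∧ (Quotient.functor HoRel).map w = φ

instance : (homotopyWeq C).IsMultiplicative where
  id_mem X := ⟨𝟙 X.as, weq_of_isIso _, (Quotient.functor HoRel).map_id _⟩
  comp_mem := by
    rintro X Y Z _ _ ⟨w, hw, rfl⟩ ⟨w', hw', rfl⟩
    exact ⟨w ≫ w', weq_trans hw hw', (Quotient.functor HoRel).map_comp _ _⟩

instance : (homotopyWeq C).HasLeftCalculusOfFractions where
  exists_leftFraction := by
    rintro ⟨X⟩ ⟨Y⟩ ⟨s, ⟨w, hw, rfl⟩, f⟩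
    obtain ⟨f, rfl⟩ := (Quotient.functor HoRel).map_surjective f
    dsimp at w f
    obtain ⟨Z, j, k, q, cj, wj, ck, wk, wq, hj, hk⟩ := exists_brown_factorization hw
    obtain ⟨P, g, t, hP⟩ := exists_pushout cj f
    refine ⟨⟨(Quotient.functor HoRel).map (k ≫ g), (Quotient.functor HoRel).map t,
      ⟨t, acyclic_inr hP cj wj, rfl⟩⟩, ?_⟩
    refine ((Quotient.functor HoRel).map_comp _ _).symm.trans (Eq.trans ?_
      ((Quotient.functor HoRel).map_comp _ _))
    rw [Quotient.functor_map_eq_iff, ← hP.w, ← Category.assoc]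
    refine HoRel.postcomp (.of_eq_postcomp wq ?_) g
    rw [Category.assoc, hk, Category.comp_id, hj]
  ext := by
    rintro ⟨X'⟩ ⟨X⟩ ⟨Y⟩ f g s ⟨w, hw, rfl⟩ h
    obtain ⟨f, rfl⟩ := (Quotient.functor HoRel).map_surjective f
    obtain ⟨g, rfl⟩ := (Quotient.functor HoRel).map_surjective g
    refine ⟨_, 𝟙 _, MorphismProperty.id_mem _ _, ?_⟩
    rw [Category.comp_id, Category.comp_id, Quotient.functor_map_eq_iff]
    refine HoRel.of_precomp hw ?_
    rw [← Quotient.functor_map_eq_iff HoRel, Functor.map_comp, Functor.map_comp]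
    exact h

lemma γ_eq_of_hoRel {f g : X ⟶ Y} (h : HoRel f g) : (γ C).map f = (γ C).map g := by
  obtain ⟨Y', s, -, ws, I, p, i₀, i₁, H, hp, h₀, h₁, hf, hg⟩ := h
  have := isIso_γ s ws
  have := isIso_γ p hp
  have e : (γ C).map i₀ = (γ C).map i₁ := by
    rw [← cancel_mono ((γ C).map p), ← Functor.map_comp, ← Functor.map_comp, h₀, h₁]
  rw [← cancel_mono ((γ C).map s), ← Functor.map_comp, ← Functor.map_comp, ← hf, ← hg,
    Functor.map_comp, Functor.map_comp, e]

/-- Two morphisms become equal in the homotopy category if and only if they become homotopic after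
composition with an acyclic cofibration. -/
lemma γ_map_eq_iff {f g : X ⟶ Y} : (γ C).map f = (γ C).map g ↔ HoRel f g := by
  refine ⟨fun h => ?_, γ_eq_of_hoRel⟩
  let L := Quotient.functor (HoRel (C := C)) ⋙ (homotopyWeq C).Q
  have hL : (weakEquivalences C).IsInvertedBy L := fun X Y w hw =>
    (homotopyWeq C).Q_inverts _ ⟨w, hw, rfl⟩
  -- `L` inverts weak equivalences, so it factors through `γ`; fractions over the quotient category
  -- then detect the equality.
  have h' : L.map f = L.map g := by
    have e := Localization.Construction.fac L hL
    have := congrArg (Localization.Construction.lift L hL).map h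
    have hf := Functor.congr_hom e f
    have hg := Functor.congr_hom e g
    simp only [Functor.comp_map] at hf hg
    rw [hf, hg] at this
    simpa only [cancel_epi, cancel_mono] using this
  obtain ⟨⟨Z⟩, _, ⟨w, hw, rfl⟩, h⟩ :=
    (MorphismProperty.map_eq_iff_postcomp (homotopyWeq C).Q (homotopyWeq C) _ _).1 h'
  refine HoRel.of_postcomp hw ?_
  rw [← Quotient.functor_map_eq_iff HoRel, Functor.map_comp, Functor.map_comp]
  exact h

/-- Every morphism of the homotopy category is a left fraction whose denominator is an acyclic
cofibration. -/
lemma exists_fraction (φ : (γ C).obj X ⟶ (γ C).obj Y) :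
    ∃ (Z : C) (f : X ⟶ Z) (s : Y ⟶ Z), cofibrations C s ∧ weakEquivalences C s ∧
      φ ≫ (γ C).map s = (γ C).map f := by
  -- Induction over words in morphisms of `C` and formal inverses. The equalities of objects are
  -- built in because the induction ranges over arbitrary objects of the localization.
  let P : MorphismProperty (Ho C) := fun A B φ => ∀ (X Y : C) (hX : A = (γ C).obj X)
    (hY : (γ C).obj Y = B),
    ∃ (Z : C) (f : X ⟶ Z) (s : Y ⟶ Z), cofibrations C s ∧ weakEquivalences C s ∧
      φ ≫ eqToHom hY.symm ≫ (γ C).map s = eqToHom hX ≫ (γ C).map f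
  have inj : ∀ {X Y : C}, (γ C).obj X = (γ C).obj Y → X = Y := fun h =>
    (Localization.Construction.objEquiv (weakEquivalences C)).injective h
  have hc : P.IsStableUnderComposition := by
    refine ⟨fun {A B D} φ ψ hφ hψ X Y hX hY => ?_⟩
    obtain ⟨B, rfl⟩ : ∃ B', (γ C).obj B' = B :=
      (Localization.Construction.objEquiv (weakEquivalences C)).surjective B
    obtain ⟨Z, f, s, cs, ws, e⟩ := hφ X B hX rfl
    obtain ⟨Z', f', s', cs', ws', e'⟩ := hψ B Y rfl hY
    obtain ⟨Q, a, b, hQ⟩ := exists_pushout cs f'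
    refine ⟨Q, f ≫ a, s' ≫ b, cof_trans cs' (cof_inr hQ cs),
      weq_trans ws' (acyclic_inr hQ cs ws), ?_⟩
    subst hX hY
    simp only [eqToHom_refl, Category.id_comp] at e e' ⊢
    rw [Category.assoc, (γ C).map_comp s', reassoc_of% e', ← (γ C).map_comp, ← hQ.w,
      (γ C).map_comp s, reassoc_of% e, ← (γ C).map_comp]
  have h := Localization.Construction.morphismProperty_eq_top P ?_ ?_
  · have : P φ := h ▸ MorphismProperty.top_apply φ
    simpa using this X Y rfl rfl
  · intro A B f X Y hX hY
    obtain rfl := inj hX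
    obtain rfl := inj hY
    exact ⟨_, f, 𝟙 _, cof_of_isIso _, weq_of_isIso _, by simp⟩
  · intro A B w hw X Y hX hY
    obtain rfl := inj hX
    obtain rfl := inj hY
    obtain ⟨Z, j, k, q, cj, wj, -, -, wq, hj, hk⟩ := exists_brown_factorization hw
    -- With `w = j ≫ q` and `k ≫ q = 𝟙`, the inverse of `w` is the fraction with numerator `k` and
    -- denominator `j`.
    refine ⟨Z, k, j, cj, wj, ?_⟩
    have := isIso_γ _ hw
    have := isIso_γ _ wq
    simp only [eqToHom_refl, Category.id_comp]
    rw [← cancel_epi ((γ C).map w), ← cancel_mono ((γ C).map q)]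
    have e : (γ C).map w ≫ Localization.Construction.wInv w hw = 𝟙 _ :=
      (Localization.Construction.wIso w hw).hom_inv_id
    rw [reassoc_of% e, Category.assoc, ← Functor.map_comp, ← Functor.map_comp, hj, hk,
      CategoryTheory.Functor.map_id, Category.comp_id]

end Fractions

end CofibrationCategory

namespace CofibrationCategory

/-! ### Invariance of cobase change and of quotients under weak equivalences -/

section Gluing

variable {C : Type u} [Category.{v} C] [CofibrationCategory C]

/-- A weak equivalence between cofibrations under `A` stays a weak equivalence after cobase change
along a morphism `A ⟶ D`. -/
lemma glue_weq {A Y Y' D P P' : C} {i : A ⟶ Y} {i' : A ⟶ Y'} {b : Y ⟶ Y'}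
    (hi : cofibrations C i) (hi' : cofibrations C i') (hb : weakEquivalences C b)
    (hib : i ≫ b = i') {f : A ⟶ D} {x : Y ⟶ P} {d : D ⟶ P} {x' : Y' ⟶ P'} {d' : D ⟶ P'}
    (hP : IsPushout i f x d) (hP' : IsPushout i' f x' d')
    (w : i ≫ b ≫ x' = f ≫ d') : weakEquivalences C (hP.desc (b ≫ x') d' w) := by
  -- Relative to `A`, factor `b` as the acyclic cofibration `n ≫ c` followed by `p`, which has the
  -- acyclic cofibration `m ≫ c` as a section. Acyclic cofibrations survive cobase change, and
  -- 2-out-of-3 handles `p`.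
  obtain ⟨R, n, m, hR⟩ := exists_pushout hi i'
  obtain ⟨S, c, p, hc, hp, fac⟩ :=
    exists_factorization (hR.desc b (𝟙 Y') (by rw [hib, Category.comp_id]))
  have en : (n ≫ c) ≫ p = b := by rw [Category.assoc, fac, hR.inl_desc]
  have em : (m ≫ c) ≫ p = 𝟙 Y' := by rw [Category.assoc, fac, hR.inr_desc]
  have cn : cofibrations C (n ≫ c) := cof_trans (cof_inl hR hi') hc
  have cm : cofibrations C (m ≫ c) := cof_trans (cof_inr hR hi) hc
  have wn : weakEquivalences C (n ≫ c) := weq_of_postcomp hp (by rw [en]; exact hb)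
  have wm : weakEquivalences C (m ≫ c) :=
    weq_of_postcomp hp (by rw [em]; exact weq_of_isIso _)
  obtain ⟨PS, y, e, hPS⟩ := exists_pushout cn x
  have hS : IsPushout (i ≫ n ≫ c) f y (d ≫ e) := (hP.flip.paste_vert hPS.flip).flip
  have wS : i' ≫ (m ≫ c) ≫ y = f ≫ d ≫ e := by
    rw [← hS.w, ← Category.assoc i', ← Category.assoc i', ← hR.w, Category.assoc i n c]
  have hm : IsPushout (m ≫ c) x' y (hP'.desc ((m ≫ c) ≫ y) (d ≫ e) wS) := by
    refine (IsPushout.of_top (h₁₁ := f) (v₁₁ := i') (v₁₂ := d') ?_ ?_ hP'.flip).flip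
    · rw [hP'.inr_desc, ← Category.assoc, ← hR.w, Category.assoc]
      exact hS.flip
    · rw [hP'.inl_desc]
  have we' := acyclic_inr hm cm wm
  have wr : (i ≫ n ≫ c) ≫ p ≫ x' = f ≫ d' := by
    rw [← w, ← en]; simp only [Category.assoc]
  have hr : weakEquivalences C (hS.desc (p ≫ x') d' wr) := by
    refine weq_of_precomp we' ?_
    have : hP'.desc ((m ≫ c) ≫ y) (d ≫ e) wS ≫ hS.desc (p ≫ x') d' wr = 𝟙 P' := by
      apply hP'.hom_ext
      · rw [hP'.inl_desc_assoc, Category.assoc, hS.inl_desc, ← Category.assoc, em,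
          Category.id_comp, Category.comp_id]
      · rw [hP'.inr_desc_assoc, hS.inr_desc, Category.comp_id]
    rw [this]
    exact weq_of_isIso _
  have : hP.desc (b ≫ x') d' w = e ≫ hS.desc (p ≫ x') d' wr := by
    apply hP.hom_ext
    · rw [hP.inl_desc, ← Category.assoc, ← hPS.w, Category.assoc, hS.inl_desc, ← Category.assoc,
        en]
    · rw [hP.inr_desc, ← Category.assoc, hS.inr_desc]
  rw [this]
  exact weq_trans (acyclic_inr hPS cn wn) hr

variable [HasZeroObject C]

lemma quotMap_weq_of_weq {X Y Y' : C} {f : X ⟶ Y} (hf : cofibrations C f) {f' : X ⟶ Y'}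
    (hf' : cofibrations C f') {b : Y ⟶ Y'} (hb : weakEquivalences C b) (w : f ≫ b = 𝟙 X ≫ f') :
    weakEquivalences C (quotMap f hf f' hf' (𝟙 X) b w) :=
  glue_weq hf hf' hb (by rw [w, Category.id_comp]) (quot_isPushout f hf) (quot_isPushout f' hf')
    _

lemma isIso_quotMap_of_isPushout {X Y X' Y' : C} {f : X ⟶ Y} {hf : cofibrations C f}
    {f' : X' ⟶ Y'} {hf' : cofibrations C f'} {a : X ⟶ X'} {b : Y ⟶ Y'}
    (h : IsPushout f a b f') : IsIso (quotMap f hf f' hf' a b h.w) := by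
  have hpo : IsPushout f (toZero X) (b ≫ quotProj f' hf') (fromZero _) := by
    have := h.paste_vert (quot_isPushout f' hf')
    rwa [toZero_eq (a ≫ toZero X') (toZero X)] at this
  have : quotMap f hf f' hf' a b h.w = ((quot_isPushout f hf).isoIsPushout _ _ hpo).hom := by
    apply quot_hom_ext
    rw [IsPushout.inl_isoIsPushout_hom]
    exact quotProj_quotMap _ _ _ _ _ _ _
  rw [this]
  infer_instance

end Gluing

/-! ### Zero object and coproducts of the homotopy category -/

section Ho

variable {C : Type u} [Category.{v} C] [CofibrationCategory C] [HasZeroObject C]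

lemma exists_γ_obj_eq (A : Ho C) : ∃ X : C, (γ C).obj X = A :=
  (Localization.Construction.objEquiv (weakEquivalences C)).surjective A

variable (C) in
lemma isZero_γ_zero : IsZero ((γ C).obj (0 : C)) := by
  have key : ∀ {X Y : C} (a b : (γ C).obj X ⟶ (γ C).obj Y),
      (∃ (Z : C) (f g : X ⟶ Z) (s : Y ⟶ Z), weakEquivalences C s ∧
        a ≫ (γ C).map s = (γ C).map f ∧ b ≫ (γ C).map s = (γ C).map g ∧
        (γ C).map f = (γ C).map g) → a = b := by
    rintro X Y a b ⟨Z, f, g, s, ws, ha, hb, h⟩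
    have := isIso_γ s ws
    rw [← cancel_mono ((γ C).map s), ha, hb, h]
  constructor
  · intro A
    obtain ⟨X, rfl⟩ := exists_γ_obj_eq A
    refine ⟨⟨⟨(γ C).map (fromZero X)⟩, fun a => ?_⟩⟩
    obtain ⟨Z, f, s, cs, ws, e⟩ := exists_fraction a
    exact key _ _ ⟨Z, f, fromZero X ≫ s, s, ws, e, ((γ C).map_comp _ _).symm, by
      rw [fromZero_eq f (fromZero X ≫ s)]⟩
  · intro A
    obtain ⟨X, rfl⟩ := exists_γ_obj_eq A
    refine ⟨⟨⟨(γ C).map (toZero X)⟩, fun a => ?_⟩⟩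
    obtain ⟨Z, f, s, cs, ws, e⟩ := exists_fraction a
    refine key _ _ ⟨Z, f, toZero X ≫ s, s, ws, e, ((γ C).map_comp _ _).symm, ?_⟩
    -- The target `Z` of the numerator receives a weak equivalence from `0`, so it is isomorphic to
    -- `0` in the homotopy category.
    have : IsIso ((γ C).map (toZero Z)) := by
      have := isIso_γ s ws
      have h : (γ C).map s ≫ (γ C).map (toZero Z) = 𝟙 _ := by
        rw [← Functor.map_comp, toZero_eq (s ≫ toZero Z) (𝟙 0), CategoryTheory.Functor.map_id]
      exact IsIso.of_isIso_fac_left h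
    rw [← cancel_mono ((γ C).map (toZero Z)), ← Functor.map_comp, ← Functor.map_comp,
      toZero_eq (f ≫ toZero Z) ((toZero X ≫ s) ≫ toZero Z)]

lemma isZero_γ {X : C} (hX : WeaklyContractible X) : IsZero ((γ C).obj X) :=
  have := isIso_γ _ hX
  (isZero_γ_zero C).of_iso (asIso ((γ C).map (toZero X)))

variable {X Y P : C} {l : X ⟶ P} {r : Y ⟶ P}

lemma coprod_map_isPushout (h : IsPushout (fromZero X) (fromZero Y) l r) {I M : C} {m : I ⟶ M}
    {n : Y ⟶ M} (h' : IsPushout (fromZero I) (fromZero Y) m n) (i : X ⟶ I) :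
    IsPushout i l m (h.desc (i ≫ m) n (fromZero_eq _ _)) := by
  refine IsPushout.of_left ?_ (h.inl_desc _ _ _).symm h
  rwa [h.inr_desc, fromZero_eq (fromZero X ≫ i) (fromZero I)]

/-- The coproduct of two cofibrations as a composition of cobase changes. -/
lemma exists_coprod_map_fac (h : IsPushout (fromZero X) (fromZero Y) l r) {I J G : C} {x : I ⟶ G}
    {y : J ⟶ G} (h' : IsPushout (fromZero I) (fromZero J) x y) (i : X ⟶ I) (j : Y ⟶ J) :
    ∃ (M : C) (m : I ⟶ M) (n : Y ⟶ M) (a : P ⟶ M) (b : M ⟶ G), IsPushout i l m a ∧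
      IsPushout j n y b ∧ a ≫ b = h.desc (i ≫ x) (j ≫ y) (fromZero_eq _ _) := by
  obtain ⟨M, m, n, hM⟩ := exists_pushout (cof_fromZero I) (fromZero Y)
  refine ⟨M, m, n, _, _, coprod_map_isPushout h hM i, coprod_map_isPushout hM.flip h'.flip j, ?_⟩
  apply h.hom_ext
  · rw [h.inl_desc_assoc, Category.assoc, h.inl_desc]
    exact congrArg (i ≫ ·) (hM.flip.inr_desc _ _ _)
  · rw [h.inr_desc_assoc, h.inr_desc]
    exact hM.flip.inl_desc _ _ _

lemma coprod_map_acyclic (h : IsPushout (fromZero X) (fromZero Y) l r) {I J G : C} {x : I ⟶ G}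
    {y : J ⟶ G} (h' : IsPushout (fromZero I) (fromZero J) x y) {i : X ⟶ I} {j : Y ⟶ J}
    (ci : cofibrations C i) (wi : weakEquivalences C i)
    (cj : cofibrations C j) (wj : weakEquivalences C j) :
    weakEquivalences C (h.desc (i ≫ x) (j ≫ y) (fromZero_eq _ _)) := by
  obtain ⟨M, m, n, a, b, ha, hb, e⟩ := exists_coprod_map_fac h h' i j
  exact e ▸ weq_trans (acyclic_inr ha ci wi) (acyclic_inr hb cj wj)

/-- Coproducts in `C` are coproducts in the homotopy category: existence. -/
lemma exists_coprod_desc (h : IsPushout (fromZero X) (fromZero Y) l r) {A : Ho C}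
    (a : (γ C).obj X ⟶ A) (b : (γ C).obj Y ⟶ A) :
    ∃ d : (γ C).obj P ⟶ A, (γ C).map l ≫ d = a ∧ (γ C).map r ≫ d = b := by
  obtain ⟨Z, rfl⟩ := exists_γ_obj_eq A
  obtain ⟨Z₁, f, s, cs, ws, ha⟩ := exists_fraction a
  obtain ⟨Z₂, g, t, ct, wt, hb⟩ := exists_fraction b
  obtain ⟨Q, x, y, hQ⟩ := exists_pushout cs t
  have w : weakEquivalences C (s ≫ x) := weq_trans ws (acyclic_inl hQ ct wt)
  have := isIso_γ _ w
  refine ⟨(γ C).map (h.desc (f ≫ x) (g ≫ y) (fromZero_eq _ _)) ≫ inv ((γ C).map (s ≫ x)),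
    ?_, ?_⟩
  · rw [← Category.assoc, IsIso.comp_inv_eq, ← Functor.map_comp, h.inl_desc, Functor.map_comp,
      Functor.map_comp, reassoc_of% ha]
  · rw [← Category.assoc, IsIso.comp_inv_eq, ← Functor.map_comp, h.inr_desc, hQ.w,
      Functor.map_comp, Functor.map_comp, reassoc_of% hb]

/-- Coproducts in `C` are coproducts in the homotopy category: uniqueness. -/
lemma coprod_hom_ext (h : IsPushout (fromZero X) (fromZero Y) l r) {A : Ho C}
    {a b : (γ C).obj P ⟶ A} (hl : (γ C).map l ≫ a = (γ C).map l ≫ b)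
    (hr : (γ C).map r ≫ a = (γ C).map r ≫ b) : a = b := by
  obtain ⟨Z, rfl⟩ := exists_γ_obj_eq A
  obtain ⟨Z₁, f, s, cs, ws, ha⟩ := exists_fraction a
  obtain ⟨Z₂, g, t, ct, wt, hb⟩ := exists_fraction b
  obtain ⟨Q, x, y, hQ⟩ := exists_pushout cs t
  have w : weakEquivalences C (s ≫ x) := weq_trans ws (acyclic_inl hQ ct wt)
  have := isIso_γ _ w
  have ha' : a ≫ (γ C).map (s ≫ x) = (γ C).map (f ≫ x) := by
    rw [Functor.map_comp, reassoc_of% ha, Functor.map_comp]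
  have hb' : b ≫ (γ C).map (s ≫ x) = (γ C).map (g ≫ y) := by
    rw [hQ.w, Functor.map_comp, reassoc_of% hb, Functor.map_comp]
  have el : HoRel (l ≫ f ≫ x) (l ≫ g ≫ y) := by
    rw [← γ_map_eq_iff, (γ C).map_comp l, ← ha', (γ C).map_comp l, ← hb', reassoc_of% hl]
  have er : HoRel (r ≫ f ≫ x) (r ≫ g ≫ y) := by
    rw [← γ_map_eq_iff, (γ C).map_comp r, ← ha', (γ C).map_comp r, ← hb', reassoc_of% hr]
  -- Over the common denominator `s ≫ x` it remains to combine a homotopy on `X` with one on `Y`.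
  -- After a common acyclic cofibration to `V` both have the same target, and the coproduct of the
  -- two cylinders carries the combined homotopy.
  rw [← cancel_mono ((γ C).map (s ≫ x)), ha', hb', γ_map_eq_iff]
  generalize f ≫ x = f' at el er
  generalize g ≫ y = g' at el er
  obtain ⟨Q₁, s₁, cs₁, ws₁, hl'⟩ := el
  obtain ⟨Q₂, s₂, cs₂, ws₂, hr'⟩ := er
  obtain ⟨V, v₁, v₂, hV⟩ := exists_pushout cs₁ s₂
  obtain ⟨I, H, i₀, i₁⟩ := (hl'.postcomp v₁).exists_cylinder
  obtain ⟨J, K, j₀, j₁⟩ := (hr'.postcomp v₂).exists_cylinder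
  obtain ⟨G, x, y, hG⟩ := exists_pushout (cof_fromZero I.obj) (fromZero J.obj)
  refine ⟨V, s₁ ≫ v₁, cof_trans cs₁ (cof_inl hV cs₂), weq_trans ws₁ (acyclic_inl hV cs₂ ws₂), G,
    hG.desc (I.p ≫ l) (J.p ≫ r) (fromZero_eq _ _), h.desc (I.i₀ ≫ x) (J.i₀ ≫ y)
      (fromZero_eq _ _), h.desc (I.i₁ ≫ x) (J.i₁ ≫ y) (fromZero_eq _ _),
    hG.desc H K (fromZero_eq _ _), ?_, ?_, ?_, ?_, ?_⟩
  · refine weq_of_precomp (f := h.desc (I.i₀ ≫ x) (J.i₀ ≫ y) (fromZero_eq _ _))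
      (coprod_map_acyclic h hG I.cof_i₀ I.weq_i₀ J.cof_i₀ J.weq_i₀) ?_
    have : h.desc (I.i₀ ≫ x) (J.i₀ ≫ y) (fromZero_eq _ _) ≫
        hG.desc (I.p ≫ l) (J.p ≫ r) (fromZero_eq _ _) = 𝟙 P := by
      apply h.hom_ext
      · rw [h.inl_desc_assoc, Category.assoc, hG.inl_desc, reassoc_of% I.i₀_p, Category.comp_id]
      · rw [h.inr_desc_assoc, Category.assoc, hG.inr_desc, reassoc_of% J.i₀_p, Category.comp_id]
    rw [this]
    exact weq_of_isIso _
  · apply h.hom_ext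
    · rw [h.inl_desc_assoc, Category.assoc, hG.inl_desc, reassoc_of% I.i₀_p, Category.comp_id]
    · rw [h.inr_desc_assoc, Category.assoc, hG.inr_desc, reassoc_of% J.i₀_p, Category.comp_id]
  · apply h.hom_ext
    · rw [h.inl_desc_assoc, Category.assoc, hG.inl_desc, reassoc_of% I.i₁_p, Category.comp_id]
    · rw [h.inr_desc_assoc, Category.assoc, hG.inr_desc, reassoc_of% J.i₁_p, Category.comp_id]
  · apply h.hom_ext
    · rw [h.inl_desc_assoc, Category.assoc, hG.inl_desc, i₀]
      simp only [Category.assoc]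
    · rw [h.inr_desc_assoc, Category.assoc, hG.inr_desc, j₀]
      simp only [Category.assoc, hV.w]
  · apply h.hom_ext
    · rw [h.inl_desc_assoc, Category.assoc, hG.inl_desc, i₁]
      simp only [Category.assoc]
    · rw [h.inr_desc_assoc, Category.assoc, hG.inr_desc, j₁]
      simp only [Category.assoc, hV.w]

end Ho
end CofibrationCategory

namespace CofibrationCategory

variable {C : Type u} [Category.{v} C] [CofibrationCategory C] [HasZeroObject C]

/-! ### Naturality of the connecting morphism and morphisms of elementary triangles -/

namespace Cones

variable (K : Cones C) {X Y X' Y' : C}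

variable (X) in
/-- The value of the suspension functor of the homotopy category on `γ X` is `γ (CX/X)`. -/
def σ : (γ C).obj (K.suspObj X) ≅ K.suspension.obj ((γ C).obj X) := Iso.refl _

lemma suspension_map_γ (f : X ⟶ Y) :
    (K.σ X).hom ≫ K.suspension.map ((γ C).map f) = K.suspMap f ≫ (K.σ Y).hom := by
  have h := Functor.congr_hom K.γ_comp_suspension f
  have h' : K.suspension.map ((γ C).map f) = K.suspMap f := by simpa using! h
  exact (Category.id_comp _).trans (h'.trans (Category.comp_id _).symm)

lemma inCone_collapseCone (f : X ⟶ Y) (hf : cofibrations C f) :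
    K.inCone f ≫ K.collapseCone f hf = toZero _ ≫ fromZero _ :=
  (K.mappingCone_isPushout f).inl_desc _ _ _

lemma inBase_collapseCone (f : X ⟶ Y) (hf : cofibrations C f) :
    K.inBase f ≫ K.collapseCone f hf = quotProj f hf :=
  (K.mappingCone_isPushout f).inr_desc _ _ _

lemma inCone_collapseBase (f : X ⟶ Y) :
    K.inCone f ≫ K.collapseBase f = quotProj (K.ι X) (K.cof X) :=
  (K.mappingCone_isPushout f).inl_desc _ _ _

lemma inBase_collapseBase (f : X ⟶ Y) :
    K.inBase f ≫ K.collapseBase f = toZero _ ≫ fromZero _ :=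
  (K.mappingCone_isPushout f).inr_desc _ _ _

lemma cof_inBase (f : X ⟶ Y) : cofibrations C (K.inBase f) :=
  cof_inr (K.mappingCone_isPushout f) (K.cof X)

lemma collapseCone_δ (f : X ⟶ Y) (hf : cofibrations C f) :
    (γ C).map (K.collapseCone f hf) ≫ K.δ f hf =
      (γ C).map (K.collapseBase f) ≫ (K.σ X).hom := by
  have h : (γ C).map (K.collapseCone f hf) ≫ γInv (K.collapseCone f hf)
      (K.collapseCone_weq f hf) ≫ (γ C).map (K.collapseBase f) =
      (γ C).map (K.collapseBase f) := by
    rw [← Category.assoc, γ_γInv, Category.id_comp]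
  exact h.trans (Category.comp_id _).symm

lemma zero_comp_eq {A B D : C} (f : B ⟶ D) :
    toZero A ≫ fromZero B ≫ f = toZero A ≫ fromZero D := by
  rw [fromZero_eq (fromZero B ≫ f)]

lemma comp_zero_eq {A B D : C} (f : A ⟶ B) :
    f ≫ toZero B ≫ fromZero D = toZero A ≫ fromZero D := by
  rw [← Category.assoc, toZero_eq (f ≫ toZero B)]

/-- The connecting morphism is natural with respect to commutative squares. -/
lemma δ_naturality (f : X ⟶ Y) (hf : cofibrations C f) (f' : X' ⟶ Y') (hf' : cofibrations C f')
    (a : X ⟶ X') (b : Y ⟶ Y') (w : f ≫ b = a ≫ f') :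
    (γ C).map (quotMap f hf f' hf' a b w) ≫ K.δ f' hf' =
      K.δ f hf ≫ K.suspension.map ((γ C).map a) := by
  obtain ⟨E⟩ := K.exists_extension a
  have hE : cofibrations C (K.ι X' ≫ E.s) := cof_trans (K.cof X') E.cof_s
  -- `N` is the mapping cone of `f'` formed with the larger cone `E.obj` of `X'`. Both mapping cones
  -- map to it, and its collapses `c` and `d` compare their connecting morphisms.
  obtain ⟨N, n, m, hN⟩ := exists_pushout hE f'
  have hM := K.mappingCone_isPushout f
  have hM' := K.mappingCone_isPushout f'
  -- the morphisms of mapping cones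
  let x : K.mappingCone f ⟶ N := hM.desc (E.map ≫ n) (b ≫ m) (by
    rw [← Category.assoc, E.comm, Category.assoc, Category.assoc, ← Category.assoc (K.ι X'),
      hN.w, ← Category.assoc, ← Category.assoc, w])
  let y : K.mappingCone f' ⟶ N := hM'.desc (E.s ≫ n) m (by rw [← Category.assoc, hN.w])
  let c : N ⟶ quot f' hf' := hN.desc (toZero _ ≫ fromZero _) (quotProj f' hf') (by
    rw [(quot_isPushout f' hf').w, comp_zero_eq])
  let d : N ⟶ quot _ hE := hN.desc (quotProj _ hE) (toZero _ ≫ fromZero _) (by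
    rw [(quot_isPushout _ hE).w, comp_zero_eq])
  have hyc : y ≫ c = K.collapseCone f' hf' := by
    apply hM'.hom_ext
    · rw [inCone_collapseCone, hM'.inl_desc_assoc, Category.assoc, hN.inl_desc, comp_zero_eq]
    · rw [inBase_collapseCone, hM'.inr_desc_assoc, hN.inr_desc]
  have hxc : x ≫ c = K.collapseCone f hf ≫ quotMap f hf f' hf' a b w := by
    apply hM.hom_ext
    · rw [reassoc_of% (K.inCone_collapseCone f hf), hM.inl_desc_assoc, Category.assoc,
        hN.inl_desc, comp_zero_eq, zero_comp_eq]
    · rw [reassoc_of% (K.inBase_collapseCone f hf), hM.inr_desc_assoc, Category.assoc,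
        hN.inr_desc, quotProj_quotMap]
  have hyd : y ≫ d = K.collapseBase f' ≫ K.quotS E.s E.cof_s := by
    apply hM'.hom_ext
    · rw [reassoc_of% (K.inCone_collapseBase f'), hM'.inl_desc_assoc, Category.assoc,
        hN.inl_desc, quotS, quotProj_quotMap]
    · rw [reassoc_of% (K.inBase_collapseBase f'), hM'.inr_desc_assoc,
        hN.inr_desc, zero_comp_eq]
  have hxd : x ≫ d = K.collapseBase f ≫ K.quotA a E.map E.s E.cof_s E.comm := by
    apply hM.hom_ext
    · rw [reassoc_of% (K.inCone_collapseBase f), hM.inl_desc_assoc, Category.assoc,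
        hN.inl_desc, quotA, quotProj_quotMap]
    · rw [reassoc_of% (K.inBase_collapseBase f), hM.inr_desc_assoc, Category.assoc,
        hN.inr_desc, zero_comp_eq, comp_zero_eq]
  -- `y` is a cobase change of the acyclic cofibration `E.s`.
  have wy : weakEquivalences C y :=
    acyclic_inr (IsPushout.of_top (h₁₁ := f') (v₁₁ := K.ι X') (v₁₂ := K.inBase f')
      (h₂₁ := K.inCone f') (v₂₁ := E.s) (h₃₁ := n) (v₂₂ := y)
      (by rw [hM'.inr_desc]; exact hN.flip) (hM'.inl_desc _ _ _) hM'.flip).flip E.cof_s E.weq_s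
  have wc : weakEquivalences C c :=
    weq_of_precomp wy (by rw [hyc]; exact K.collapseCone_weq f' hf')
  have i1 := isIso_γ _ (K.collapseCone_weq f hf)
  have i2 := isIso_γ _ wc
  have i3 := isIso_γ _ wy
  have i4 := isIso_γ _ (K.quotS_weq E.s E.cof_s E.weq_s)
  have e : (γ C).map c ≫ K.δ f' hf' ≫ (K.σ X').inv ≫ (γ C).map (K.quotS E.s E.cof_s) =
      (γ C).map d := by
    rw [← cancel_epi ((γ C).map y), ← reassoc_of% ((γ C).map_comp y c), hyc,
      ← (γ C).map_comp y d, hyd, reassoc_of% (K.collapseCone_δ f' hf'), Iso.hom_inv_id_assoc,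
      Functor.map_comp]
  have hq := K.suspMap_quotS a E.map E.s E.cof_s E.weq_s E.comm
  have hσ := K.suspension_map_γ a
  rw [← cancel_epi ((γ C).map (K.collapseCone f hf)), ← cancel_mono (K.σ X').inv,
    ← cancel_mono ((γ C).map (K.quotS E.s E.cof_s))]
  simp only [Category.assoc]
  rw [reassoc_of% (K.collapseCone_δ f hf), reassoc_of% hσ, Iso.hom_inv_id_assoc, hq,
    ← reassoc_of% ((γ C).map_comp (K.collapseCone f hf)), ← hxc, Functor.map_comp,
    Category.assoc, e, ← Functor.map_comp, hxd, Functor.map_comp]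

/-- A pair of morphisms in the homotopy category extends to a morphism between the elementary exact
triangles of `f` and `f'`. -/
def Completes (f : X ⟶ Y) (hf : cofibrations C f) (f' : X' ⟶ Y') (hf' : cofibrations C f')
    (a : (γ C).obj X ⟶ (γ C).obj X') (b : (γ C).obj Y ⟶ (γ C).obj Y') : Prop :=
  ∃ c : (γ C).obj (quot f hf) ⟶ (γ C).obj (quot f' hf'),
    (γ C).map (quotProj f hf) ≫ c = b ≫ (γ C).map (quotProj f' hf') ∧
      K.δ f hf ≫ K.suspension.map a = c ≫ K.δ f' hf'

variable {K} {f : X ⟶ Y} {hf : cofibrations C f} {f' : X' ⟶ Y'} {hf' : cofibrations C f'}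

lemma Completes.comp {X'' Y'' : C} {f'' : X'' ⟶ Y''} {hf'' : cofibrations C f''}
    {a : (γ C).obj X ⟶ (γ C).obj X'} {b : (γ C).obj Y ⟶ (γ C).obj Y'}
    {a' : (γ C).obj X' ⟶ (γ C).obj X''} {b' : (γ C).obj Y' ⟶ (γ C).obj Y''}
    (h : K.Completes f hf f' hf' a b) (h' : K.Completes f' hf' f'' hf'' a' b') :
    K.Completes f hf f'' hf'' (a ≫ a') (b ≫ b') := by
  obtain ⟨c, hc, hc'⟩ := h
  obtain ⟨d, hd, hd'⟩ := h'
  refine ⟨c ≫ d, ?_, ?_⟩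
  · rw [reassoc_of% hc, hd, Category.assoc]
  · rw [Functor.map_comp, reassoc_of% hc', hd', Category.assoc]

variable (K) in
lemma completes_γ {a : X ⟶ X'} {b : Y ⟶ Y'} (w : f ≫ b = a ≫ f') :
    K.Completes f hf f' hf' ((γ C).map a) ((γ C).map b) :=
  ⟨(γ C).map (quotMap f hf f' hf' a b w), by
    rw [← Functor.map_comp, quotProj_quotMap, Functor.map_comp],
    (K.δ_naturality f hf f' hf' a b w).symm⟩

variable (K) in
lemma completes_inv {a : X ⟶ X'} {b : Y ⟶ Y'} (w : f ≫ b = a ≫ f') [IsIso ((γ C).map a)]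
    [IsIso ((γ C).map b)] [IsIso ((γ C).map (quotMap f hf f' hf' a b w))] :
    K.Completes f' hf' f hf (inv ((γ C).map a)) (inv ((γ C).map b)) := by
  refine ⟨inv ((γ C).map (quotMap f hf f' hf' a b w)), ?_, ?_⟩
  · rw [IsIso.comp_inv_eq, Category.assoc, ← Functor.map_comp, quotProj_quotMap,
      Functor.map_comp, IsIso.inv_hom_id_assoc]
  · rw [Functor.map_inv, IsIso.comp_inv_eq, Category.assoc, ← δ_naturality _ _ _ _ _ _ _ w,
      IsIso.inv_hom_id_assoc]

variable (K hf hf') in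
/-- Commutative squares in the homotopy category extend to morphisms of elementary exact
triangles. -/
lemma completes_of_comm (a : (γ C).obj X ⟶ (γ C).obj X') (b : (γ C).obj Y ⟶ (γ C).obj Y')
    (w : (γ C).map f ≫ b = a ≫ (γ C).map f') : K.Completes f hf f' hf' a b := by
  -- Write `a` and then `b` as fractions, pushing `f'` out along the denominator of `a`. The
  -- numerators `α` and `β` form a square commuting in the homotopy category, hence up to a homotopy
  -- `H`.
  obtain ⟨X'', α, s, cs, ws, ha⟩ := exists_fraction a
  obtain ⟨Y'', t, f'', hY⟩ := exists_pushout hf' s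
  have ct : cofibrations C t := cof_inl hY cs
  have wt : weakEquivalences C t := acyclic_inl hY cs ws
  have hf'' : cofibrations C f'' := cof_inr hY hf'
  obtain ⟨Y₃, β, s₂, cs₂, ws₂, hb⟩ := exists_fraction (b ≫ (γ C).map t)
  have e : (γ C).map (α ≫ f'' ≫ s₂) = (γ C).map (f ≫ β) := by
    rw [(γ C).map_comp α, ← ha, (γ C).map_comp f, ← hb, (γ C).map_comp f'', Category.assoc,
      Category.assoc, reassoc_of% w, ← reassoc_of% ((γ C).map_comp s f''),
      ← reassoc_of% ((γ C).map_comp f' t), hY.w]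
  obtain ⟨Y₄, s₃, cs₃, ws₃, h⟩ := γ_map_eq_iff.1 e
  obtain ⟨I, H, h₀, h₁⟩ := h.exists_cylinder
  -- `N` is the mapping cylinder of `f`. Using `H` on the cylinder and `β` on `Y` makes the square
  -- strict on the free end `I.i₀`.
  obtain ⟨N, n, g, hN⟩ := exists_pushout hf I.i₁
  have wn : weakEquivalences C n := acyclic_inl hN I.cof_i₁ I.weq_i₁
  have cg : cofibrations C (I.i₀ ≫ g) := cof_trans I.cof_i₀ (cof_inr hN hf)
  have c₄ : cofibrations C (f'' ≫ s₂ ≫ s₃) := cof_trans hf'' (cof_trans cs₂ cs₃)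
  -- the projection of the mapping cylinder
  let π : N ⟶ Y := hN.desc (𝟙 Y) (I.p ≫ f) (by
    rw [Category.comp_id, ← Category.assoc, I.i₁_p, Category.id_comp])
  have hnπ : n ≫ π = 𝟙 Y := hN.inl_desc _ _ _
  have wπ : weakEquivalences C π := weq_of_precomp wn (by rw [hnπ]; exact weq_of_isIso _)
  have eπ : (I.i₀ ≫ g) ≫ π = 𝟙 X ≫ f := by
    rw [Category.assoc, hN.inr_desc, ← Category.assoc, I.i₀_p]
  let ρ : N ⟶ Y₄ := hN.desc (β ≫ s₃) H (by rw [h₁, Category.assoc])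
  have eρ : (I.i₀ ≫ g) ≫ ρ = α ≫ f'' ≫ s₂ ≫ s₃ := by
    rw [Category.assoc, hN.inr_desc, h₀]; simp only [Category.assoc]
  have e₄ : f' ≫ t ≫ s₂ ≫ s₃ = s ≫ f'' ≫ s₂ ≫ s₃ := by
    rw [← Category.assoc, hY.w, Category.assoc]
  have w₄ : weakEquivalences C (t ≫ s₂ ≫ s₃) := weq_trans wt (weq_trans ws₂ ws₃)
  have i₁ := isIso_γ _ wπ
  have i₂ := isIso_γ _ (weq_of_isIso (𝟙 X))
  have i₃ := isIso_γ _ (quotMap_weq_of_weq cg hf wπ eπ)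
  have i₄ := isIso_γ _ ws
  have i₅ := isIso_γ _ w₄
  have i₆ : IsIso ((γ C).map (quotMap f' hf' _ c₄ s (t ≫ s₂ ≫ s₃) e₄)) := by
    have j₁ := isIso_quotMap_of_isPushout (hf := hf') (hf' := hf'') hY
    have j₂ := isIso_γ _ (quotMap_weq f'' hf'' (s₂ ≫ s₃) _ c₄ (Category.id_comp _).symm
      (cof_trans cs₂ cs₃) (weq_trans ws₂ ws₃))
    have : quotMap f' hf' _ c₄ s (t ≫ s₂ ≫ s₃) e₄ = quotMap f' hf' f'' hf'' s t hY.w ≫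
        quotMap f'' hf'' _ c₄ (𝟙 _) (s₂ ≫ s₃) (Category.id_comp _).symm := by
      simp only [quotMap_comp, Category.comp_id]
    rw [this, Functor.map_comp]
    infer_instance
  -- A zigzag of strict squares: the first and last are inverted because all their vertical maps,
  -- including those on quotients, become isomorphisms.
  have key := ((K.completes_inv (hf := cg) (hf' := hf) eπ).comp
    (K.completes_γ (hf := cg) (hf' := c₄) eρ)).comp (K.completes_inv (hf := hf') (hf' := c₄) e₄)
  have ea : (inv ((γ C).map (𝟙 X)) ≫ (γ C).map α) ≫ inv ((γ C).map s) = a := by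
    rw [IsIso.comp_inv_eq, IsIso.inv_comp_eq, CategoryTheory.Functor.map_id, Category.id_comp, ha]
  have eb : (inv ((γ C).map π) ≫ (γ C).map ρ) ≫ inv ((γ C).map (t ≫ s₂ ≫ s₃)) = b := by
    have : inv ((γ C).map π) = (γ C).map n := by
      rw [← cancel_mono ((γ C).map π), IsIso.inv_hom_id, ← Functor.map_comp, hnπ,
        CategoryTheory.Functor.map_id]
    rw [IsIso.comp_inv_eq, this, ← Functor.map_comp, hN.inl_desc, Functor.map_comp, ← hb,
      Functor.map_comp, Functor.map_comp, Category.assoc, Category.assoc]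
  rwa [ea, eb] at key

end Cones

end CofibrationCategory

namespace CofibrationCategory

variable {C : Type u} [Category.{v} C] [CofibrationCategory C] [HasZeroObject C]

section

variable [HasZeroMorphisms (Ho C)]

lemma γ_map_toZero_fromZero (X Y : C) : (γ C).map (toZero X ≫ fromZero Y) = 0 := by
  rw [Functor.map_comp, (isZero_γ_zero C).eq_zero_of_tgt ((γ C).map (toZero X)), zero_comp]

end

lemma isIso_quotProj_of_isZero {X Y : C} (f : X ⟶ Y) (hf : cofibrations C f) (hX : IsZero X) :
    IsIso (quotProj f hf) := by
  have : IsIso (toZero X) := ⟨hX.from_ 0, hX.eq_of_src _ _, toZero_eq _ _⟩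
  exact (quot_isPushout f hf).isIso_inl_of_isIso

/-! ### Exactness properties of the elementary triangles -/

namespace Cones

variable (K : Cones C) {X Y : C}

/-- The isomorphism from `CX/X` to the quotient of `CX ∪_X Y` by `Y`. -/
def suspToQuot (f : X ⟶ Y) : K.suspObj X ⟶ quot (K.inBase f) (K.cof_inBase f) :=
  quotMap (K.ι X) (K.cof X) _ _ f (K.inCone f) (K.mappingCone_isPushout f).w

instance (f : X ⟶ Y) : IsIso (K.suspToQuot f) :=
  isIso_quotMap_of_isPushout (K.mappingCone_isPushout f).flip.flip

lemma collapseBase_suspToQuot (f : X ⟶ Y) :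
    K.collapseBase f ≫ K.suspToQuot f = quotProj (K.inBase f) (K.cof_inBase f) := by
  apply (K.mappingCone_isPushout f).hom_ext
  · rw [reassoc_of% (K.inCone_collapseBase f), suspToQuot, quotProj_quotMap]
  · rw [reassoc_of% (K.inBase_collapseBase f), zero_comp_eq, (quot_isPushout _ _).w]

lemma suspToQuot_δ (f : X ⟶ Y) :
    (γ C).map (K.suspToQuot f) ≫ K.δ (K.inBase f) (K.cof_inBase f) =
      K.δ (K.ι X) (K.cof X) ≫ K.suspension.map ((γ C).map f) :=
  K.δ_naturality _ _ _ _ _ _ _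

variable (X) in
lemma collapseBase_ι_weq : weakEquivalences C (K.collapseBase (K.ι X)) := by
  have h : weakEquivalences C (quotProj (K.inBase (K.ι X)) (K.cof_inBase _)) :=
    weq_collapse (K.cof_inBase _) (K.contractible X) (quot_isPushout _ _)
  rw [← collapseBase_suspToQuot] at h
  exact weq_two_out_of_three.of_postcomp _ _ (weq_of_isIso _) h

variable (X) in
lemma isIso_δ_ι : IsIso (K.δ (K.ι X) (K.cof X)) := by
  have := isIso_γ _ (K.collapseBase_ι_weq X)
  have := isIso_γ _ (K.collapseCone_weq (K.ι X) (K.cof X))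
  have h := K.collapseCone_δ (K.ι X) (K.cof X)
  have h' : K.δ (K.ι X) (K.cof X) = inv ((γ C).map (K.collapseCone (K.ι X) (K.cof X))) ≫
      (γ C).map (K.collapseBase (K.ι X)) ≫ (K.σ X).hom := by rw [IsIso.eq_inv_comp, h]
  rw [h']
  infer_instance

section Exactness

variable [HasZeroMorphisms (Ho C)]

-- Complete `b` to a morphism into the elementary triangle of `0 ⟶ Z`, whose quotient is `Z` itself.
include K in
lemma yoneda_exact₂ (f : X ⟶ Y) (hf : cofibrations C f) {B : Ho C} (b : (γ C).obj Y ⟶ B)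
    (h : (γ C).map f ≫ b = 0) :
    ∃ c : (γ C).obj (quot f hf) ⟶ B, b = (γ C).map (quotProj f hf) ≫ c := by
  obtain ⟨Z, rfl⟩ := exists_γ_obj_eq B
  obtain ⟨c, hc, -⟩ := K.completes_of_comm hf (cof_fromZero Z) 0 b (by rw [h, zero_comp])
  have := isIso_quotProj_of_isZero (fromZero Z) (cof_fromZero Z) (isZero_zero C)
  exact ⟨c ≫ inv ((γ C).map (quotProj (fromZero Z) (cof_fromZero Z))), by
    rw [reassoc_of% hc, IsIso.hom_inv_id, Category.comp_id]⟩

/-- This is `yoneda_exact₂` for `Y ⟶ CX ∪_X Y`, whose quotient is `CX/X`. -/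
lemma yoneda_exact₃ (f : X ⟶ Y) (hf : cofibrations C f) {B : Ho C}
    (b : (γ C).obj (quot f hf) ⟶ B) (h : (γ C).map (quotProj f hf) ≫ b = 0) :
    ∃ c : K.suspension.obj ((γ C).obj X) ⟶ B, b = K.δ f hf ≫ c := by
  obtain ⟨c, hc⟩ := K.yoneda_exact₂ (K.inBase f) (K.cof_inBase f)
    ((γ C).map (K.collapseCone f hf) ≫ b)
    (by rw [← Category.assoc, ← Functor.map_comp, inBase_collapseCone, h])
  have := isIso_γ _ (K.collapseCone_weq f hf)
  refine ⟨(K.σ X).inv ≫ (γ C).map (K.suspToQuot f) ≫ c, ?_⟩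
  rw [← cancel_epi ((γ C).map (K.collapseCone f hf)), hc, reassoc_of% (K.collapseCone_δ f hf),
    Iso.hom_inv_id_assoc, ← collapseBase_suspToQuot, Functor.map_comp, Category.assoc]

variable (hK : K.suspension.IsEquivalence)

-- A map from `W` killed in `Y/X` gives a square from `W ⟶ CW` to `Y ⟶ CX ∪_X Y`. Completing it
-- produces a morphism of suspensions from `W` to `X`; fullness desuspends it and faithfulness
-- verifies the factorization.
include hK in
lemma coyoneda_exact₂ (f : X ⟶ Y) (hf : cofibrations C f) {A : Ho C} (c : A ⟶ (γ C).obj Y)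
    (h : c ≫ (γ C).map (quotProj f hf) = 0) : ∃ x : A ⟶ (γ C).obj X, c = x ≫ (γ C).map f := by
  obtain ⟨W, rfl⟩ := exists_γ_obj_eq A
  have := isIso_γ _ (K.collapseCone_weq f hf)
  obtain ⟨e, -, he⟩ := K.completes_of_comm (K.cof W) (K.cof_inBase f) c 0 (by
    rw [comp_zero, ← cancel_mono ((γ C).map (K.collapseCone f hf)), Category.assoc,
      ← Functor.map_comp, inBase_collapseCone, h, zero_comp])
  have := K.isIso_δ_ι W
  obtain ⟨x, hx⟩ := K.suspension.map_surjective (inv (K.δ (K.ι W) (K.cof W)) ≫ e ≫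
    inv ((γ C).map (K.suspToQuot f)) ≫ K.δ (K.ι X) (K.cof X))
  refine ⟨x, K.suspension.map_injective ?_⟩
  rw [Functor.map_comp, hx, Category.assoc, Category.assoc, Category.assoc, ← suspToQuot_δ,
    IsIso.inv_hom_id_assoc, ← he, IsIso.inv_hom_id_assoc]

end Exactness

/-! ### Biproducts in the homotopy category -/

section Pinch

variable (W : C)

lemma cof_toDouble : cofibrations C (K.ι W ≫ K.inBase (K.ι W)) :=
  cof_trans (K.cof W) (K.cof_inBase _)

/-- The quotient of `CW ∪_W CW` by `W`; it is a coproduct of two copies of `CW/W`. -/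
abbrev doubleSusp : C := quot (K.ι W ≫ K.inBase (K.ι W)) (K.cof_toDouble W)

/-- The pinch morphism. -/
abbrev pinch : K.mappingCone (K.ι W) ⟶ K.doubleSusp W := quotProj _ (K.cof_toDouble W)

lemma ι_inCone : K.ι W ≫ K.inCone (K.ι W) = 𝟙 W ≫ K.ι W ≫ K.inBase (K.ι W) := by
  rw [Category.id_comp, (K.mappingCone_isPushout (K.ι W)).w]

/-- The first inclusion into the double suspension. -/
def dInl : K.suspObj W ⟶ K.doubleSusp W :=
  quotMap (K.ι W) (K.cof W) _ (K.cof_toDouble W) (𝟙 W) (K.inCone (K.ι W)) (K.ι_inCone W)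

/-- The second inclusion into the double suspension. -/
def dInr : K.suspObj W ⟶ K.doubleSusp W :=
  quotMap (K.ι W) (K.cof W) _ (K.cof_toDouble W) (𝟙 W) (K.inBase (K.ι W))
    (Category.id_comp _).symm

lemma inCone_pinch : K.inCone (K.ι W) ≫ K.pinch W = quotProj (K.ι W) (K.cof W) ≫ K.dInl W :=
  (quotProj_quotMap _ _ _ _ _ _ _).symm

lemma inBase_pinch : K.inBase (K.ι W) ≫ K.pinch W = quotProj (K.ι W) (K.cof W) ≫ K.dInr W :=
  (quotProj_quotMap _ _ _ _ _ _ _).symm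

lemma double_isPushout : IsPushout (fromZero (K.suspObj W)) (fromZero (K.suspObj W))
    (K.dInl W) (K.dInr W) := by
  refine ⟨⟨fromZero_eq _ _⟩, ⟨PushoutCocone.IsColimit.mk _ (fun s =>
    (quot_isPushout _ (K.cof_toDouble W)).desc
      ((K.mappingCone_isPushout (K.ι W)).desc (quotProj _ _ ≫ s.inl) (quotProj _ _ ≫ s.inr)
        ?_) (fromZero _) ?_) ?_ ?_ ?_⟩⟩
  · rw [reassoc_of% (quot_isPushout (K.ι W) (K.cof W)).w,
      reassoc_of% (quot_isPushout (K.ι W) (K.cof W)).w, fromZero_eq (_ ≫ s.inl) (_ ≫ s.inr)]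
  · rw [Category.assoc, IsPushout.inr_desc, reassoc_of% (quot_isPushout (K.ι W) (K.cof W)).w,
      fromZero_eq (_ ≫ s.inr) (fromZero _)]
  · intro s
    apply quot_hom_ext
    rw [← reassoc_of% (K.inCone_pinch W), IsPushout.inl_desc, IsPushout.inl_desc]
  · intro s
    apply quot_hom_ext
    rw [← reassoc_of% (K.inBase_pinch W), IsPushout.inl_desc, IsPushout.inr_desc]
  · intro s m h₁ h₂
    apply quot_hom_ext
    rw [IsPushout.inl_desc]
    apply (K.mappingCone_isPushout (K.ι W)).hom_ext
    · rw [reassoc_of% (K.inCone_pinch W), h₁, IsPushout.inl_desc]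
    · rw [reassoc_of% (K.inBase_pinch W), h₂, IsPushout.inr_desc]

lemma dInl_δ : (γ C).map (K.dInl W) ≫ K.δ _ (K.cof_toDouble W) = K.δ (K.ι W) (K.cof W) := by
  have h := K.δ_naturality (K.ι W) (K.cof W) _ (K.cof_toDouble W) (𝟙 W) (K.inCone (K.ι W))
    (K.ι_inCone W)
  rwa [CategoryTheory.Functor.map_id, CategoryTheory.Functor.map_id, Category.comp_id] at h

lemma dInr_δ : (γ C).map (K.dInr W) ≫ K.δ _ (K.cof_toDouble W) = K.δ (K.ι W) (K.cof W) := by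
  have h := K.δ_naturality (K.ι W) (K.cof W) _ (K.cof_toDouble W) (𝟙 W) (K.inBase (K.ι W))
    (Category.id_comp _).symm
  rwa [CategoryTheory.Functor.map_id, CategoryTheory.Functor.map_id, Category.comp_id] at h

variable [HasZeroMorphisms (Ho C)]

variable {W}

/-- By exactness `d` factors through the connecting morphism of `W ⟶ CW ∪_W CW`, whose restrictions
to the two summands coincide. -/
lemma eq_of_pinch_comp_eq_zero {B : Ho C} (d : (γ C).obj (K.doubleSusp W) ⟶ B)
    (h : (γ C).map (K.pinch W) ≫ d = 0) :
    (γ C).map (K.dInl W) ≫ d = (γ C).map (K.dInr W) ≫ d := by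
  obtain ⟨c, rfl⟩ := K.yoneda_exact₃ _ (K.cof_toDouble W) d h
  rw [reassoc_of% (K.dInl_δ W), reassoc_of% (K.dInr_δ W)]

/-- Such a `d` factors through the fold map, and pinching followed by folding factors through the
weakly contractible object `CW`. -/
lemma pinch_comp_eq_zero {B : Ho C} (d : (γ C).obj (K.doubleSusp W) ⟶ B)
    (h : (γ C).map (K.dInl W) ≫ d = (γ C).map (K.dInr W) ≫ d) :
    (γ C).map (K.pinch W) ≫ d = 0 := by
  have hM := K.mappingCone_isPushout (K.ι W)
  let F : K.doubleSusp W ⟶ K.suspObj W :=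
    (K.double_isPushout W).desc (𝟙 _) (𝟙 _) (fromZero_eq _ _)
  have e : d = (γ C).map F ≫ (γ C).map (K.dInl W) ≫ d := by
    apply coprod_hom_ext (K.double_isPushout W)
    · rw [← reassoc_of% ((γ C).map_comp (K.dInl W) F), IsPushout.inl_desc,
        CategoryTheory.Functor.map_id, Category.id_comp]
    · rw [← reassoc_of% ((γ C).map_comp (K.dInr W) F), IsPushout.inr_desc,
        CategoryTheory.Functor.map_id, Category.id_comp, h]
  have e' : K.pinch W ≫ F = hM.desc (𝟙 _) (𝟙 _) rfl ≫ quotProj (K.ι W) (K.cof W) := by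
    apply hM.hom_ext
    · rw [reassoc_of% (K.inCone_pinch W), IsPushout.inl_desc, IsPushout.inl_desc_assoc,
        Category.comp_id, Category.id_comp]
    · rw [reassoc_of% (K.inBase_pinch W), IsPushout.inr_desc, IsPushout.inr_desc_assoc,
        Category.comp_id, Category.id_comp]
  rw [e, ← reassoc_of% ((γ C).map_comp (K.pinch W) F), e', Functor.map_comp,
    (isZero_γ (K.contractible W)).eq_zero_of_tgt ((γ C).map (hM.desc (𝟙 _) (𝟙 _) rfl)),
    zero_comp, zero_comp]

end Pinch

end Cones

end CofibrationCategory

/-! ### Preadditive structures from biproducts -/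

section

variable {T : Type u} [Category.{v} T] [HasZeroMorphisms T] [HasBinaryBiproducts T]

open SemiadditiveOfBinaryBiproducts in
attribute [local instance] addCommMonoidHomOfHasBinaryBiproducts in
/-- A category with binary biproducts in which every identity morphism has an additive inverse is
preadditive. -/
abbrev preadditiveOfBinaryBiproducts
    (h : ∀ X : T, ∃ n : X ⟶ X, biprod.lift (𝟙 X) n ≫ biprod.desc (𝟙 X) (𝟙 X) = 0) : Preadditive T where
  homGroup X Y :=
    { addCommMonoidHomOfHasBinaryBiproducts X Y with
      neg := fun f => (h X).choose ≫ f
      zsmul := @zsmulRec _ _ _ ⟨fun f => (h X).choose ≫ f⟩ nsmulRec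
      neg_add_cancel := fun f => by
        have e := (h X).choose_spec
        rw [← add_eq_left_addition] at e
        change (h X).choose ≫ f + f = 0
        rw [add_comm]
        conv_lhs => lhs; rw [← Category.id_comp f]
        rw [← add_comp, e, zero_comp] }
  add_comp _ _ _ f g k := add_comp f g k
  comp_add _ _ _ f g k := comp_add f g k

end

namespace CofibrationCategory

/-! ### Biproducts and negatives from the pinch morphism -/

namespace Cones

variable {C : Type u} [Category.{v} C] [CofibrationCategory C] [HasZeroObject C]
  (K : Cones C) (hK : K.suspension.IsEquivalence) [HasZeroMorphisms (Ho C)]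

include hK in
lemma exists_iso_suspObj (A : Ho C) : ∃ W : C, Nonempty ((γ C).obj (K.suspObj W) ≅ A) := by
  obtain ⟨W, hW⟩ := exists_γ_obj_eq (K.suspension.objPreimage A)
  exact ⟨W, ⟨K.σ W ≪≫ eqToIso (by rw [hW]) ≪≫ K.suspension.objObjPreimageIso A⟩⟩

/-- The first component of `CW/W ⟶ CW/W ⨿ CW/W`, the pinch morphism normalized to have first
component the identity, exists in the homotopy category. -/
lemma exists_copinch (W : C) :
    ∃ (κ : (γ C).obj (K.suspObj W) ⟶ (γ C).obj (K.doubleSusp W))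
      (m : (γ C).obj (K.suspObj W) ≅ (γ C).obj (K.suspObj W)),
      K.δ (K.ι W) (K.cof W) = m.inv ≫ (K.σ W).hom ∧
      κ ≫ (γ C).map ((K.double_isPushout W).desc (𝟙 _) (toZero _ ≫ fromZero _)
        (fromZero_eq _ _)) = 𝟙 _ ∧
      κ ≫ (γ C).map ((K.double_isPushout W).desc (toZero _ ≫ fromZero _) (𝟙 _)
        (fromZero_eq _ _)) = m.hom ∧
      ∀ {B : Ho C} (d : (γ C).obj (K.doubleSusp W) ⟶ B),
        κ ≫ d = 0 ↔ (γ C).map (K.dInl W) ≫ d = (γ C).map (K.dInr W) ≫ d := by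
  have hM := K.mappingCone_isPushout (K.ι W)
  have i₁ := isIso_γ _ (K.collapseBase_ι_weq W)
  have i₂ := isIso_γ _ (K.collapseCone_weq (K.ι W) (K.cof W))
  have h₁ : K.pinch W ≫ (K.double_isPushout W).desc (𝟙 _) (toZero _ ≫ fromZero _)
      (fromZero_eq _ _) = K.collapseBase (K.ι W) := by
    apply hM.hom_ext
    · rw [reassoc_of% (K.inCone_pinch W), IsPushout.inl_desc, Category.comp_id,
        inCone_collapseBase]
    · rw [reassoc_of% (K.inBase_pinch W), IsPushout.inr_desc, comp_zero_eq, inBase_collapseBase]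
  have h₂ : K.pinch W ≫ (K.double_isPushout W).desc (toZero _ ≫ fromZero _) (𝟙 _)
      (fromZero_eq _ _) = K.collapseCone (K.ι W) (K.cof W) := by
    apply hM.hom_ext
    · rw [reassoc_of% (K.inCone_pinch W), IsPushout.inl_desc, comp_zero_eq, inCone_collapseCone]
    · rw [reassoc_of% (K.inBase_pinch W), IsPushout.inr_desc, Category.comp_id,
        inBase_collapseCone]
  -- Both collapses of `CW ∪_W CW` onto `CW/W` become isomorphisms. One normalizes the first
  -- component of the pinch to the identity, and the comparison `m` of the two is the second
  -- component; it will turn out to be `-𝟙`.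
  refine ⟨inv ((γ C).map (K.collapseBase (K.ι W))) ≫ (γ C).map (K.pinch W),
    (asIso ((γ C).map (K.collapseBase (K.ι W)))).symm ≪≫
      asIso ((γ C).map (K.collapseCone (K.ι W) (K.cof W))), ?_, ?_, ?_, fun d => ?_⟩
  · rw [← cancel_epi ((γ C).map (K.collapseCone (K.ι W) (K.cof W))), collapseCone_δ]
    simp
  · rw [Category.assoc, ← Functor.map_comp, h₁, IsIso.inv_hom_id]
  · rw [Category.assoc, ← Functor.map_comp, h₂]
    simp
  · rw [Category.assoc, ← comp_zero (f := inv ((γ C).map (K.collapseBase (K.ι W)))), cancel_epi]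
    exact ⟨K.eq_of_pinch_comp_eq_zero d, K.pinch_comp_eq_zero d⟩

variable {X Y P : C} {l : X ⟶ P} {r : Y ⟶ P} (h : IsPushout (fromZero X) (fromZero Y) l r)

-- The quotient map of `l` factors through the projection to `Y`, so exactness in the middle
-- applies.
include hK in
lemma eq_comp_inl_of_comp_snd_eq_zero {A : Ho C} (z : A ⟶ (γ C).obj P)
    (hz : z ≫ (γ C).map (h.desc (toZero X ≫ fromZero Y) (𝟙 Y) (fromZero_eq _ _)) = 0) :
    ∃ x : A ⟶ (γ C).obj X, z = x ≫ (γ C).map l := by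
  have hl := cof_inl h (cof_fromZero Y)
  refine K.coyoneda_exact₂ hK l hl z ?_
  have e : quotProj l hl = h.desc (toZero X ≫ fromZero Y) (𝟙 Y) (fromZero_eq _ _) ≫ r ≫
      quotProj l hl := by
    apply h.hom_ext
    · rw [h.inl_desc_assoc, Category.assoc, zero_comp_eq, (quot_isPushout l hl).w]
    · rw [h.inr_desc_assoc, Category.id_comp]
  rw [e, Functor.map_comp, reassoc_of% hz, zero_comp]

-- Here coproducts become products. The source may be taken to be `CW/W`, where the normalized pinch
-- `κ` both adds morphisms and detects their equality.
include hK in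
lemma existsUnique_prod_lift {A : Ho C} (a : A ⟶ (γ C).obj X) (b : A ⟶ (γ C).obj Y) :
    ∃! c : A ⟶ (γ C).obj P,
      c ≫ (γ C).map (h.desc (𝟙 X) (toZero Y ≫ fromZero X) (fromZero_eq _ _)) = a ∧
      c ≫ (γ C).map (h.desc (toZero X ≫ fromZero Y) (𝟙 Y) (fromZero_eq _ _)) = b := by
  set ρ := h.desc (𝟙 X) (toZero Y ≫ fromZero X) (fromZero_eq _ _) with hρ
  set π := h.desc (toZero X ≫ fromZero Y) (𝟙 Y) (fromZero_eq _ _) with hπ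
  have lρ : (γ C).map l ≫ (γ C).map ρ = 𝟙 _ := by
    rw [← Functor.map_comp, h.inl_desc, CategoryTheory.Functor.map_id]
  have rρ : (γ C).map r ≫ (γ C).map ρ = 0 := by
    rw [← Functor.map_comp, h.inr_desc, γ_map_toZero_fromZero]
  have lπ : (γ C).map l ≫ (γ C).map π = 0 := by
    rw [← Functor.map_comp, h.inl_desc, γ_map_toZero_fromZero]
  have rπ : (γ C).map r ≫ (γ C).map π = 𝟙 _ := by
    rw [← Functor.map_comp, h.inr_desc, CategoryTheory.Functor.map_id]
  obtain ⟨W, ⟨e⟩⟩ := K.exists_iso_suspObj hK A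
  obtain ⟨κ, m, -, h₁, h₂, h₀⟩ := K.exists_copinch W
  have hD := K.double_isPushout W
  refine existsUnique_of_exists_of_unique ?_ ?_
  -- The factor `m.inv` cancels the second component of `κ`.
  · obtain ⟨d, dl, dr⟩ := exists_coprod_desc hD (e.hom ≫ a ≫ (γ C).map l)
      (m.inv ≫ e.hom ≫ b ≫ (γ C).map r)
    have e₁ : d ≫ (γ C).map ρ = (γ C).map (hD.desc (𝟙 _) (toZero _ ≫ fromZero _)
        (fromZero_eq _ _)) ≫ e.hom ≫ a := by
      apply coprod_hom_ext hD
      · rw [reassoc_of% dl, lρ, ← Category.assoc ((γ C).map (K.dInl W)), ← Functor.map_comp,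
          hD.inl_desc, CategoryTheory.Functor.map_id, Category.id_comp, Category.comp_id]
      · rw [reassoc_of% dr, rρ, ← Category.assoc ((γ C).map (K.dInr W)), ← Functor.map_comp,
          hD.inr_desc, γ_map_toZero_fromZero]
        simp only [comp_zero, zero_comp]
    have e₂ : d ≫ (γ C).map π = (γ C).map (hD.desc (toZero _ ≫ fromZero _) (𝟙 _)
        (fromZero_eq _ _)) ≫ m.inv ≫ e.hom ≫ b := by
      apply coprod_hom_ext hD
      · rw [reassoc_of% dl, lπ, ← Category.assoc ((γ C).map (K.dInl W)), ← Functor.map_comp,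
          hD.inl_desc, γ_map_toZero_fromZero]
        simp only [comp_zero, zero_comp]
      · rw [reassoc_of% dr, rπ, ← Category.assoc ((γ C).map (K.dInr W)), ← Functor.map_comp,
          hD.inr_desc, CategoryTheory.Functor.map_id, Category.id_comp, Category.comp_id]
    refine ⟨e.inv ≫ κ ≫ d, ?_, ?_⟩
    · rw [Category.assoc, Category.assoc, e₁, reassoc_of% h₁, Iso.inv_hom_id_assoc]
    · rw [Category.assoc, Category.assoc, e₂, reassoc_of% h₂, Iso.hom_inv_id_assoc,
        Iso.inv_hom_id_assoc]
  · rintro c c' ⟨rfl, rfl⟩ ⟨hc, hc'⟩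
    -- `κ ≫ [c, c']` plays the role of `c - c'`: both projections kill it, so it vanishes, and this
    -- forces `c = c'`.
    obtain ⟨d, dl, dr⟩ := exists_coprod_desc hD (e.hom ≫ c) (e.hom ≫ c')
    have z₁ : (κ ≫ d) ≫ (γ C).map ρ = 0 := by
      rw [Category.assoc, h₀, reassoc_of% dl, reassoc_of% dr, hc]
    have z₂ : (κ ≫ d) ≫ (γ C).map π = 0 := by
      rw [Category.assoc, h₀, reassoc_of% dl, reassoc_of% dr, hc']
    obtain ⟨x, hx⟩ := K.eq_comp_inl_of_comp_snd_eq_zero hK h _ z₂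
    have hx0 : x = 0 := by rwa [hx, Category.assoc, lρ, Category.comp_id] at z₁
    rw [hx0, zero_comp, h₀, dl, dr, cancel_epi] at hx
    exact hx

include hK in
lemma hasBinaryBiproducts : HasBinaryBiproducts (Ho C) := by
  refine ⟨fun A B => ?_⟩
  obtain ⟨X, rfl⟩ := exists_γ_obj_eq A
  obtain ⟨Y, rfl⟩ := exists_γ_obj_eq B
  obtain ⟨P, l, r, h⟩ := exists_pushout (cof_fromZero X) (fromZero Y)
  let c : BinaryBicone ((γ C).obj X) ((γ C).obj Y) :=
    { pt := (γ C).obj P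
      fst := (γ C).map (h.desc (𝟙 X) (toZero Y ≫ fromZero X) (fromZero_eq _ _))
      snd := (γ C).map (h.desc (toZero X ≫ fromZero Y) (𝟙 Y) (fromZero_eq _ _))
      inl := (γ C).map l
      inr := (γ C).map r
      inl_fst := by rw [← Functor.map_comp, h.inl_desc, CategoryTheory.Functor.map_id]
      inl_snd := by rw [← Functor.map_comp, h.inl_desc, γ_map_toZero_fromZero]
      inr_fst := by rw [← Functor.map_comp, h.inr_desc, γ_map_toZero_fromZero]
      inr_snd := by rw [← Functor.map_comp, h.inr_desc, CategoryTheory.Functor.map_id] }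
  refine HasBinaryBiproduct.mk ⟨c, ⟨BinaryFan.IsLimit.mk _
    (fun a b => (K.existsUnique_prod_lift hK h a b).choose)
    (fun a b => (K.existsUnique_prod_lift hK h a b).choose_spec.1.1)
    (fun a b => (K.existsUnique_prod_lift hK h a b).choose_spec.1.2)
    (fun a b m h₁ h₂ => (K.existsUnique_prod_lift hK h a b).choose_spec.2 _ ⟨h₁, h₂⟩),
    BinaryCofan.IsColimit.mk _ (fun a b => (exists_coprod_desc h a b).choose)
    (fun a b => (exists_coprod_desc h a b).choose_spec.1)
    (fun a b => (exists_coprod_desc h a b).choose_spec.2)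
    (fun a b m h₁ h₂ => coprod_hom_ext h
      (h₁.trans (exists_coprod_desc h a b).choose_spec.1.symm)
      (h₂.trans (exists_coprod_desc h a b).choose_spec.2.symm))⟩⟩

-- The negative is `m` transported to `A`: `κ` represents the pair `(𝟙, m)`, and the codiagonal
-- kills it because it agrees on both summands.
include hK in
lemma exists_neg_id [HasBinaryBiproducts (Ho C)] (A : Ho C) :
    ∃ n : A ⟶ A, biprod.lift (𝟙 A) n ≫ biprod.desc (𝟙 A) (𝟙 A) = 0 := by
  obtain ⟨W, ⟨e⟩⟩ := K.exists_iso_suspObj hK A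
  obtain ⟨κ, m, -, h₁, h₂, h₀⟩ := K.exists_copinch W
  have hD := K.double_isPushout W
  obtain ⟨d, dl, dr⟩ := exists_coprod_desc hD (e.hom ≫ biprod.inl) (e.hom ≫ biprod.inr)
  have e₁ : d ≫ biprod.fst = (γ C).map (hD.desc (𝟙 _) (toZero _ ≫ fromZero _)
      (fromZero_eq _ _)) ≫ e.hom := by
    apply coprod_hom_ext hD
    · rw [reassoc_of% dl, biprod.inl_fst, ← Category.assoc ((γ C).map (K.dInl W)),
        ← Functor.map_comp, hD.inl_desc, CategoryTheory.Functor.map_id, Category.id_comp,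
        Category.comp_id]
    · rw [reassoc_of% dr, biprod.inr_fst, ← Category.assoc ((γ C).map (K.dInr W)),
        ← Functor.map_comp, hD.inr_desc, γ_map_toZero_fromZero, zero_comp, comp_zero]
  have e₂ : d ≫ biprod.snd = (γ C).map (hD.desc (toZero _ ≫ fromZero _) (𝟙 _)
      (fromZero_eq _ _)) ≫ e.hom := by
    apply coprod_hom_ext hD
    · rw [reassoc_of% dl, biprod.inl_snd, ← Category.assoc ((γ C).map (K.dInl W)),
        ← Functor.map_comp, hD.inl_desc, γ_map_toZero_fromZero, zero_comp, comp_zero]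
    · rw [reassoc_of% dr, biprod.inr_snd, ← Category.assoc ((γ C).map (K.dInr W)),
        ← Functor.map_comp, hD.inr_desc, CategoryTheory.Functor.map_id, Category.id_comp,
        Category.comp_id]
  refine ⟨e.inv ≫ m.hom ≫ e.hom, ?_⟩
  have e₃ : biprod.lift (𝟙 A) (e.inv ≫ m.hom ≫ e.hom) = e.inv ≫ κ ≫ d := by
    apply biprod.hom_ext
    · rw [biprod.lift_fst, Category.assoc, Category.assoc, e₁, reassoc_of% h₁, Iso.inv_hom_id]
    · rw [biprod.lift_snd, Category.assoc, Category.assoc, e₂, reassoc_of% h₂]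
  have e₄ : κ ≫ d ≫ biprod.desc (𝟙 A) (𝟙 A) = 0 := by
    rw [h₀, reassoc_of% dl, reassoc_of% dr, biprod.inl_desc, biprod.inr_desc]
  rw [e₃, Category.assoc, Category.assoc, e₄, comp_zero]

omit [HasZeroMorphisms (Ho C)] in
/-- The connecting morphism of the cone inclusion is minus the identity. -/
lemma δ_ι_eq_neg [Preadditive (Ho C)] (W : C) : K.δ (K.ι W) (K.cof W) = -(K.σ W).hom := by
  obtain ⟨κ, m, hm, h₁, h₂, h₀⟩ := K.exists_copinch W
  have hD := K.double_isPushout W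
  set t₁ := (γ C).map (hD.desc (𝟙 _) (toZero _ ≫ fromZero _) (fromZero_eq _ _))
  set t₂ := (γ C).map (hD.desc (toZero _ ≫ fromZero _) (𝟙 _) (fromZero_eq _ _))
  -- `t₁ + t₂` is the fold map, equal on both summands, so `κ` kills it. Reading off the components
  -- of `κ` gives `𝟙 + m = 0`.
  have e : κ ≫ (t₁ + t₂) = 0 := by
    rw [h₀, Preadditive.comp_add, Preadditive.comp_add, ← Functor.map_comp, ← Functor.map_comp,
      ← Functor.map_comp, ← Functor.map_comp, hD.inl_desc, hD.inl_desc, hD.inr_desc, hD.inr_desc,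
      add_comm]
  rw [Preadditive.comp_add, h₁, h₂] at e
  have hm' : m.hom = -𝟙 _ := by rw [eq_neg_iff_add_eq_zero, add_comm, e]
  have hm'' : m.inv = -𝟙 _ := by
    rw [← cancel_epi m.hom, m.hom_inv_id, hm', Preadditive.neg_comp, Preadditive.comp_neg,
      Category.id_comp, neg_neg]
  rw [hm, hm'', Preadditive.neg_comp, Category.id_comp]

end Cones

end CofibrationCategory

/-! ### The shift by the integers attached to an autoequivalence -/

/-- A spectrum for an endofunctor `S`: a sequence of objects `X n` indexed by the integers with
isomorphisms `S (X n) ≅ X (n + 1)`. -/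
structure EndoSpectrum {T : Type u} [Category.{v} T] (S : T ⥤ T) where
  /-- the objects -/
  obj : ℤ → T
  /-- the structure isomorphisms -/
  iso : ∀ n m : ℤ, n + 1 = m → (S.obj (obj n) ≅ obj m)

namespace EndoSpectrum

variable {T : Type u} [Category.{v} T] {S : T ⥤ T}

/-- Morphisms of spectra. -/
@[ext]
structure Hom (X Y : EndoSpectrum S) where
  /-- the components -/
  f : ∀ n : ℤ, X.obj n ⟶ Y.obj n
  comm : ∀ (n m : ℤ) (h : n + 1 = m),
    S.map (f n) ≫ (Y.iso n m h).hom = (X.iso n m h).hom ≫ f m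

instance : Category (EndoSpectrum S) where
  Hom := Hom
  id X := ⟨fun n => 𝟙 _, fun n m h => by simp⟩
  comp f g := ⟨fun n => f.f n ≫ g.f n, fun n m h => by
    rw [S.map_comp, Category.assoc, g.comm, ← Category.assoc, f.comm, Category.assoc]⟩

lemma hom_ext {X Y : EndoSpectrum S} {f g : X ⟶ Y} (h : ∀ n, f.f n = g.f n) : f = g :=
  Hom.ext (funext h)

/-- The spectrum with terms `X (n + k)`. -/
def shiftFunctor (S : T ⥤ T) (k : ℤ) : EndoSpectrum S ⥤ EndoSpectrum S where
  obj X := ⟨fun n => X.obj (n + k), fun n m h => X.iso (n + k) (m + k) (by omega)⟩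
  map f := ⟨fun n => f.f (n + k), fun n m h => f.comm _ _ _⟩

/-- The transport between the terms of a spectrum along an equality of indices. -/
def cast (X : EndoSpectrum S) {a b : ℤ} (e : a = b) : X.obj a ⟶ X.obj b :=
  eqToHom (congrArg X.obj e)

lemma cast_trans (X : EndoSpectrum S) {a b c : ℤ} (e : a = b) (e' : b = c) :
    X.cast e ≫ X.cast e' = X.cast (e.trans e') := by
  subst e e'
  exact Category.id_comp _

lemma cast_naturality {X Y : EndoSpectrum S} (f : X ⟶ Y) {a b : ℤ} (e : a = b) :
    f.f a ≫ Y.cast e = X.cast e ≫ f.f b := by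
  subst e
  exact (Category.comp_id _).trans (Category.id_comp _).symm

lemma map_cast_iso (X : EndoSpectrum S) {n m n' m' : ℤ} (h : n + 1 = m) (h' : n' + 1 = m')
    (e : n = n') (e' : m = m') :
    S.map (X.cast e) ≫ (X.iso n' m' h').hom = (X.iso n m h).hom ≫ X.cast e' := by
  subst e h h'
  simp [cast]

/-- The shift by `0` is the identity. -/
def shiftZero (S : T ⥤ T) : shiftFunctor S 0 ≅ 𝟭 (EndoSpectrum S) :=
  NatIso.ofComponents (fun X =>
    { hom := ⟨fun n => X.cast (by omega), fun n m h => X.map_cast_iso _ _ _ _⟩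
      inv := ⟨fun n => X.cast (by omega), fun n m h => X.map_cast_iso _ _ _ _⟩
      hom_inv_id := hom_ext fun n => X.cast_trans (by omega) (by omega)
      inv_hom_id := hom_ext fun n => X.cast_trans (by omega) (by omega) })
    (fun f => hom_ext fun n => cast_naturality f (by omega))

/-- The compatibility of the shifts with addition. -/
def shiftAdd (S : T ⥤ T) (k l : ℤ) :
    shiftFunctor S (k + l) ≅ shiftFunctor S k ⋙ shiftFunctor S l :=
  NatIso.ofComponents (fun X =>
    { hom := ⟨fun n => X.cast (by omega), fun n m h => X.map_cast_iso _ _ _ _⟩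
      inv := ⟨fun n => X.cast (by omega), fun n m h => X.map_cast_iso _ _ _ _⟩
      hom_inv_id := hom_ext fun n => X.cast_trans (by omega) (by omega)
      inv_hom_id := hom_ext fun n => X.cast_trans (by omega) (by omega) })
    (fun f => hom_ext fun n => cast_naturality f (by omega))

lemma eqToHom_shiftFunctor_f (X : EndoSpectrum S) {k l : ℤ} (e : k = l)
    (h : (shiftFunctor S k).obj X = (shiftFunctor S l).obj X) (n : ℤ) :
    (eqToHom h).f n = X.cast (congrArg (n + ·) e) := by
  subst e
  rfl

/-- On spectra the shift only reindexes, so every coherence isomorphism is a transport along an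
equality of integers and all coherence laws reduce to `cast_trans`. -/
instance : HasShift (EndoSpectrum S) ℤ := hasShiftMk _ _
  { F := shiftFunctor S
    zero := shiftZero S
    add := shiftAdd S
    assoc_hom_app := fun a b c X => hom_ext fun n => by
      have e := X.eqToHom_shiftFunctor_f (add_assoc a b c) (by rw [add_assoc]) n
      refine (X.cast_trans (by omega) (by omega)).trans (Eq.trans ?_
        (congrArg (· ≫ X.cast (b := n + (b + c) + a) (by omega) ≫
          X.cast (b := n + c + b + a) (by omega)) e.symm))
      refine ((congrArg (_ ≫ ·) (X.cast_trans (by omega) (by omega))).trans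
        (X.cast_trans (by omega) (by omega))).symm
    zero_add_hom_app := fun a X => hom_ext fun n => by
      have e := X.eqToHom_shiftFunctor_f (zero_add a) (by rw [zero_add]) n
      refine (X.cast_trans (by omega) (by omega)).symm.trans
        (congrArg (· ≫ X.cast (b := n + a + 0) (by omega)) e.symm)
    add_zero_hom_app := fun a X => hom_ext fun n => by
      have e := X.eqToHom_shiftFunctor_f (add_zero a) (by rw [add_zero]) n
      refine (X.cast_trans (by omega) (by omega)).symm.trans
        (congrArg (· ≫ X.cast (b := n + 0 + a) (by omega)) e.symm) }

section Evaluation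

/-- The functor sending a spectrum to its term of index `0`. -/
def eval (S : T ⥤ T) : EndoSpectrum S ⥤ T where
  obj X := X.obj 0
  map f := f.f 0

/-- Evaluation at `0` of the shift by `1` is the endofunctor. -/
def evalShiftOne (S : T ⥤ T) : shiftFunctor S 1 ⋙ eval S ≅ eval S ⋙ S :=
  NatIso.ofComponents (fun X => (X.iso 0 (0 + 1) rfl).symm) (fun {X Y} f => by
    have := f.comm 0 (0 + 1) rfl
    change f.f (0 + 1) ≫ (Y.iso 0 (0 + 1) rfl).inv = (X.iso 0 (0 + 1) rfl).inv ≫ S.map (f.f 0)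
    rw [Iso.comp_inv_eq, Category.assoc, this, Iso.inv_hom_id_assoc])

variable [S.IsEquivalence] {X Y : EndoSpectrum S}

/-- The extension of a morphism in degree `0` to nonnegative degrees. -/
def extendNat (f : X.obj 0 ⟶ Y.obj 0) : ∀ n : ℕ, X.obj n ⟶ Y.obj n
  | 0 => f
  | n + 1 => (X.iso n (n + 1 : ℕ) (by simp)).inv ≫ S.map (extendNat f n) ≫
      (Y.iso n (n + 1 : ℕ) (by simp)).hom

/-- The extension of a morphism in degree `0` to nonpositive degrees. -/
def extendNeg (f : X.obj 0 ⟶ Y.obj 0) : ∀ n : ℕ, X.obj (-n) ⟶ Y.obj (-n)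
  | 0 => f
  | n + 1 => S.preimage ((X.iso (-(n + 1 : ℕ)) (-n) (by simp)).hom ≫ extendNeg f n ≫
      (Y.iso (-(n + 1 : ℕ)) (-n) (by simp)).inv)

/-- The extension of a morphism in degree `0` to all degrees. -/
def extend (f : X.obj 0 ⟶ Y.obj 0) : ∀ n : ℤ, X.obj n ⟶ Y.obj n
  | Int.ofNat n => extendNat f n
  | Int.negSucc n => extendNeg f (n + 1)

lemma extend_neg (f : X.obj 0 ⟶ Y.obj 0) (n : ℕ) : extend f (-n) = extendNeg f n := by
  cases n <;> rfl

lemma extend_comm (f : X.obj 0 ⟶ Y.obj 0) (n m : ℤ) (h : n + 1 = m) :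
    S.map (extend f n) ≫ (Y.iso n m h).hom = (X.iso n m h).hom ≫ extend f m := by
  obtain ⟨k, rfl | rfl⟩ : ∃ k : ℕ, n = k ∨ n = -(k + 1 : ℕ) := by
    rcases n with k | k
    · exact ⟨k, Or.inl rfl⟩
    · exact ⟨k, Or.inr rfl⟩
  · obtain rfl : m = (k + 1 : ℕ) := by simp [← h]
    change S.map (extendNat f k) ≫ _ = _ ≫ extendNat f (k + 1)
    rw [extendNat, Iso.hom_inv_id_assoc]
  · obtain rfl : m = -k := by rw [← h]; simp
    rw [extend_neg, extend_neg, extendNeg, Functor.map_preimage]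
    simp

instance : (eval S).Full where
  map_surjective f := ⟨⟨extend f, extend_comm f⟩, rfl⟩

/-- The structure isomorphisms determine degree `n + 1` from degree `n`; faithfulness of `S`
determines degree `n - 1`. -/
lemma f_unique {f g : X ⟶ Y} (h : f.f 0 = g.f 0) (n : ℤ) : f.f n = g.f n := by
  induction n using Int.induction_on with
  | zero => exact h
  | succ n ih =>
    rw [← cancel_epi (X.iso n (n + 1) rfl).hom, ← f.comm, ← g.comm, ih]
  | pred n ih =>
    apply S.map_injective
    rw [← cancel_mono (Y.iso (-n - 1) (-n) (by omega)).hom, f.comm, g.comm, ih]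

instance : (eval S).Faithful where
  map_injective h := hom_ext (f_unique h)

/-- The terms of a spectrum with a given term of index `0`. -/
def freeObj (S : T ⥤ T) [S.IsEquivalence] (A : T) : ℤ → T
  | Int.ofNat n => (S.obj)^[n] A
  | Int.negSucc n => (S.inv.obj)^[n + 1] A

/-- The structure isomorphisms of a spectrum with a given term of index `0`. -/
def freeIso (S : T ⥤ T) [S.IsEquivalence] (A : T) :
    ∀ n : ℤ, S.obj (freeObj S A n) ≅ freeObj S A (n + 1)
  | Int.ofNat n => eqToIso (Function.iterate_succ_apply' S.obj n A).symm
  | Int.negSucc 0 => S.asEquivalence.counitIso.app A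
  | Int.negSucc (n + 1) =>
      S.mapIso (eqToIso (Function.iterate_succ_apply' S.inv.obj (n + 1) A)) ≪≫
        S.asEquivalence.counitIso.app _

instance : (eval S).EssSurj where
  mem_essImage A := ⟨⟨freeObj S A, fun n _ h => freeIso S A n ≪≫
    eqToIso (congrArg (freeObj S A) h)⟩, ⟨Iso.refl A⟩⟩

instance : (eval S).IsEquivalence where

end Evaluation

end EndoSpectrum

/-- An autoequivalence is the shift by `1` of a shift by the integers. -/
theorem exists_hasShift_of_isEquivalence {T : Type u} [Category.{v} T] (S : T ⥤ T)
    [S.IsEquivalence] :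
    ∃ _ : HasShift T ℤ, (∀ n : ℤ, (shiftFunctor T n).IsEquivalence) ∧
      Nonempty (shiftFunctor T (1 : ℤ) ≅ S) := by
  let F := EndoSpectrum.eval S
  let s : ℤ → T ⥤ T := fun n => F.inv ⋙ shiftFunctor (EndoSpectrum S) n ⋙ F
  let i : ∀ n, s n ⋙ F.inv ≅ F.inv ⋙ shiftFunctor (EndoSpectrum S) n := fun n =>
    Functor.associator _ _ _ ≪≫ Functor.isoWhiskerLeft _ (Functor.associator _ _ _ ≪≫
      Functor.isoWhiskerLeft _ F.asEquivalence.unitIso.symm ≪≫ Functor.rightUnitor _)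
  -- Transport the shift of spectra along the equivalence given by evaluation at `0`; there the
  -- shift by `1` is `S`, through the structure isomorphism in degree `0`.
  let h : HasShift T ℤ := (Functor.FullyFaithful.ofFullyFaithful F.inv).hasShift s i
  refine ⟨h, fun n => inferInstance, ⟨?_⟩⟩
  change s 1 ≅ S
  exact Functor.isoWhiskerLeft F.inv (EndoSpectrum.evalShiftOne S) ≪≫
    (Functor.associator _ _ _).symm ≪≫
    Functor.isoWhiskerRight F.asEquivalence.counitIso S ≪≫ Functor.leftUnitor _

/-! ### Pretriangulated structures from forward rotations -/

section ForwardRotation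

variable {T : Type u} [Category.{v} T] [Preadditive T] [HasZeroObject T] [HasShift T ℤ]
  [∀ n : ℤ, (shiftFunctor T n).Additive]

variable (T) in
/-- The axioms of a pretriangulated category in which rotation is only required to preserve
distinguished triangles. -/
structure ForwardPretriangulated where
  /-- the distinguished triangles -/
  D : Set (Triangle T)
  of_iso : ∀ T₁ ∈ D, ∀ (T₂) (_ : T₂ ≅ T₁), T₂ ∈ D
  contractible : ∀ X : T, contractibleTriangle X ∈ D
  cocone : ∀ {X Y : T} (f : X ⟶ Y),
    ∃ (Z : T) (g : Y ⟶ Z) (h : Z ⟶ X⟦(1 : ℤ)⟧), Triangle.mk f g h ∈ D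
  rotate : ∀ T₁ ∈ D, T₁.rotate ∈ D
  complete : ∀ (T₁ T₂ : Triangle T) (_ : T₁ ∈ D) (_ : T₂ ∈ D)
      (a : T₁.obj₁ ⟶ T₂.obj₁) (b : T₁.obj₂ ⟶ T₂.obj₂) (_ : T₁.mor₁ ≫ b = a ≫ T₂.mor₁),
      ∃ c : T₁.obj₃ ⟶ T₂.obj₃, T₁.mor₂ ≫ c = b ≫ T₂.mor₂ ∧ T₁.mor₃ ≫ a⟦1⟧' = c ≫ T₂.mor₃

namespace ForwardPretriangulated

variable (P : ForwardPretriangulated T)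

section

variable {X Y Z X' Y' Z' : T} {f : X ⟶ Y} {g : Y ⟶ Z} {h : Z ⟶ X⟦(1 : ℤ)⟧}
  {f' : X' ⟶ Y'} {g' : Y' ⟶ Z'} {h' : Z' ⟶ X'⟦(1 : ℤ)⟧}

lemma exists_hom (hA : Triangle.mk f g h ∈ P.D) (hB : Triangle.mk f' g' h' ∈ P.D)
    (a : X ⟶ X') (b : Y ⟶ Y') (w : f ≫ b = a ≫ f') :
    ∃ c : Z ⟶ Z', g ≫ c = b ≫ g' ∧ h ≫ a⟦(1 : ℤ)⟧' = c ≫ h' :=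
  P.complete _ _ hA hB a b w

lemma rotate_mk (hA : Triangle.mk f g h ∈ P.D) : Triangle.mk g h (-f⟦(1 : ℤ)⟧') ∈ P.D :=
  P.rotate _ hA

/-- Compare with the contractible triangle on `V⟦-1⟧` rotated twice, which starts at `0` and has
minus an identity as second morphism. -/
lemma exists_desc (hA : Triangle.mk f g h ∈ P.D) {V : T} (b : Y ⟶ V)
    (w : f ≫ b = 0) : ∃ c : Z ⟶ V, g ≫ c = b := by
  let e : V⟦(-1 : ℤ)⟧⟦(1 : ℤ)⟧ ≅ V := (shiftEquiv T (1 : ℤ)).counitIso.app V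
  obtain ⟨c, hc, -⟩ := P.exists_hom hA
    (P.rotate_mk (P.rotate_mk (P.contractible (V⟦(-1 : ℤ)⟧))))
    0 (b ≫ e.inv) (by rw [reassoc_of% w, zero_comp, zero_comp])
  -- The sign compensates for the `-𝟙` in the rotated contractible triangle.
  refine ⟨-(c ≫ e.hom), ?_⟩
  rw [CategoryTheory.Functor.map_id, Preadditive.comp_neg, Category.comp_id] at hc
  rw [Preadditive.comp_neg, reassoc_of% hc, Preadditive.neg_comp, neg_neg, Category.assoc,
    e.inv_hom_id, Category.comp_id]

/-- `c - 𝟙` is killed by `g`, so it equals `h ≫ y` for some `y`. Since it is also killed by `h` it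
has square zero, and `𝟙 - h ≫ y` is the inverse. This avoids a five lemma, which would need
exactness for morphisms into the triangle. -/
lemma isIso_of_endo (hA : Triangle.mk f g h ∈ P.D) (c : Z ⟶ Z)
    (h₂ : g ≫ c = g) (h₃ : c ≫ h = h) : IsIso c := by
  obtain ⟨y, hy⟩ := P.exists_desc (P.rotate_mk hA) (c - 𝟙 _)
    (by rw [Preadditive.comp_sub, h₂, Category.comp_id, sub_self])
  have hc : c = 𝟙 _ + h ≫ y := by rw [hy]; abel
  have h0 : (h ≫ y) ≫ h = 0 := by
    rw [hy, Preadditive.sub_comp, h₃, Category.id_comp, sub_self]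
  have h1 : (h ≫ y) ≫ h ≫ y = 0 := by rw [← Category.assoc, h0, zero_comp]
  refine ⟨𝟙 _ - h ≫ y, ?_, ?_⟩
  · rw [hc, Preadditive.add_comp, Preadditive.comp_sub, Preadditive.comp_sub, h1]
    simp
  · rw [hc, Preadditive.sub_comp, Preadditive.comp_add, Preadditive.comp_add, h1]
    simp

lemma isIso_of_id {g' : Y ⟶ Z'} {h' : Z' ⟶ X⟦(1 : ℤ)⟧} (hA : Triangle.mk f g h ∈ P.D)
    (hB : Triangle.mk f g' h' ∈ P.D) (c : Z ⟶ Z') (h₂ : g ≫ c = g') (h₃ : h = c ≫ h') :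
    IsIso c := by
  obtain ⟨r, hr, hr'⟩ := P.exists_hom hB hA (𝟙 _) (𝟙 _)
    ((Category.comp_id _).trans (Category.id_comp _).symm)
  rw [Category.id_comp] at hr
  rw [CategoryTheory.Functor.map_id, Category.comp_id] at hr'
  have i1 : IsIso (c ≫ r) := P.isIso_of_endo hA (c ≫ r) (by rw [reassoc_of% h₂, hr])
    (by rw [Category.assoc, ← hr', h₃])
  have i2 : IsIso (r ≫ c) := P.isIso_of_endo hB (r ≫ c) (by rw [reassoc_of% hr, h₂])
    (by rw [Category.assoc, ← h₃, ← hr'])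
  have e := IsIso.hom_inv_id (c ≫ r)
  rw [Category.assoc] at e
  refine ⟨r ≫ inv (c ≫ r), e, ?_⟩
  rw [← cancel_epi (r ≫ c), Category.comp_id]
  simp only [Category.assoc]
  rw [reassoc_of% e]

/-- Complete `f` to a distinguished triangle. Two further rotations of the given triangle and three
of the chosen one begin with the same morphism `-f⟦1⟧'`, hence have isomorphic third objects. Full
faithfulness of the shift brings this isomorphism back. -/
lemma mem_of_rotate_mem (hA : Triangle.mk g h (-f⟦(1 : ℤ)⟧') ∈ P.D) :
    Triangle.mk f g h ∈ P.D := by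
  obtain ⟨Z', g', h', hB⟩ := P.cocone f
  have hA3 := P.rotate_mk (P.rotate_mk hA)
  have hB3 := P.rotate_mk (P.rotate_mk (P.rotate_mk hB))
  obtain ⟨c, hc, hc'⟩ := P.exists_hom hA3 hB3 (𝟙 _) (𝟙 _)
    ((Category.comp_id _).trans (Category.id_comp _).symm)
  rw [Category.id_comp] at hc
  rw [CategoryTheory.Functor.map_id, Category.comp_id] at hc'
  have hi : IsIso c := P.isIso_of_id hA3 hB3 c hc hc'
  rw [Preadditive.neg_comp, neg_inj] at hc
  rw [Preadditive.comp_neg, neg_inj] at hc'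
  obtain ⟨d, rfl⟩ := (shiftFunctor T (1 : ℤ)).map_surjective c
  have : IsIso d := isIso_of_reflects_iso d (shiftFunctor T (1 : ℤ))
  let e : Z ≅ Z' := asIso d
  refine P.of_iso _ hB _ (Triangle.isoMk _ _ (Iso.refl _) (Iso.refl _) e ?_ ?_ ?_)
  · exact (Category.comp_id _).trans (Category.id_comp _).symm
  · refine Eq.trans ?_ (Category.id_comp _).symm
    apply (shiftFunctor T (1 : ℤ)).map_injective
    exact ((shiftFunctor T (1 : ℤ)).map_comp _ _).trans hc
  · change h ≫ (𝟙 X)⟦(1 : ℤ)⟧' = d ≫ h'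
    rw [CategoryTheory.Functor.map_id, Category.comp_id]
    apply (shiftFunctor T (1 : ℤ)).map_injective
    rw [Functor.map_comp, hc']

end

/-- The resulting pretriangulated structure. -/
abbrev pretriangulated : Pretriangulated T where
  distinguishedTriangles := P.D
  isomorphic_distinguished := P.of_iso
  contractible_distinguished := P.contractible
  distinguished_cocone_triangle := P.cocone
  rotate_distinguished_triangle A := ⟨P.rotate A, P.mem_of_rotate_mem⟩
  complete_distinguished_triangle_morphism := P.complete

end ForwardPretriangulated

end ForwardRotation

namespace CofibrationCategory

variable {C : Type u} [Category.{v} C] [CofibrationCategory C] [HasZeroObject C]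

/-- Up to isomorphism of its target, a morphism of the homotopy category comes from a
cofibration. -/
lemma exists_cof_replacement {X Y : C} (φ : (γ C).obj X ⟶ (γ C).obj Y) :
    ∃ (Y' : C) (i : X ⟶ Y') (_ : cofibrations C i) (e : (γ C).obj Y ≅ (γ C).obj Y'),
      φ ≫ e.hom = (γ C).map i := by
  obtain ⟨Z, f, s, -, hs, h⟩ := exists_fraction φ
  obtain ⟨Y', i, p, hi, hp, rfl⟩ := exists_factorization f
  have := isIso_γ s hs
  have := isIso_γ p hp
  refine ⟨Y', i, hi, asIso ((γ C).map s) ≪≫ (asIso ((γ C).map p)).symm, ?_⟩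
  rw [Iso.trans_hom, asIso_hom, Iso.symm_hom, asIso_inv, reassoc_of% h, Functor.map_comp,
    Category.assoc, IsIso.hom_inv_id, Category.comp_id]

/-! ### The triangles isomorphic to elementary ones form a pretriangulation -/

namespace Cones

variable (K : Cones C) {X Y X' Y' : C} [Preadditive (Ho C)] [HasShift (Ho C) ℤ]
  (e : shiftFunctor (Ho C) (1 : ℤ) ≅ K.suspension)

/-- The elementary exact triangle of a cofibration. -/
abbrev elemTriangle (f : X ⟶ Y) (hf : cofibrations C f) : Triangle (Ho C) :=
  Triangle.mk ((γ C).map f) ((γ C).map (quotProj f hf)) (K.δ f hf ≫ e.inv.app ((γ C).obj X))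

/-- The triangles isomorphic to an elementary exact triangle. -/
def exactTriangles : Set (Triangle (Ho C)) :=
  {T | ∃ (X Y : C) (f : X ⟶ Y) (hf : cofibrations C f), Nonempty (T ≅ K.elemTriangle e f hf)}

lemma elemTriangle_mem (f : X ⟶ Y) (hf : cofibrations C f) :
    K.elemTriangle e f hf ∈ K.exactTriangles e := ⟨X, Y, f, hf, ⟨Iso.refl _⟩⟩

lemma exactTriangles_of_iso (T₁ : Triangle (Ho C)) (h : T₁ ∈ K.exactTriangles e)
    (T₂ : Triangle (Ho C)) (i : T₂ ≅ T₁) : T₂ ∈ K.exactTriangles e := by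
  obtain ⟨X, Y, f, hf, ⟨j⟩⟩ := h
  exact ⟨X, Y, f, hf, ⟨i ≪≫ j⟩⟩

lemma contractible_mem [HasZeroObject (Ho C)] (A : Ho C) :
    contractibleTriangle A ∈ K.exactTriangles e := by
  obtain ⟨X, rfl⟩ := exists_γ_obj_eq A
  have hc := cof_of_isIso (𝟙 X)
  have hz : IsZero ((γ C).obj (quot (𝟙 X) hc)) := by
    have : IsIso (fromZero (quot (𝟙 X) hc)) := (quot_isPushout (𝟙 X) hc).isIso_inr_of_isIso
    exact (isZero_γ_zero C).of_iso ((γ C).mapIso (asIso (fromZero (quot (𝟙 X) hc)))).symm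
  refine ⟨X, X, 𝟙 X, hc, ⟨Triangle.isoMk _ _ (Iso.refl _) (Iso.refl _)
    ((isZero_zero _).iso hz) ?_ ?_ ?_⟩⟩
  · change 𝟙 _ ≫ 𝟙 _ = 𝟙 _ ≫ (γ C).map (𝟙 X)
    rw [CategoryTheory.Functor.map_id]
  · exact hz.eq_of_tgt _ _
  · exact (isZero_zero (Ho C)).eq_of_src _ _

lemma exists_exactTriangle {A B : Ho C} (φ : A ⟶ B) :
    ∃ (Z : Ho C) (g : B ⟶ Z) (h : Z ⟶ A⟦(1 : ℤ)⟧), Triangle.mk φ g h ∈ K.exactTriangles e := by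
  obtain ⟨X, rfl⟩ := exists_γ_obj_eq A
  obtain ⟨Y, rfl⟩ := exists_γ_obj_eq B
  obtain ⟨Y', i, hi, j, hj⟩ := exists_cof_replacement φ
  refine ⟨_, j.hom ≫ (γ C).map (quotProj i hi), K.δ i hi ≫ e.inv.app _, X, Y', i, hi,
    ⟨Triangle.isoMk _ _ (Iso.refl _) j (Iso.refl _) ?_ ?_ ?_⟩⟩
  · exact hj.trans (Category.id_comp _).symm
  · exact Category.comp_id _
  · change (K.δ i hi ≫ e.inv.app _) ≫ (𝟙 ((γ C).obj X))⟦(1 : ℤ)⟧' = 𝟙 _ ≫ K.δ i hi ≫ e.inv.app _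
    rw [CategoryTheory.Functor.map_id, Category.comp_id, Category.id_comp]

lemma exactTriangles_complete {A B D A' B' D' : Ho C} {f : A ⟶ B} {g : B ⟶ D}
    {h : D ⟶ A⟦(1 : ℤ)⟧} {f' : A' ⟶ B'} {g' : B' ⟶ D'} {h' : D' ⟶ A'⟦(1 : ℤ)⟧}
    (hT : Triangle.mk f g h ∈ K.exactTriangles e) (hT' : Triangle.mk f' g' h' ∈ K.exactTriangles e)
    (a : A ⟶ A') (b : B ⟶ B') (w : f ≫ b = a ≫ f') :
    ∃ c : D ⟶ D', g ≫ c = b ≫ g' ∧ h ≫ a⟦(1 : ℤ)⟧' = c ≫ h' := by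
  obtain ⟨X, Y, i, hi, ⟨j⟩⟩ := hT
  obtain ⟨X', Y', i', hi', ⟨j'⟩⟩ := hT'
  let j₁ : A ≅ (γ C).obj X := Triangle.π₁.mapIso j
  let j₂ : B ≅ (γ C).obj Y := Triangle.π₂.mapIso j
  let j₃ : D ≅ (γ C).obj (quot i hi) := Triangle.π₃.mapIso j
  let k₁ : A' ≅ (γ C).obj X' := Triangle.π₁.mapIso j'
  let k₂ : B' ≅ (γ C).obj Y' := Triangle.π₂.mapIso j'
  let k₃ : D' ≅ (γ C).obj (quot i' hi') := Triangle.π₃.mapIso j'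
  have c₁ : f ≫ j₂.hom = j₁.hom ≫ (γ C).map i := j.hom.comm₁
  have c₂ : g ≫ j₃.hom = j₂.hom ≫ (γ C).map (quotProj i hi) := j.hom.comm₂
  have c₃ : h ≫ j₁.hom⟦(1 : ℤ)⟧' = j₃.hom ≫ K.δ i hi ≫ e.inv.app _ := j.hom.comm₃
  have d₁ : f' ≫ k₂.hom = k₁.hom ≫ (γ C).map i' := j'.hom.comm₁
  have d₂ : g' ≫ k₃.hom = k₂.hom ≫ (γ C).map (quotProj i' hi') := j'.hom.comm₂
  have d₃ : h' ≫ k₁.hom⟦(1 : ℤ)⟧' = k₃.hom ≫ K.δ i' hi' ≫ e.inv.app _ := j'.hom.comm₃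
  obtain ⟨c, hc, hc'⟩ := K.completes_of_comm hi hi' (j₁.inv ≫ a ≫ k₁.hom) (j₂.inv ≫ b ≫ k₂.hom)
    (by
      rw [← cancel_epi j₁.hom, ← reassoc_of% c₁]
      simp only [Category.assoc, Iso.hom_inv_id_assoc]
      rw [reassoc_of% w, d₁])
  have hn := e.inv.naturality (j₁.inv ≫ a ≫ k₁.hom)
  refine ⟨j₃.hom ≫ c ≫ k₃.inv, ?_, ?_⟩
  · rw [reassoc_of% c₂, reassoc_of% hc]
    simp only [Iso.hom_inv_id_assoc]
    rw [← cancel_mono k₃.hom]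
    simp only [Category.assoc, Iso.inv_hom_id, Category.comp_id]
    rw [d₂]
  · rw [← cancel_mono (k₁.hom⟦(1 : ℤ)⟧'), Category.assoc, Category.assoc, Category.assoc,
      Category.assoc, d₃, Iso.inv_hom_id_assoc, ← reassoc_of% hc', hn, ← reassoc_of% c₃]
    simp only [← Functor.map_comp, Iso.hom_inv_id_assoc]

/-- The rotation is the elementary triangle of `Y ⟶ CX ∪_X Y`, up to the collapses `CX ∪_X Y ⟶ Y/X`
and `CX ∪_X Y ⟶ CX/X`. -/
lemma exactTriangles_rotate [∀ n : ℤ, (shiftFunctor (Ho C) n).Additive]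
    (T : Triangle (Ho C)) (h : T ∈ K.exactTriangles e) : T.rotate ∈ K.exactTriangles e := by
  obtain ⟨X, Y, f, hf, ⟨j⟩⟩ := h
  have hw := isIso_γ _ (K.collapseCone_weq f hf)
  let q : (γ C).obj (K.mappingCone f) ≅ (γ C).obj (quot f hf) :=
    asIso ((γ C).map (K.collapseCone f hf))
  let s : (γ C).obj (K.suspObj X) ≅ (γ C).obj (quot (K.inBase f) (K.cof_inBase f)) :=
    asIso ((γ C).map (K.suspToQuot f))
  refine ⟨Y, _, K.inBase f, K.cof_inBase f, ⟨(rotate (Ho C)).mapIso j ≪≫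
    Triangle.isoMk _ _ (Iso.refl _) q.symm (e.app _ ≪≫ (K.σ X).symm ≪≫ s) ?_ ?_ ?_⟩⟩
  · change (γ C).map (quotProj f hf) ≫ q.inv = 𝟙 _ ≫ (γ C).map (K.inBase f)
    rw [Category.id_comp, Iso.comp_inv_eq]
    change _ = (γ C).map (K.inBase f) ≫ (γ C).map (K.collapseCone f hf)
    rw [← Functor.map_comp, inBase_collapseCone]
  · change (K.δ f hf ≫ e.inv.app _) ≫ e.hom.app _ ≫ (K.σ X).inv ≫ (γ C).map (K.suspToQuot f) =
      q.inv ≫ (γ C).map (quotProj (K.inBase f) (K.cof_inBase f))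
    have := K.collapseCone_δ f hf
    rw [Iso.eq_inv_comp, Category.assoc, Iso.inv_hom_id_app_assoc]
    change (γ C).map (K.collapseCone f hf) ≫ _ = _
    rw [reassoc_of% this, Iso.hom_inv_id_assoc, ← Functor.map_comp, collapseBase_suspToQuot]
  · change (-((γ C).map f)⟦(1 : ℤ)⟧') ≫ (𝟙 ((γ C).obj Y))⟦(1 : ℤ)⟧' =
      (e.hom.app _ ≫ (K.σ X).inv ≫ (γ C).map (K.suspToQuot f)) ≫
        K.δ (K.inBase f) (K.cof_inBase f) ≫ e.inv.app _
    have h₁ := K.suspToQuot_δ f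
    -- The sign of the rotation axiom is the sign of the connecting morphism of `X ⟶ CX`.
    rw [δ_ι_eq_neg, Preadditive.neg_comp] at h₁
    have h₂ := e.hom.naturality ((γ C).map f)
    rw [CategoryTheory.Functor.map_id, Category.comp_id, Category.assoc, Category.assoc,
      reassoc_of% h₁, Preadditive.neg_comp, Category.assoc, Preadditive.comp_neg,
      Iso.inv_hom_id_assoc, Preadditive.comp_neg, ← reassoc_of% h₂, Iso.hom_inv_id_app,
      Category.comp_id]

variable [HasZeroObject (Ho C)] [∀ n : ℤ, (shiftFunctor (Ho C) n).Additive]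

/-- The homotopy category with the triangles isomorphic to elementary exact triangles. -/
def forwardPretriangulated : ForwardPretriangulated (Ho C) where
  D := K.exactTriangles e
  of_iso := K.exactTriangles_of_iso e
  contractible := K.contractible_mem e
  cocone := K.exists_exactTriangle e
  rotate := K.exactTriangles_rotate e
  complete _ _ h h' a b w := K.exactTriangles_complete e h h' a b w

end Cones

end CofibrationCategory

/-! ### Homotopy cartesian squares in pretriangulated categories -/

section Pretriangulated

variable {T : Type u} [Category.{v} T] [Preadditive T] [HasZeroObject T] [HasShift T ℤ]
  [∀ n : ℤ, (shiftFunctor T n).Additive] [Pretriangulated T]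

lemma rotate_mk_distinguished_iff {A B D : T} (f : A ⟶ B) (g : B ⟶ D) (h : D ⟶ A⟦(1 : ℤ)⟧) :
    Triangle.mk f g h ∈ distTriang T ↔ Triangle.mk g h (-f⟦(1 : ℤ)⟧') ∈ distTriang T :=
  rotate_distinguished_triangle (Triangle.mk f g h)

/-- The distinguished triangle of a codiagonal. -/
lemma codiagonal_distinguished (A : T) :
    Triangle.mk (biprod.desc (𝟙 A) (𝟙 A)) 0
      (-(biprod.lift (𝟙 A) (-𝟙 A))⟦(1 : ℤ)⟧') ∈ distTriang T := by
  rw [← rotate_mk_distinguished_iff]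
  -- The shear `(x, y) ↦ (x, x + y)` carries `(𝟙, -𝟙)` to the first inclusion and the codiagonal to
  -- the second projection.
  let m : A ⊞ A ≅ A ⊞ A :=
    { hom := biprod.lift biprod.fst (biprod.fst + biprod.snd)
      inv := biprod.lift biprod.fst (biprod.snd - biprod.fst)
      hom_inv_id := by ext <;> simp
      inv_hom_id := by ext <;> simp }
  refine isomorphic_distinguished _ (binaryBiproductTriangle_distinguished A A) _
    (Triangle.isoMk _ _ (Iso.refl _) m (Iso.refl _) ?_ ?_ ?_)
  · change biprod.lift (𝟙 A) (-𝟙 A) ≫ biprod.lift biprod.fst (biprod.fst + biprod.snd) =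
      𝟙 _ ≫ biprod.inl
    ext <;> simp
  · change biprod.desc (𝟙 A) (𝟙 A) ≫ 𝟙 _ =
      biprod.lift biprod.fst (biprod.fst + biprod.snd) ≫ biprod.snd
    ext <;> simp
  · change 0 ≫ (𝟙 A)⟦(1 : ℤ)⟧' = 𝟙 _ ≫ 0
    rw [zero_comp, comp_zero]

/-- Meant for a cylinder inclusion `A ⨿ A ⟶ I`, which is the codiagonal up to isomorphism: it
identifies the cofibre with `A⟦1⟧` and computes the boundary. -/
lemma exists_iso_shift_of_codiagonal {W V Q A : T} {φ : W ⟶ V} {q : V ⟶ Q} {d : Q ⟶ W⟦(1 : ℤ)⟧}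
    (h : Triangle.mk φ q d ∈ distTriang T) (w : W ≅ A ⊞ A) (v : V ≅ A)
    (hw : φ ≫ v.hom = w.hom ≫ biprod.desc (𝟙 A) (𝟙 A)) :
    ∃ θ : Q ≅ A⟦(1 : ℤ)⟧,
      d ≫ w.hom⟦(1 : ℤ)⟧' = θ.hom ≫ (-(biprod.lift (𝟙 A) (-𝟙 A))⟦(1 : ℤ)⟧') := by
  let i := isoTriangleOfIso₁₂ _ _ h (codiagonal_distinguished A) w v hw
  have h₁ : i.hom.hom₁ = w.hom := isoTriangleOfIso₁₂_hom_hom₁ _ _ _ _ _ _ _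
  have h₂ := i.hom.comm₃
  rw [h₁] at h₂
  exact ⟨Triangle.π₃.mapIso i, h₂⟩

lemma exists_distinguished_of_rotate {S M Q A E P : T} {s : S ⟶ M} {q : M ⟶ Q}
    {d : Q ⟶ S⟦(1 : ℤ)⟧} (h : Triangle.mk s q d ∈ distTriang T) (t : S ≅ E) (p : M ≅ P)
    (θ : Q ≅ A⟦(1 : ℤ)⟧) {x : A ⟶ E} {y : E ⟶ P} (hy : s ≫ p.hom = t.hom ≫ y)
    (hx : d ≫ t.hom⟦(1 : ℤ)⟧' = θ.hom ≫ (-x⟦(1 : ℤ)⟧')) :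
    ∃ z : P ⟶ A⟦(1 : ℤ)⟧, Triangle.mk x y z ∈ distTriang T := by
  refine ⟨p.inv ≫ q ≫ θ.hom, (rotate_mk_distinguished_iff _ _ _).2
    (isomorphic_distinguished _ h _ (Triangle.isoMk _ _ t p θ hy ?_ hx).symm)⟩
  change q ≫ θ.hom = p.hom ≫ p.inv ≫ q ≫ θ.hom
  rw [Iso.hom_inv_id_assoc]

lemma IsHomotopyCartesian.of_iso {A B D E A' B' D' E' : T} {g : A ⟶ B} {f : A ⟶ D} {f' : B ⟶ E}
    {g' : D ⟶ E} (h : IsHomotopyCartesian g f f' g') {k : A' ⟶ B'} {l : A' ⟶ D'} {l' : B' ⟶ E'}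
    {k' : D' ⟶ E'} (a : A ≅ A') (b : B ≅ B') (d : D ≅ D') (e : E ≅ E')
    (h₁ : g ≫ b.hom = a.hom ≫ k) (h₂ : f ≫ d.hom = a.hom ≫ l)
    (h₃ : f' ≫ e.hom = b.hom ≫ l') (h₄ : g' ≫ e.hom = d.hom ≫ k') :
    IsHomotopyCartesian k l l' k' := by
  obtain ⟨⟨w⟩, z, hz⟩ := h
  refine ⟨⟨?_⟩, e.inv ≫ z ≫ a.hom⟦(1 : ℤ)⟧', isomorphic_distinguished _ hz _
    (Triangle.isoMk _ _ a (biprod.mapIso d b) e ?_ ?_ ?_).symm⟩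
  · rw [← cancel_epi a.hom, ← reassoc_of% h₁, ← reassoc_of% h₂, ← h₃, ← h₄, reassoc_of% w]
  · change biprod.lift f (-g) ≫ biprod.map d.hom b.hom = a.hom ≫ biprod.lift l (-k)
    ext <;> simp [h₁, h₂]
  · change biprod.desc g' f' ≫ e.hom = biprod.map d.hom b.hom ≫ biprod.desc k' l'
    ext <;> simp [h₃, h₄]
  · change z ≫ a.hom⟦(1 : ℤ)⟧' = e.hom ≫ e.inv ≫ z ≫ a.hom⟦(1 : ℤ)⟧'
    rw [Iso.hom_inv_id_assoc]

end Pretriangulated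

namespace CofibrationCategory

/-! ### Pushouts along cofibrations are homotopy cartesian -/

variable {C : Type u} [Category.{v} C] [CofibrationCategory C] [HasZeroObject C]

/-- Coproducts of `C` are biproducts in the homotopy category. -/
lemma exists_iso_biprod [Preadditive (Ho C)] [HasBinaryBiproducts (Ho C)] {X Y P : C} {l : X ⟶ P}
    {r : Y ⟶ P} (h : IsPushout (fromZero X) (fromZero Y) l r) :
    ∃ t : (γ C).obj P ≅ (γ C).obj X ⊞ (γ C).obj Y,
      (γ C).map l ≫ t.hom = biprod.inl ∧ (γ C).map r ≫ t.hom = biprod.inr := by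
  obtain ⟨t, h₁, h₂⟩ := exists_coprod_desc h
    (biprod.inl : _ ⟶ (γ C).obj X ⊞ (γ C).obj Y) biprod.inr
  refine ⟨⟨t, biprod.desc ((γ C).map l) ((γ C).map r), ?_, ?_⟩, h₁, h₂⟩
  · apply coprod_hom_ext h
    · rw [reassoc_of% h₁, biprod.inl_desc, Category.comp_id]
    · rw [reassoc_of% h₂, biprod.inr_desc, Category.comp_id]
  · apply biprod.hom_ext'
    · rw [biprod.inl_desc_assoc, h₁, Category.comp_id]
    · rw [biprod.inr_desc_assoc, h₂, Category.comp_id]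

/-- The mapping cylinder description of a pushout along a cofibration. -/
lemma exists_double_mappingCylinder {A B D P : C} {i : A ⟶ B} {f : A ⟶ D} {b : B ⟶ P} {j : D ⟶ P}
    (h : IsPushout i f b j) (hi : cofibrations C i) (I : Cylinder A) {S : C} {l : B ⟶ S}
    {r : D ⟶ S} (hS : IsPushout (fromZero B) (fromZero D) l r) :
    ∃ (M : C) (m : I.obj ⟶ M) (s : S ⟶ M) (p : M ⟶ P),
      IsPushout I.i (I.isPushout.desc (i ≫ l) (f ≫ r) (fromZero_eq _ _)) m s ∧
      weakEquivalences C p ∧ s ≫ p = hS.desc b j (fromZero_eq _ _) := by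
  -- The map `i ⨿ f` is split as `i ⨿ 𝟙` followed by `𝟙 ⨿ f`. Gluing the cylinder along the first
  -- gives the mapping cylinder `N` of `i`, and cobase change along the second gives `M`.
  obtain ⟨W, l', r', hW⟩ := exists_pushout (cof_fromZero B) (fromZero A)
  have sq₁ := coprod_map_isPushout I.isPushout hW i
  set x := I.isPushout.desc (i ≫ l') r' (fromZero_eq _ _)
  obtain ⟨N, c, n, sq₂⟩ := exists_pushout I.cof x
  have sq₃ := coprod_map_isPushout hW.flip hS.flip f
  set y := hW.flip.desc (f ≫ r) l (fromZero_eq _ _)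
  obtain ⟨M, m, s, sq₄⟩ := exists_pushout (cof_inr sq₂ I.cof) y
  have hxy : x ≫ y = I.isPushout.desc (i ≫ l) (f ≫ r) (fromZero_eq _ _) := by
    apply I.isPushout.hom_ext
    · rw [I.isPushout.inl_desc_assoc, Category.assoc, I.isPushout.inl_desc, hW.flip.inr_desc]
    · rw [I.isPushout.inr_desc_assoc, I.isPushout.inr_desc, hW.flip.inl_desc]
  have hM : IsPushout I.i (x ≫ y) (c ≫ m) s := sq₂.paste_vert sq₄
  rw [hxy] at hM
  -- the retraction of the mapping cylinder onto `B`
  have hN : IsPushout i I.i₀ (l' ≫ n) c := sq₁.paste_vert sq₂.flip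
  let ρ : N ⟶ B := hN.desc (𝟙 B) (I.p ≫ i) (by
    rw [Category.comp_id, ← Category.assoc, I.i₀_p, Category.id_comp])
  have hlρ : (l' ≫ n) ≫ ρ = 𝟙 B := hN.inl_desc _ _ _
  have hρ : weakEquivalences C ρ := weq_of_precomp (acyclic_inl hN I.cof_i₀ I.weq_i₀)
    (by rw [hlρ]; exact weq_of_isIso _)
  have cn : cofibrations C (r' ≫ n) :=
    cof_trans (cof_inr hW (cof_fromZero B)) (cof_inr sq₂ I.cof)
  have hrρ : (r' ≫ n) ≫ ρ = i := by
    have e : r' = I.inr ≫ x := (I.isPushout.inr_desc _ _ _).symm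
    rw [e, Category.assoc, Category.assoc, ← reassoc_of% sq₂.w, hN.inr_desc,
      ← Category.assoc, ← Category.assoc]
    change (I.i₁ ≫ I.p) ≫ i = i
    rw [I.i₁_p, Category.id_comp]
  have hMD : IsPushout (r' ≫ n) f m (r ≫ s) := sq₃.flip.paste_horiz sq₄
  have w : (r' ≫ n) ≫ ρ ≫ b = f ≫ j := by rw [← Category.assoc, hrρ, h.w]
  -- The retraction `ρ` of `N` onto `B` is a weak equivalence of cofibrations under `A`; cobase
  -- change along `f` turns it into `M ⟶ P`.
  refine ⟨M, c ≫ m, s, hMD.desc (ρ ≫ b) j w, hM, glue_weq cn hi hρ hrρ hMD h w, ?_⟩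
  apply hS.hom_ext
  · have e : l = l' ≫ y := (hW.flip.inr_desc _ _ _).symm
    rw [hS.inl_desc, e, Category.assoc, ← reassoc_of% sq₄.w, hMD.inl_desc, ← Category.assoc,
      ← Category.assoc, hlρ, Category.id_comp]
  · rw [hS.inr_desc, ← Category.assoc, hMD.inr_desc]

namespace Cones

variable (K : Cones C) [Preadditive (Ho C)] [HasZeroObject (Ho C)] [HasShift (Ho C) ℤ]
  [∀ n : ℤ, (shiftFunctor (Ho C) n).Additive] [Pretriangulated (Ho C)]
  (e : shiftFunctor (Ho C) (1 : ℤ) ≅ K.suspension)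
  (he : distTriang (Ho C) = K.exactTriangles e)

include he in
lemma elemTriangle_distinguished {X Y : C} (f : X ⟶ Y) (hf : cofibrations C f) :
    Triangle.mk ((γ C).map f) ((γ C).map (quotProj f hf)) (K.δ f hf ≫ e.inv.app ((γ C).obj X))
      ∈ distTriang (Ho C) := by
  rw [he]
  exact K.elemTriangle_mem e f hf

include he in
/-- Pushouts along cofibrations are homotopy cartesian. -/
lemma isHomotopyCartesian_of_isPushout {A B D P : C} {i : A ⟶ B} {f : A ⟶ D} {b : B ⟶ P}
    {j : D ⟶ P} (h : IsPushout i f b j) (hi : cofibrations C i) :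
    IsHomotopyCartesian ((γ C).map f) ((γ C).map i) ((γ C).map j) ((γ C).map b) := by
  obtain ⟨I⟩ := nonempty_cylinder A
  obtain ⟨S, l, r, hS⟩ := exists_pushout (cof_fromZero B) (fromZero D)
  obtain ⟨M, m, s, p, hM, wp, hsp⟩ := exists_double_mappingCylinder h hi I hS
  obtain ⟨w, w₁, w₂⟩ := exists_iso_biprod I.isPushout
  obtain ⟨t, t₁, t₂⟩ := exists_iso_biprod hS
  have ip := isIso_γ p wp
  have iI := isIso_γ I.p I.weq
  have cs : cofibrations C s := cof_inr hM I.cof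
  let φ := I.isPushout.desc (i ≫ l) (f ≫ r) (fromZero_eq _ _)
  let q := quotMap I.i I.cof s cs φ m hM.w
  -- Since `s` is a cobase change of `I.i`, its cofibre is that of the cylinder inclusion, namely
  -- `A⟦1⟧`.
  have iq : IsIso q := isIso_quotMap_of_isPushout hM.flip.flip
  obtain ⟨θ, hθ⟩ := exists_iso_shift_of_codiagonal (K.elemTriangle_distinguished e he I.i I.cof)
    w (asIso ((γ C).map I.p)) (by
      apply coprod_hom_ext I.isPushout
      · rw [reassoc_of% w₁, biprod.inl_desc, asIso_hom, ← Functor.map_comp, ← Functor.map_comp,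
          I.inl_p, CategoryTheory.Functor.map_id]
      · rw [reassoc_of% w₂, biprod.inr_desc, asIso_hom, ← Functor.map_comp, ← Functor.map_comp,
          I.inr_p, CategoryTheory.Functor.map_id])
  have hφ : (γ C).map φ ≫ t.hom = w.hom ≫ biprod.map ((γ C).map i) ((γ C).map f) := by
    apply coprod_hom_ext I.isPushout
    · rw [reassoc_of% w₁, biprod.inl_map, ← t₁, ← Functor.map_comp_assoc, ← Functor.map_comp_assoc,
        I.isPushout.inl_desc]
    · rw [reassoc_of% w₂, biprod.inr_map, ← t₂, ← Functor.map_comp_assoc, ← Functor.map_comp_assoc,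
        I.isPushout.inr_desc]
  refine ⟨⟨by rw [← Functor.map_comp, ← Functor.map_comp, h.w]⟩, ?_⟩
  refine exists_distinguished_of_rotate (K.elemTriangle_distinguished e he s cs) t
    (asIso ((γ C).map p)) ((asIso ((γ C).map q)).symm ≪≫ θ) ?_ ?_
  · apply coprod_hom_ext hS
    · rw [reassoc_of% t₁, biprod.inl_desc, asIso_hom, ← Functor.map_comp, ← Functor.map_comp,
        hsp, hS.inl_desc]
    · rw [reassoc_of% t₂, biprod.inr_desc, asIso_hom, ← Functor.map_comp, ← Functor.map_comp,
        hsp, hS.inr_desc]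
  -- By naturality the boundary is `-(𝟙, -𝟙)⟦1⟧'` followed by the shift of `i ⊕ f`, that is `-(i,
  -- -f)⟦1⟧'`; rotating back gives the first morphism `(i, -f)`.
  · have hδ := K.δ_naturality I.i I.cof s cs φ m hM.w
    have hn := e.inv.naturality ((γ C).map φ)
    change (γ C).map q ≫ _ = _ at hδ
    simp only [Category.assoc] at hθ
    rw [Iso.trans_hom, Iso.symm_hom, asIso_inv, ← cancel_epi ((γ C).map q), Category.assoc,
      Category.assoc, IsIso.hom_inv_id_assoc, reassoc_of% hδ, reassoc_of% hn, ← Functor.map_comp,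
      hφ, Functor.map_comp, reassoc_of% hθ, Preadditive.neg_comp, ← Functor.map_comp]
    congr 3
    ext <;> simp

end Cones

end CofibrationCategory

namespace CofibrationCategory

variable {C : Type u} [Category.{v} C] [CofibrationCategory C] [HasZeroObject C]

/-! ### The two homotopy cartesian squares of a composition of cofibrations -/

namespace Cones

variable (K : Cones C) {X Y Z : C}

lemma collapseBase_isPushout (f : X ⟶ Y) :
    IsPushout (K.inBase f) (toZero Y) (K.collapseBase f) (fromZero _) := by
  refine IsPushout.of_top ?_ (K.inBase_collapseBase f) (K.mappingCone_isPushout f)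
  rw [inCone_collapseBase, toZero_eq (f ≫ toZero Y) (toZero X)]
  exact quot_isPushout _ _

/-- For a cone extension `E` of `f`, the morphism `CX ∪_X Y ⟶ E`. -/
def Extension.fromMappingCone {K : Cones C} {f : X ⟶ Y} (E : K.Extension f) :
    K.mappingCone f ⟶ E.obj :=
  (K.mappingCone_isPushout f).desc E.map (K.ι Y ≫ E.s) (by rw [E.comm, Category.assoc])

section

variable {K} {f : X ⟶ Y} (E : K.Extension f)

lemma inCone_fromMappingCone : K.inCone f ≫ E.fromMappingCone = E.map :=
  (K.mappingCone_isPushout f).inl_desc _ _ _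

lemma inBase_fromMappingCone : K.inBase f ≫ E.fromMappingCone = K.ι Y ≫ E.s :=
  (K.mappingCone_isPushout f).inr_desc _ _ _

/-- The map factors through `CX ∪_X CY`: the first factor is a cobase change of `Y ⟶ CY`, the second
a cofibration by the definition of an extension. -/
lemma cof_fromMappingCone : cofibrations C E.fromMappingCone := by
  obtain ⟨R, a, b, hR⟩ := exists_pushout (K.cof Y) (K.inBase f)
  have h := (K.mappingCone_isPushout f).paste_vert hR.flip
  have e : E.fromMappingCone = b ≫ h.desc E.map E.s E.comm := by
    apply (K.mappingCone_isPushout f).hom_ext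
    · rw [inCone_fromMappingCone, ← Category.assoc, h.inl_desc]
    · rw [inBase_fromMappingCone, ← Category.assoc, ← hR.w, Category.assoc, h.inr_desc]
  rw [e]
  exact cof_trans (cof_inr hR (K.cof Y)) (E.cof_desc h)

lemma collapseBase_quotA_isPushout :
    IsPushout E.fromMappingCone (K.collapseBase f)
      (quotProj (K.ι Y ≫ E.s) (cof_trans (K.cof Y) E.cof_s))
      (K.quotA f E.map E.s E.cof_s E.comm) := by
  refine IsPushout.of_left ?_ ?_ (K.collapseBase_isPushout f)
  · rw [inBase_fromMappingCone, fromZero_eq (fromZero _ ≫ _) (fromZero _)]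
    exact quot_isPushout _ _
  · apply (K.mappingCone_isPushout f).hom_ext
    · rw [reassoc_of% (inCone_fromMappingCone E), reassoc_of% (K.inCone_collapseBase f), quotA,
        quotProj_quotMap]
    · rw [reassoc_of% (inBase_fromMappingCone E), reassoc_of% (K.inBase_collapseBase f),
        zero_comp_eq, ← Category.assoc, (quot_isPushout _ _).w]

end

variable [Preadditive (Ho C)] [HasZeroObject (Ho C)] [HasShift (Ho C) ℤ]
  [∀ n : ℤ, (shiftFunctor (Ho C) n).Additive] [Pretriangulated (Ho C)]
  (e : shiftFunctor (Ho C) (1 : ℤ) ≅ K.suspension)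
  (he : distTriang (Ho C) = K.exactTriangles e)
  (f : X ⟶ Y) (g : Y ⟶ Z) (hf : cofibrations C f) (hg : cofibrations C g)

include he in
lemma isHomotopyCartesian_quotProj :
    IsHomotopyCartesian ((γ C).map (quotProj f hf)) ((γ C).map g)
      ((γ C).map (quotMap f hf (f ≫ g) (cof_trans hf hg) (𝟙 X) g (Category.id_comp _).symm))
      ((γ C).map (quotProj (f ≫ g) (cof_trans hf hg))) :=
  K.isHomotopyCartesian_of_isPushout e he (quotMap_isPushout f hf g _ _ _) hg

-- The square is isomorphic to the image of a strict pushout with corners `CX ∪_X Z`, `CX/X`, `N`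
-- and `E/Y`, where `E` is a cone extension of `f`.
include he in
lemma isHomotopyCartesian_δ :
    IsHomotopyCartesian (K.δ (f ≫ g) (cof_trans hf hg))
      ((γ C).map (quotMap (f ≫ g) (cof_trans hf hg) g hg f (𝟙 Z) (Category.comp_id _)))
      (K.suspension.map ((γ C).map f)) (K.δ g hg) := by
  obtain ⟨E⟩ := K.exists_extension f
  have hR := K.mappingCone_isPushout f
  have hM := K.mappingCone_isPushout (f ≫ g)
  -- `CX ∪_X Z` is the pushout of `g` along `Y ⟶ CX ∪_X Y`
  let x : K.mappingCone f ⟶ K.mappingCone (f ≫ g) :=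
    hR.desc (K.inCone (f ≫ g)) (g ≫ K.inBase (f ≫ g)) (by rw [hM.w, Category.assoc])
  have hx₁ : K.inCone f ≫ x = K.inCone (f ≫ g) := hR.inl_desc _ _ _
  have hx₂ : K.inBase f ≫ x = g ≫ K.inBase (f ≫ g) := hR.inr_desc _ _ _
  have hx : IsPushout (K.inBase f) g x (K.inBase (f ≫ g)) := by
    refine IsPushout.of_top ?_ hx₂ hR
    rwa [hx₁]
  -- `N` glues `E` to `CX ∪_X Z` along `CX ∪_X Y`. Equivalently it is `E ∪_Y Z`, a mapping cone of
  -- `g` formed with the larger cone `E` of `Y`.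
  obtain ⟨N, u, i, hN⟩ := exists_pushout (cof_fromMappingCone E) x
  have ci : cofibrations C i := cof_inr hN (cof_fromMappingCone E)
  have hYN : IsPushout (K.ι Y ≫ E.s) g u (K.inBase (f ≫ g) ≫ i) := by
    rw [← inBase_fromMappingCone]
    exact hx.paste_horiz hN
  have cu : cofibrations C u := cof_inl hYN hg
  -- the two collapses of `N`
  let c : N ⟶ quot (K.ι Y ≫ E.s) (cof_trans (K.cof Y) E.cof_s) :=
    hYN.desc (quotProj _ _) (toZero Z ≫ fromZero _) (by
      rw [(quot_isPushout _ _).w, ← Category.assoc, toZero_eq (g ≫ _) (toZero Y)])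
  have hc₁ : u ≫ c = quotProj _ _ := hYN.inl_desc _ _ _
  have hc₂ : (K.inBase (f ≫ g) ≫ i) ≫ c = toZero Z ≫ fromZero _ := hYN.inr_desc _ _ _
  let r : N ⟶ quot g hg := hYN.desc (toZero _ ≫ fromZero _) (quotProj g hg) (by
      rw [(quot_isPushout _ _).w, ← Category.assoc, toZero_eq (_ ≫ toZero _) (toZero Y)])
  have hr₁ : u ≫ r = toZero _ ≫ fromZero _ := hYN.inl_desc _ _ _
  have hr₂ : (K.inBase (f ≫ g) ≫ i) ≫ r = quotProj g hg := hYN.inr_desc _ _ _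
  -- `r` collapses the weakly contractible object `E` inside `N`, with quotient `Z/Y`.
  have wr : weakEquivalences C r := by
    refine weq_collapse (i := u) (z := fromZero _) cu ((K.contractible Y).of_weq E.weq_s) ?_
    refine (IsPushout.of_left ?_ hr₁.symm hYN).flip
    rw [hr₂, toZero_eq ((K.ι Y ≫ E.s) ≫ toZero _) (toZero Y)]
    exact (quot_isPushout g hg).flip
  have hxb : x ≫ K.collapseBase (f ≫ g) = K.collapseBase f := by
    apply hR.hom_ext
    · rw [reassoc_of% hx₁, inCone_collapseBase, inCone_collapseBase]
    · rw [reassoc_of% hx₂, inBase_collapseBase, inBase_collapseBase, ← Category.assoc,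
        toZero_eq (g ≫ _) (toZero Y)]
  have hic : i ≫ c = K.collapseBase (f ≫ g) ≫ K.quotA f E.map E.s E.cof_s E.comm := by
    apply hM.hom_ext
    · rw [← hx₁, Category.assoc, Category.assoc, ← reassoc_of% hN.w, hc₁, reassoc_of% hxb,
        (collapseBase_quotA_isPushout E).w]
    · rw [← Category.assoc, hc₂, ← Category.assoc, inBase_collapseBase, Category.assoc,
        zero_comp_eq]
  have sq : IsPushout i (K.collapseBase (f ≫ g)) c (K.quotA f E.map E.s E.cof_s E.comm) := by
    refine IsPushout.of_top ?_ hic hN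
    rw [hxb, hc₁]
    exact collapseBase_quotA_isPushout E
  have wM := isIso_γ _ (K.collapseCone_weq (f ≫ g) (cof_trans hf hg))
  have wr' := isIso_γ r wr
  have wS := isIso_γ _ (K.quotS_weq E.s E.cof_s E.weq_s)
  refine (K.isHomotopyCartesian_of_isPushout e he sq ci).of_iso
    (asIso ((γ C).map (K.collapseCone (f ≫ g) (cof_trans hf hg)))) (K.σ X)
    (asIso ((γ C).map r)) ((asIso ((γ C).map (K.quotS E.s E.cof_s))).symm ≪≫ K.σ Y) ?_ ?_ ?_ ?_
  · exact (K.collapseCone_δ _ _).symm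
  · rw [asIso_hom, asIso_hom, ← Functor.map_comp, ← Functor.map_comp]
    congr 1
    apply hM.hom_ext
    · rw [← hx₁, Category.assoc, Category.assoc, ← reassoc_of% hN.w, hr₁,
        reassoc_of% hx₁, reassoc_of% (K.inCone_collapseCone (f ≫ g) (cof_trans hf hg)),
        zero_comp_eq]
      simp only [← Category.assoc]
      rw [toZero_eq (_ ≫ toZero _) (toZero _)]
    · rw [← Category.assoc, hr₂, ← Category.assoc, inBase_collapseCone, quotProj_quotMap,
        Category.id_comp]
  · rw [suspension_map_γ, Iso.trans_hom, Iso.symm_hom, asIso_inv, ← Category.assoc]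
    congr 1
    rw [IsIso.comp_inv_eq, suspMap_quotS _ _ _ _ _ E.weq_s]
  -- To recognize `δ(g)`, compare `N` with the standard mapping cone of `g` through the weak
  -- equivalence `w`, compatible with both collapses.
  · have hG := K.mappingCone_isPushout g
    let w : K.mappingCone g ⟶ N := hG.desc (E.s ≫ u) (K.inBase (f ≫ g) ≫ i) (by
      rw [← Category.assoc, hYN.w])
    have hw₁ : K.inCone g ≫ w = E.s ≫ u := hG.inl_desc _ _ _
    have hw₂ : K.inBase g ≫ w = K.inBase (f ≫ g) ≫ i := hG.inr_desc _ _ _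
    have hwr : w ≫ r = K.collapseCone g hg := by
      apply hG.hom_ext
      · rw [reassoc_of% hw₁, hr₁, inCone_collapseCone, ← Category.assoc,
          toZero_eq (E.s ≫ _) (toZero _)]
      · rw [← Category.assoc, hw₂, hr₂, inBase_collapseCone]
    have hwc : w ≫ c = K.collapseBase g ≫ K.quotS E.s E.cof_s := by
      apply hG.hom_ext
      · rw [reassoc_of% hw₁, hc₁, ← Category.assoc, inCone_collapseBase, quotS,
          quotProj_quotMap]
      · rw [← Category.assoc, hw₂, hc₂, ← Category.assoc, inBase_collapseBase, Category.assoc,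
          zero_comp_eq]
    have ww := isIso_γ w (weq_of_postcomp wr (by rw [hwr]; exact K.collapseCone_weq g hg))
    rw [asIso_hom, Iso.trans_hom, Iso.symm_hom, asIso_inv, ← cancel_epi ((γ C).map w),
      ← reassoc_of% ((γ C).map_comp w r), hwr, collapseCone_δ,
      ← reassoc_of% ((γ C).map_comp w c), hwc, Functor.map_comp, Category.assoc,
      IsIso.hom_inv_id_assoc]

end Cones

end CofibrationCategory

/-! ### Strong triangulations -/

section Pretriangulated

variable {T : Type u} [Category.{v} T]

lemma comp_inv_eq_of_comp_hom_eq {A B A' B' : T} {g : A ⟶ B} {k : A' ⟶ B'} {a : A' ≅ A} {b : B' ≅ B}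
    (h : k ≫ b.hom = a.hom ≫ g) : g ≫ b.inv = a.inv ≫ k := by
  rw [Iso.comp_inv_eq, Category.assoc, h, Iso.inv_hom_id_assoc]

variable [Preadditive T] [HasZeroObject T] [HasShift T ℤ]
  [∀ n : ℤ, (shiftFunctor T n).Additive] [Pretriangulated T]

lemma IsHomotopyCartesian.of_iso' {A B D E A' B' D' E' : T} {g : A ⟶ B} {f : A ⟶ D} {f' : B ⟶ E}
    {g' : D ⟶ E} (h : IsHomotopyCartesian g f f' g') {k : A' ⟶ B'} {l : A' ⟶ D'} {l' : B' ⟶ E'}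
    {k' : D' ⟶ E'} (a : A' ≅ A) (b : B' ≅ B) (d : D' ≅ D) (e : E' ≅ E)
    (h₁ : k ≫ b.hom = a.hom ≫ g) (h₂ : l ≫ d.hom = a.hom ≫ f)
    (h₃ : l' ≫ e.hom = b.hom ≫ f') (h₄ : k' ≫ e.hom = d.hom ≫ g') :
    IsHomotopyCartesian k l l' k' :=
  h.of_iso a.symm b.symm d.symm e.symm (comp_inv_eq_of_comp_hom_eq h₁)
    (comp_inv_eq_of_comp_hom_eq h₂) (comp_inv_eq_of_comp_hom_eq h₃) (comp_inv_eq_of_comp_hom_eq h₄)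

lemma exists_iso₃_of_iso₁₂ {X Y Z X' Y' Z' : T} {f : X ⟶ Y} {g : Y ⟶ Z} {h : Z ⟶ X⟦(1 : ℤ)⟧}
    {f' : X' ⟶ Y'} {g' : Y' ⟶ Z'} {h' : Z' ⟶ X'⟦(1 : ℤ)⟧}
    (hT : Triangle.mk f g h ∈ distTriang T) (hT' : Triangle.mk f' g' h' ∈ distTriang T)
    (a : X ≅ X') (b : Y ≅ Y') (w : f ≫ b.hom = a.hom ≫ f') :
    ∃ c : Z ≅ Z', g ≫ c.hom = b.hom ≫ g' ∧ h ≫ a.hom⟦(1 : ℤ)⟧' = c.hom ≫ h' := by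
  let i := isoTriangleOfIso₁₂ _ _ hT hT' a b w
  have h₁ : i.hom.hom₁ = a.hom := isoTriangleOfIso₁₂_hom_hom₁ _ _ _ _ _ _ _
  have h₂ : i.hom.hom₂ = b.hom := isoTriangleOfIso₁₂_hom_hom₂ _ _ _ _ _ _ _
  have c₂ := i.hom.comm₂
  have c₃ := i.hom.comm₃
  rw [h₂] at c₂
  rw [h₁] at c₃
  exact ⟨Triangle.π₃.mapIso i, c₂, c₃⟩

section

variable {X₁ X₂ X₃ Z₁₂ Z₂₃ Z₁₃ : T}

/-- The existence of an octahedron whose two middle squares are homotopy cartesian. -/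
def HasStrongOctahedron (u₁₂ : X₁ ⟶ X₂) (u₂₃ : X₂ ⟶ X₃) (v₁₂ : X₂ ⟶ Z₁₂)
    (w₁₂ : Z₁₂ ⟶ X₁⟦(1 : ℤ)⟧) (v₂₃ : X₃ ⟶ Z₂₃) (w₂₃ : Z₂₃ ⟶ X₂⟦(1 : ℤ)⟧) (v₁₃ : X₃ ⟶ Z₁₃)
    (w₁₃ : Z₁₃ ⟶ X₁⟦(1 : ℤ)⟧) : Prop :=
  ∃ (m₁ : Z₁₂ ⟶ Z₁₃) (m₃ : Z₁₃ ⟶ Z₂₃), m₁ ≫ w₁₃ = w₁₂ ∧ v₁₃ ≫ m₃ = v₂₃ ∧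
    Triangle.mk m₁ m₃ (w₂₃ ≫ v₁₂⟦(1 : ℤ)⟧') ∈ distTriang T ∧
    IsHomotopyCartesian v₁₂ u₂₃ m₁ v₁₃ ∧
    IsHomotopyCartesian w₁₃ m₃ (u₁₂⟦(1 : ℤ)⟧') w₂₃

variable {u₁₂ : X₁ ⟶ X₂} {u₂₃ : X₂ ⟶ X₃} {u₁₃ : X₁ ⟶ X₃} {v₁₂ : X₂ ⟶ Z₁₂}
  {w₁₂ : Z₁₂ ⟶ X₁⟦(1 : ℤ)⟧} {v₂₃ : X₃ ⟶ Z₂₃} {w₂₃ : Z₂₃ ⟶ X₂⟦(1 : ℤ)⟧} {v₁₃ : X₃ ⟶ Z₁₃}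
  {w₁₃ : Z₁₃ ⟶ X₁⟦(1 : ℤ)⟧}

lemma HasStrongOctahedron.exists_octahedron
    (H : HasStrongOctahedron u₁₂ u₂₃ v₁₂ w₁₂ v₂₃ w₂₃ v₁₃ w₁₃) (comm : u₁₂ ≫ u₂₃ = u₁₃)
    (h₁₂ : Triangle.mk u₁₂ v₁₂ w₁₂ ∈ distTriang T) (h₂₃ : Triangle.mk u₂₃ v₂₃ w₂₃ ∈ distTriang T)
    (h₁₃ : Triangle.mk u₁₃ v₁₃ w₁₃ ∈ distTriang T) :
    ∃ o : Triangulated.Octahedron comm h₁₂ h₂₃ h₁₃,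
      IsHomotopyCartesian v₁₂ u₂₃ o.m₁ v₁₃ ∧
      IsHomotopyCartesian w₁₃ o.m₃ (u₁₂⟦(1 : ℤ)⟧') w₂₃ := by
  obtain ⟨m₁, m₃, hm₁, hm₃, hm, c₁, c₂⟩ := H
  exact ⟨⟨m₁, m₃, c₁.1.w, hm₁, hm₃, c₂.1.w, hm⟩, c₁, c₂⟩

/-- Isomorphic compositions have isomorphic triangles, whatever the choices, so one good octahedron
suffices; its morphisms are conjugated by the isomorphisms of third objects. -/
lemma HasStrongOctahedron.of_iso {X₁' X₂' X₃' Z₁₂' Z₂₃' Z₁₃' : T} {u₁₂' : X₁' ⟶ X₂'}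
    {u₂₃' : X₂' ⟶ X₃'} {u₁₃' : X₁' ⟶ X₃'} {v₁₂' : X₂' ⟶ Z₁₂'} {w₁₂' : Z₁₂' ⟶ X₁'⟦(1 : ℤ)⟧}
    {v₂₃' : X₃' ⟶ Z₂₃'} {w₂₃' : Z₂₃' ⟶ X₂'⟦(1 : ℤ)⟧} {v₁₃' : X₃' ⟶ Z₁₃'}
    {w₁₃' : Z₁₃' ⟶ X₁'⟦(1 : ℤ)⟧}
    (H : HasStrongOctahedron u₁₂' u₂₃' v₁₂' w₁₂' v₂₃' w₂₃' v₁₃' w₁₃')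
    (comm : u₁₂ ≫ u₂₃ = u₁₃) (comm' : u₁₂' ≫ u₂₃' = u₁₃')
    (h₁₂ : Triangle.mk u₁₂ v₁₂ w₁₂ ∈ distTriang T) (h₂₃ : Triangle.mk u₂₃ v₂₃ w₂₃ ∈ distTriang T)
    (h₁₃ : Triangle.mk u₁₃ v₁₃ w₁₃ ∈ distTriang T)
    (h₁₂' : Triangle.mk u₁₂' v₁₂' w₁₂' ∈ distTriang T)
    (h₂₃' : Triangle.mk u₂₃' v₂₃' w₂₃' ∈ distTriang T)
    (h₁₃' : Triangle.mk u₁₃' v₁₃' w₁₃' ∈ distTriang T)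
    (e₁ : X₁ ≅ X₁') (e₂ : X₂ ≅ X₂') (e₃ : X₃ ≅ X₃')
    (a₁₂ : u₁₂ ≫ e₂.hom = e₁.hom ≫ u₁₂') (a₂₃ : u₂₃ ≫ e₃.hom = e₂.hom ≫ u₂₃') :
    HasStrongOctahedron u₁₂ u₂₃ v₁₂ w₁₂ v₂₃ w₂₃ v₁₃ w₁₃ := by
  obtain ⟨m₁, m₃, hm₁, hm₃, hm, c₁, c₂⟩ := H
  obtain ⟨k₁₂, p₁₂, q₁₂⟩ := exists_iso₃_of_iso₁₂ h₁₂ h₁₂' e₁ e₂ a₁₂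
  obtain ⟨k₂₃, p₂₃, q₂₃⟩ := exists_iso₃_of_iso₁₂ h₂₃ h₂₃' e₂ e₃ a₂₃
  obtain ⟨k₁₃, p₁₃, q₁₃⟩ := exists_iso₃_of_iso₁₂ h₁₃ h₁₃' e₁ e₃ (by
    rw [← comm, ← comm', Category.assoc, a₂₃, reassoc_of% a₁₂])
  refine ⟨k₁₂.hom ≫ m₁ ≫ k₁₃.inv, k₁₃.hom ≫ m₃ ≫ k₂₃.inv, ?_, ?_, ?_, ?_, ?_⟩
  · rw [← cancel_mono (e₁.hom⟦(1 : ℤ)⟧'), Category.assoc, Category.assoc, Category.assoc, q₁₃,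
      Iso.inv_hom_id_assoc, hm₁, q₁₂]
  · rw [reassoc_of% p₁₃, reassoc_of% hm₃, ← reassoc_of% p₂₃, Iso.hom_inv_id, Category.comp_id]
  · refine isomorphic_distinguished _ hm _ (Triangle.isoMk _ _ k₁₂ k₁₃ k₂₃ ?_ ?_ ?_)
    · change (k₁₂.hom ≫ m₁ ≫ k₁₃.inv) ≫ k₁₃.hom = k₁₂.hom ≫ m₁
      simp
    · change (k₁₃.hom ≫ m₃ ≫ k₂₃.inv) ≫ k₂₃.hom = k₁₃.hom ≫ m₃
      simp
    · change (w₂₃ ≫ v₁₂⟦(1 : ℤ)⟧') ≫ k₁₂.hom⟦(1 : ℤ)⟧' = k₂₃.hom ≫ w₂₃' ≫ v₁₂'⟦(1 : ℤ)⟧'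
      rw [Category.assoc, ← Functor.map_comp, p₁₂, Functor.map_comp, reassoc_of% q₂₃]
  · exact c₁.of_iso' e₂ k₁₂ e₃ k₁₃ p₁₂ a₂₃ (by simp) p₁₃
  · exact c₂.of_iso' k₁₃ ((shiftFunctor T (1 : ℤ)).mapIso e₁) k₂₃
      ((shiftFunctor T (1 : ℤ)).mapIso e₂) q₁₃ (by simp)
      (by rw [Functor.mapIso_hom, Functor.mapIso_hom, ← Functor.map_comp, ← Functor.map_comp, a₁₂])
      q₂₃

end

end Pretriangulated

namespace CofibrationCategory

variable {C : Type u} [Category.{v} C] [CofibrationCategory C] [HasZeroObject C]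

namespace Cones

variable (K : Cones C) {X Y Z : C}

section

variable [Preadditive (Ho C)] [HasZeroObject (Ho C)] [HasShift (Ho C) ℤ]
  [∀ n : ℤ, (shiftFunctor (Ho C) n).Additive] [Pretriangulated (Ho C)]
  (e : shiftFunctor (Ho C) (1 : ℤ) ≅ K.suspension)
  (he : distTriang (Ho C) = K.exactTriangles e)

-- The map `a : Y/X ⟶ Z/X` is a cobase change of `g`, hence a cofibration with quotient `Z/Y`. Its
-- elementary triangle is the fourth triangle of the octahedron, with boundary given by naturality
-- of `δ`.
include he in
lemma hasStrongOctahedron (f : X ⟶ Y) (g : Y ⟶ Z) (hf : cofibrations C f)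
    (hg : cofibrations C g) :
    HasStrongOctahedron ((γ C).map f) ((γ C).map g) ((γ C).map (quotProj f hf))
      (K.δ f hf ≫ e.inv.app _) ((γ C).map (quotProj g hg)) (K.δ g hg ≫ e.inv.app _)
      ((γ C).map (quotProj (f ≫ g) (cof_trans hf hg)))
      (K.δ (f ≫ g) (cof_trans hf hg) ≫ e.inv.app _) := by
  let a := quotMap f hf (f ≫ g) (cof_trans hf hg) (𝟙 X) g (Category.id_comp _).symm
  let b := quotMap (f ≫ g) (cof_trans hf hg) g hg f (𝟙 Z) (Category.comp_id _)
  have sq : IsPushout g (quotProj f hf) (quotProj (f ≫ g) (cof_trans hf hg)) a :=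
    quotMap_isPushout f hf g _ _ _
  have ca : cofibrations C a := cof_inr sq hg
  let n : quot g hg ⟶ quot a ca := quotMap g hg a ca (quotProj f hf) _ sq.w
  have hn : IsIso n := isIso_quotMap_of_isPushout sq
  let i : (γ C).obj (quot g hg) ≅ (γ C).obj (quot a ca) := (γ C).mapIso (@asIso _ _ _ _ n hn)
  have hbn : b ≫ n = quotProj a ca := by
    apply quot_hom_ext
    rw [← Category.assoc, quotProj_quotMap, Category.id_comp, quotProj_quotMap]
  have hδa := K.δ_naturality f hf (f ≫ g) (cof_trans hf hg) (𝟙 X) g (Category.id_comp _).symm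
  rw [CategoryTheory.Functor.map_id, CategoryTheory.Functor.map_id, Category.comp_id] at hδa
  refine ⟨(γ C).map a, (γ C).map b, by rw [← Category.assoc, hδa], ?_, ?_,
    K.isHomotopyCartesian_quotProj e he f g hf hg, ?_⟩
  · rw [← Functor.map_comp, quotProj_quotMap, Category.id_comp]
  · have hδn := K.δ_naturality g hg a ca (quotProj f hf) _ sq.w
    have hen := e.inv.naturality ((γ C).map (quotProj f hf))
    refine isomorphic_distinguished _ (K.elemTriangle_distinguished e he a ca) _
      (Triangle.isoMk _ _ (Iso.refl _) (Iso.refl _) i ?_ ?_ ?_)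
    · exact (Category.comp_id _).trans (Category.id_comp _).symm
    · change (γ C).map b ≫ (γ C).map n = 𝟙 _ ≫ (γ C).map (quotProj a ca)
      rw [← Functor.map_comp, hbn, Category.id_comp]
    · change ((K.δ g hg ≫ e.inv.app _) ≫ ((γ C).map (quotProj f hf))⟦(1 : ℤ)⟧') ≫
        (𝟙 ((γ C).obj (quot f hf)))⟦(1 : ℤ)⟧' = (γ C).map n ≫ K.δ a ca ≫ e.inv.app _
      rw [CategoryTheory.Functor.map_id, Category.comp_id, Category.assoc, ← hen,
        ← Category.assoc, ← Category.assoc, hδn]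
  · refine (K.isHomotopyCartesian_δ e he f g hf hg).of_iso (Iso.refl _) (e.symm.app _)
      (Iso.refl _) (e.symm.app _) (Category.id_comp _).symm
      ((Category.comp_id _).trans (Category.id_comp _).symm) (e.inv.naturality _)
      (Category.id_comp _).symm

include he in
lemma isStronglyTriangulated : IsStronglyTriangulated (Ho C) := by
  intro X₁ X₂ X₃ Z₁₂ Z₂₃ Z₁₃ u₁₂ u₂₃ u₁₃ comm v₁₂ w₁₂ h₁₂ v₂₃ w₂₃ h₂₃ v₁₃ w₁₃ h₁₃
  refine HasStrongOctahedron.exists_octahedron ?_ comm h₁₂ h₂₃ h₁₃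
  obtain ⟨X, rfl⟩ := exists_γ_obj_eq X₁
  obtain ⟨Y₀, rfl⟩ := exists_γ_obj_eq X₂
  obtain ⟨Z₀, rfl⟩ := exists_γ_obj_eq X₃
  -- Replace the first morphism by a cofibration, then the second one precomposed with the inverse
  -- of the change of middle object, so that the two cofibrations compose in `C`.
  obtain ⟨Y, f, hf, e₂, a₁₂⟩ := exists_cof_replacement u₁₂
  obtain ⟨Z, g, hg, e₃, a₂₃⟩ := exists_cof_replacement (e₂.inv ≫ u₂₃)
  refine (K.hasStrongOctahedron e he f g hf hg).of_iso comm ((γ C).map_comp f g).symm h₁₂ h₂₃ h₁₃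
    (K.elemTriangle_distinguished e he f hf) (K.elemTriangle_distinguished e he g hg)
    (K.elemTriangle_distinguished e he _ _) (Iso.refl _) e₂ e₃
    (a₁₂.trans (Category.id_comp _).symm) ?_
  rw [← a₂₃, Category.assoc, Iso.hom_inv_id_assoc]

end

lemma additive_of_isEquivalence {T : Type u} [Category.{v} T] [Preadditive T]
    [HasBinaryBiproducts T] (F : T ⥤ T) [F.IsEquivalence] : F.Additive :=
  Functor.additive_of_preserves_binary_products F

lemma exists_preadditive (hK : K.suspension.IsEquivalence) :
    ∃ _ : Preadditive (Ho C), HasBinaryBiproducts (Ho C) := by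
  let _ := (isZero_γ_zero C).hasZeroMorphisms
  have := K.hasBinaryBiproducts hK
  exact ⟨preadditiveOfBinaryBiproducts (fun A => K.exists_neg_id hK A), this⟩

end Cones

end CofibrationCategory

end

theorem mainTheorem7 {C : Type u} [Category.{v} C] [CofibrationCategory C] [HasZeroObject C]
    (K : Cones C) (hstable : K.suspension.IsEquivalence) :
    ∃ (_ : Preadditive (Ho C)) (_ : HasZeroObject (Ho C)) (_ : HasShift (Ho C) ℤ)
      (_ : ∀ n : ℤ, (shiftFunctor (Ho C) n).Additive) (_ : Pretriangulated (Ho C))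
      (e : shiftFunctor (Ho C) (1 : ℤ) ≅ K.suspension),
      -- the distinguished triangles are those isomorphic to an elementary exact triangle
      (∀ T : Triangle (Ho C), T ∈ distTriang (Ho C) ↔
        ∃ (X Y : C) (f : X ⟶ Y) (hf : cofibrations C f),
          Nonempty (T ≅ Triangle.mk ((γ C).map f) ((γ C).map (quotProj f hf))
            (K.δ f hf ≫ e.inv.app ((γ C).obj X)))) ∧
      -- the two squares attached to a composition of cofibrations are homotopy cartesian
      (∀ {X Y Z : C} (f : X ⟶ Y) (g : Y ⟶ Z) (hf : cofibrations C f) (hg : cofibrations C g),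
        IsHomotopyCartesian ((γ C).map (quotProj f hf)) ((γ C).map g)
          ((γ C).map (quotMap f hf (f ≫ g) (cof_trans hf hg) (𝟙 X) g
            (Category.id_comp _).symm))
          ((γ C).map (quotProj (f ≫ g) (cof_trans hf hg))) ∧
        IsHomotopyCartesian (K.δ (f ≫ g) (cof_trans hf hg))
          ((γ C).map (quotMap (f ≫ g) (cof_trans hf hg) g hg f (𝟙 Z)
            (Category.comp_id _)))
          (K.suspension.map ((γ C).map f)) (K.δ g hg)) ∧
      -- the homotopy category is strongly triangulated
      IsStronglyTriangulated (Ho C) := by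
  obtain ⟨_, _⟩ := K.exists_preadditive hstable
  obtain ⟨_, _, ⟨e⟩⟩ := exists_hasShift_of_isEquivalence K.suspension
  have hzero : HasZeroObject (Ho C) := ⟨_, isZero_γ_zero C⟩
  have hadd : ∀ n : ℤ, (shiftFunctor (Ho C) n).Additive := fun n =>
    Cones.additive_of_isEquivalence _
  let P : Pretriangulated (Ho C) := (K.forwardPretriangulated e).pretriangulated
  have he : distTriang (Ho C) = K.exactTriangles e := rfl
  exact ⟨_, hzero, _, hadd, P, e, fun T => Iff.rfl,
    fun f g hf hg => ⟨K.isHomotopyCartesian_quotProj e he f g hf hg,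
      K.isHomotopyCartesian_δ e he f g hf hg⟩, K.isStronglyTriangulated e he⟩
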